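/- **Theorem 4.1.** Notation: $H_n^{(m)}=\sum_{j=1}^n j^{-m}$ and $H_n=H_n^{(1)}$. For nonzero integers $s_1,\dots,s_d$ and $n\ge 0$, $$\zeta_n^\star(s_1,\dots,s_d)=\sum_{n\ge n_1\ge\cdots\ge n_d\ge1}\ \prod_{j=1}^d \frac{\operatorname{sgn}(s_j)^{n_j}}{n_j^{|s_j|}}$$ is the multiple harmonic star sum, of weight $\sum_j|s_j|$ and depth $d$. A bar denotes a negative entry, $\bar a=-a$, and $\{1\}_3$ means $1,1,1$. We write $\zeta^\star(\mathbf s)=\lim_{n\to\infty}\zeta_n^\star(\mathbf s)$ when the limit exists; a single zeta value $\zeta(m)$, $m\ge2$, has weight $m$ and depth $1$; $\mathrm{Li}_4(x)=\sum_{n\ge1}x^n/n^4$. For integers $k\ge1$ and $p\ge 0$ put $$\overline W_k(1,2;p)=\sum_{n=1}^\infty\frac{H_nH_n^{(2)}}{n^p\binom{n+k}{k}}(-1)^{n+1},\qquad \overline W_k(\{1\}_3;p)=\sum_{n=1}^\infty\frac{H_n^3}{n^p\binom{n+k}{k}}(-1)^{n+1}$$ (limits of partial sums). For $r\ge1$ let,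 with $\zeta^\star=\zeta^\star_{r-1}$ on the right-hand sides, $$\begin{aligned}A(r)={}&-\tfrac5{16}\zeta(4)-\tfrac14\zeta(2)\ln^22+\tfrac78\zeta(3)\ln2+\tfrac78\zeta(3)\zeta^\star(\bar1)-\tfrac14\zeta(3)H_{r-1}-\tfrac12\zeta(2)\zeta^\star(\bar2)\\&-\zeta^\star(3,\bar1)+\zeta^\star(1,2,\bar1)+\tfrac12\zeta(2)\zeta^\star(1,\bar1)+\zeta^\star(2,1,\bar1)+\ln2\,\{\zeta^\star(\bar3)-\zeta^\star(3)\}\\&-\tfrac12\ln2\,\zeta(2)\{\zeta^\star(\bar1)-\zeta^\star(1)\}+\tfrac12\ln^22\,\{\zeta^\star(\bar2)-\zeta^\star(2)\}\\&-\ln2\,\{\zeta^\star(2,\bar1)-\zeta^\star(2,1)\}-\ln2\,\{\zeta^\star(1,\bar2)-\zeta^\star(1,2)\},\end{aligned}$$ $$\begin{aligned}B(r)={}&-\tfrac5{16}\zeta(4)+\tfrac98\zeta(3)\ln2-\tfrac34\zeta(2)\ln^22+\tfrac14\ln^42+\tfrac98\zeta(3)\zeta^\star(\bar1)-\tfrac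12\zeta(2)\zeta^\star(\bar2)-\zeta^\star(3,\bar1)\\&+\tfrac32\zeta(2)\zeta^\star(1,\bar1)-\tfrac34\zeta(3)H_{r-1}+3\zeta^\star(1,2,\bar1)+3\zeta^\star(2,1,\bar1)-6\zeta^\star(\{1\}_3,\bar1)\\&+\ln2\,\{\zeta^\star(\bar3)-\zeta^\star(3)\}-3\ln2\,\{\zeta^\star(2,\bar1)-\zeta^\star(2,1)\}-3\ln2\,\{\zeta^\star(1,\bar2)-\zeta^\star(1,2)\}\\&+6\ln2\,\{\zeta^\star(1,1,\bar1)-\zeta^\star(\{1\}_3)\}-3\ln^22\,\{\zeta^\star(1,\bar1)-\zeta^\star(1,1)\}\\&+\tfrac32\ln^22\,\{\zeta^\star(\bar2)-\zeta^\star(2)\}+\{\ln^32-\tfrac32\ln2\,\zeta(2)\}\{\zeta^\star(\bar1)-\zeta^\star(1)\},\end{aligned}$$ and let $$a=2\,\mathrm{Li}_4(\tfrac12)+\tfrac1{12}\ln^42+\tfrac78\zeta(3)\ln2-\tfrac14\zeta(2)\ln^22-\zeta(4),\qquad b=\tfrac58\zeta(4)+\tfrac34\zeta(2)\ln^22-\tfrac14\ln^42-\tfrac98\zeta(3)\ln2.$$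 Then for every integer $k\ge1$ and $p\in\{0,1\}$ the two series converge, and: (i) they have the closed forms $$\overline W_k(1,2;0)=\sum_{r=1}^k r\binom kr A(r),\qquad \overline W_k(\{1\}_3;0)=\sum_{r=1}^k r\binom kr B(r),$$ $$\overline W_k(1,2;1)=\sum_{r=1}^k(-1)^{r+1}\binom kr\{a-(-1)^{r+1}A(r)\},\qquad \overline W_k(\{1\}_3;1)=\sum_{r=1}^k(-1)^{r+1}\binom kr\{b-(-1)^{r+1}B(r)\};$$ (ii) each of $\overline W_k(1,2;p)$ and $\overline W_k(\{1\}_3;p)$ is a linear combination, with rational coefficients, of products of single zeta values $\zeta(m)$ $(m\ge2)$, multiple harmonic star sums $\zeta_n^\star(\mathbf s)$ and their convergent limits $\zeta^\star(\mathbf s)$, where in each product the weights of the factors add up to at most $4$ and their depths add up to at most $4$. -/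

import Mathlib

open Filter Topology

noncomputable section

/-- The generalized harmonic number `H_n^{(m)} = ∑_{j=1}^n 1 / j^m`. -/
def genHarmonic (m n : ℕ) : ℝ := ∑ j ∈ Finset.Icc 1 n, 1 / (j : ℝ) ^ m

/-- The `N`-th partial sum (`1 ≤ n ≤ N`) of the series
`∑ H_n^{(m₁)} ⋯ H_n^{(m_r)} (-1)^{n+1} / (n^p * binom(n+k, k))`, with `m = [m₁, …, m_r]`. -/
def altSumPartial (m : List ℕ) (p k N : ℕ) : ℝ :=
  ∑ n ∈ Finset.Icc 1 N,
    (m.map fun i => genHarmonic i n).prod / ((n : ℝ) ^ p * ((n + k).choose k : ℝ)) *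
      (-1 : ℝ) ^ (n + 1)

/-- The series `W̄_k(m₁, …, m_r; p)` converges (as a limit of partial sums; it need not converge
absolutely) and its sum is `w`. -/
def IsAltSum (m : List ℕ) (p k : ℕ) (w : ℝ) : Prop :=
  Tendsto (altSumPartial m p k) atTop (𝓝 w)

/-- The multiple harmonic star sum `ζ⋆_n(s₁, …, s_d)`: the sum over
`n ≥ n₁ ≥ ⋯ ≥ n_d ≥ 1` of `∏ sgn(s_j)^{n_j} / n_j^{|s_j|}`, as an iterated sum, the outermost
index first. A barred entry is a negative one. The value at the empty list is `1`. -/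
def starSum : ℕ → List ℤ → ℝ
  | _, [] => 1
  | n, s :: t =>
      ∑ i ∈ Finset.Icc 1 n, ((s.sign : ℤ) : ℝ) ^ i / (i : ℝ) ^ s.natAbs * starSum i t

/-- The single zeta value `ζ(m)`, as a real number. -/
def zetaVal (m : ℕ) : ℝ := (riemannZeta (m : ℂ)).re

/-- `Li_m(x) = ∑_{n ≥ 1} x^n / n^m`. -/
def polyLog (m : ℕ) (x : ℝ) : ℝ := ∑' n : ℕ, x ^ (n + 1) / ((n : ℝ) + 1) ^ m

/-- The weight `|s₁| + ⋯ + |s_d|` of a composition. -/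
def starWeight (s : List ℤ) : ℕ := (s.map Int.natAbs).sum

/-- `StarMonomial w d x`: the real number `x` is a product of single zeta values `ζ(m)`, `m ≥ 2`,
of multiple harmonic star sums `ζ⋆_n(s)` and of convergent limits `ζ⋆(s) = lim_n ζ⋆_n(s)`;
the weights of the factors add up to `w` and their depths to `d`. -/
inductive StarMonomial : ℕ → ℕ → ℝ → Prop
  | one : StarMonomial 0 0 1
  | zeta_mul {w d : ℕ} {x : ℝ} (m : ℕ) (hm : 2 ≤ m) (hx : StarMonomial w d x) :
      StarMonomial (m + w) (1 + d) (zetaVal m * x)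
  | starSum_mul {w d : ℕ} {x : ℝ} (n : ℕ) (s : List ℤ) (hs : ∀ a ∈ s, a ≠ 0)
      (hx : StarMonomial w d x) :
      StarMonomial (starWeight s + w) (s.length + d) (starSum n s * x)
  | starLim_mul {w d : ℕ} {x : ℝ} (s : List ℤ) (hs : ∀ a ∈ s, a ≠ 0) (v : ℝ)
      (hv : Tendsto (fun n => starSum n s) atTop (𝓝 v)) (hx : StarMonomial w d x) :
      StarMonomial (starWeight s + w) (s.length + d) (v * x)

/-- Rational linear combinations of products of single zeta values and multiple harmonic star
sums of (total) weight at most `4` and (total) depth at most `4`. -/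
def starSpan : Submodule ℚ ℝ :=
  Submodule.span ℚ {x : ℝ | ∃ w d : ℕ, w ≤ 4 ∧ d ≤ 4 ∧ StarMonomial w d x}

/-- The closed form of `∑_{n ≥ 1} H_n H_n^{(2)} (-1)^{n+r} / (n + r)`, for `r ≥ 1`. -/
def shiftClosed12 (r : ℕ) : ℝ :=
  -(5 / 16) * zetaVal 4 - 1 / 4 * zetaVal 2 * Real.log 2 ^ 2 + 7 / 8 * zetaVal 3 * Real.log 2
    + 7 / 8 * zetaVal 3 * starSum (r - 1) [-1]
    - 1 / 4 * zetaVal 3 * genHarmonic 1 (r - 1)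
    - 1 / 2 * zetaVal 2 * starSum (r - 1) [-2]
    - starSum (r - 1) [3, -1] + starSum (r - 1) [1, 2, -1]
    + 1 / 2 * zetaVal 2 * starSum (r - 1) [1, -1] + starSum (r - 1) [2, 1, -1]
    + Real.log 2 * (starSum (r - 1) [-3] - starSum (r - 1) [3])
    - 1 / 2 * Real.log 2 * zetaVal 2 * (starSum (r - 1) [-1] - starSum (r - 1) [1])
    + 1 / 2 * Real.log 2 ^ 2 * (starSum (r - 1) [-2] - starSum (r - 1) [2])
    - Real.log 2 * (starSum (r - 1) [2, -1] - starSum (r - 1) [2, 1])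
    - Real.log 2 * (starSum (r - 1) [1, -2] - starSum (r - 1) [1, 2])

/-- The closed form of `∑_{n ≥ 1} H_n^3 (-1)^{n+r} / (n + r)`, for `r ≥ 1`. -/
def shiftClosed111 (r : ℕ) : ℝ :=
  -(5 / 16) * zetaVal 4 + 9 / 8 * zetaVal 3 * Real.log 2 - 3 / 4 * zetaVal 2 * Real.log 2 ^ 2
    + 1 / 4 * Real.log 2 ^ 4
    + 9 / 8 * zetaVal 3 * starSum (r - 1) [-1]
    - 1 / 2 * zetaVal 2 * starSum (r - 1) [-2]
    - starSum (r - 1) [3, -1]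
    + 3 / 2 * zetaVal 2 * starSum (r - 1) [1, -1]
    - 3 / 4 * zetaVal 3 * genHarmonic 1 (r - 1)
    + 3 * starSum (r - 1) [1, 2, -1] + 3 * starSum (r - 1) [2, 1, -1]
    - 6 * starSum (r - 1) [1, 1, 1, -1]
    + Real.log 2 * (starSum (r - 1) [-3] - starSum (r - 1) [3])
    - 3 * Real.log 2 * (starSum (r - 1) [2, -1] - starSum (r - 1) [2, 1])
    - 3 * Real.log 2 * (starSum (r - 1) [1, -2] - starSum (r - 1) [1, 2])
    + 6 * Real.log 2 * (starSum (r - 1) [1, 1, -1] - starSum (r - 1) [1, 1, 1])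
    - 3 * Real.log 2 ^ 2 * (starSum (r - 1) [1, -1] - starSum (r - 1) [1, 1])
    + 3 / 2 * Real.log 2 ^ 2 * (starSum (r - 1) [-2] - starSum (r - 1) [2])
    + (Real.log 2 ^ 3 - 3 / 2 * Real.log 2 * zetaVal 2)
        * (starSum (r - 1) [-1] - starSum (r - 1) [1])

/-- The closed form of `∑_{n ≥ 1} H_n H_n^{(2)} (-1)^{n-1} / n`. -/
def baseClosed12 : ℝ :=
  2 * polyLog 4 (1 / 2) + 1 / 12 * Real.log 2 ^ 4 + 7 / 8 * zetaVal 3 * Real.log 2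
    - 1 / 4 * zetaVal 2 * Real.log 2 ^ 2 - zetaVal 4

/-- The closed form of `∑_{n ≥ 1} H_n^3 (-1)^{n-1} / n`. -/
def baseClosed111 : ℝ :=
  5 / 8 * zetaVal 4 + 3 / 4 * zetaVal 2 * Real.log 2 ^ 2 - 1 / 4 * Real.log 2 ^ 4
    - 9 / 8 * zetaVal 3 * Real.log 2

end

/-! Write S(c, r) for the sum of c_n (-1)^(n+r) / (n+r) over n ≥ 1, a limit of partial sums
(`HasAltShift`). Partial fractions in n of 1 / binom(n+k, k) and 1 / (n binom(n+k, k)) turn the four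
series into finite combinations of S(c, r), 0 ≤ r ≤ k, with c_n = H_n H_n^(2) or c_n = H_n^3. Hence
A(r) and B(r) have to be the values S(c, r) for r ≥ 1, and -a and -b the values S(c, 0).

Two rules move r. If d_n = c_n - c_{n-1}, then S(c, r+1) = S(c, r) - S(d, r) (`HasAltShift.succ`).
From 1/(n(n+r)) = (1/n - 1/(n+r))/r, the value S(c_n/n, r) follows from S(c, 0) and S(c, r)
(`HasAltShift.div`). Differences of products of harmonic numbers are simpler products divided by
powers of n, so all reduces to values at r = 0. Iterating the first rule sums factors 1/j over j <
r, and these nested sums are the star sums at r - 1.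

At r = 0, Abel's theorem gives S(c, 0) as the limit at -1 of ∑ c_n x^n/n = ∑ d_n x^n/n + F(x), where
F' = ∑ d_n x^n / (1-x). Integration by parts makes F a polynomial in log(1-x), Li_2, Li_3 and ∑ H_n
x^n/n^2 (`hasDerivAt_shiftGen12`, `hasDerivAt_shiftGen111`). What remains is S(d, 0) and ∑ (-1)^n
H_n/n^2. With a = log(1-u) and b = log(1+u), these come from integrals over (0, 1) against du/u:
2a^2 + 2b^2 = (a+b)^2 + (a-b)^2 gives `hasAltShift_H_div`, a^3 + 3ab^2 = ((a+b)^3 + (a-b)^3)/2 gives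
`tsum_mixed`, and v = 1/(1+u) in the integral of b^3 gives `hasAltShift_cubeCoeff`, where Li_4(1/2)
enters.

For the second claim, ln 2 = -ζ⋆(-1) makes every term of A, B and b admissible on sight. The
constant a contains Li_4(1/2), which is not an allowed factor; but a = -S(d, 0) - A(1), and S(d, 0)
= ζ⋆(-3,1) + ζ⋆(-2,2) - ζ⋆(-4) (`baseClosed12_mem`). -/

noncomputable section

/-! ### Sequences of polynomial growth. -/

/-- Sequences bounded by a polynomial. -/
def PolyGrowth (c : ℕ → ℝ) : Prop := ∃ (C : ℝ) (k : ℕ), ∀ n, |c n| ≤ C * ((n : ℝ) + 1) ^ k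

/-- The generating function `∑ c_n x^n`. -/
def gen (c : ℕ → ℝ) (x : ℝ) : ℝ := ∑' n, c n * x ^ n

namespace PolyGrowth

variable {c d : ℕ → ℝ}

lemma exists_nonneg (hc : PolyGrowth c) :
    ∃ (C : ℝ) (k : ℕ), 0 ≤ C ∧ ∀ n, |c n| ≤ C * ((n : ℝ) + 1) ^ k := by
  obtain ⟨C, k, h⟩ := hc
  refine ⟨C, k, ?_, h⟩
  have := (abs_nonneg _).trans (h 0)
  simpa using this

lemma mul (hc : PolyGrowth c) (hd : PolyGrowth d) : PolyGrowth fun n => c n * d n := by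
  obtain ⟨C, k, hC, h⟩ := hc.exists_nonneg
  obtain ⟨D, l, hD, h'⟩ := hd.exists_nonneg
  refine ⟨C * D, k + l, fun n => ?_⟩
  rw [abs_mul]
  calc |c n| * |d n| ≤ (C * ((n : ℝ) + 1) ^ k) * (D * ((n : ℝ) + 1) ^ l) :=
        mul_le_mul (h n) (h' n) (abs_nonneg _) (by positivity)
    _ = _ := by ring

lemma add (hc : PolyGrowth c) (hd : PolyGrowth d) : PolyGrowth fun n => c n + d n := by
  obtain ⟨C, k, hC, h⟩ := hc.exists_nonneg
  obtain ⟨D, l, hD, h'⟩ := hd.exists_nonneg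
  refine ⟨C + D, k + l, fun n => ?_⟩
  have h1 : (1 : ℝ) ≤ (n : ℝ) + 1 := by linarith [Nat.cast_nonneg (α := ℝ) n]
  have h2 : ((n : ℝ) + 1) ^ k ≤ ((n : ℝ) + 1) ^ (k + l) := pow_le_pow_right₀ h1 (by omega)
  have h3 : ((n : ℝ) + 1) ^ l ≤ ((n : ℝ) + 1) ^ (k + l) := pow_le_pow_right₀ h1 (by omega)
  calc |c n + d n| ≤ |c n| + |d n| := abs_add_le _ _
    _ ≤ C * ((n : ℝ) + 1) ^ k + D * ((n : ℝ) + 1) ^ l := add_le_add (h n) (h' n)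
    _ ≤ C * ((n : ℝ) + 1) ^ (k + l) + D * ((n : ℝ) + 1) ^ (k + l) := by gcongr
    _ = _ := by ring

lemma const (a : ℝ) : PolyGrowth fun _ => a := ⟨|a|, 0, fun n => by simp⟩

lemma sub (hc : PolyGrowth c) (hd : PolyGrowth d) : PolyGrowth fun n => c n - d n := by
  simpa [sub_eq_add_neg] using hc.add ((const (-1)).mul hd)

lemma pow (hc : PolyGrowth c) (m : ℕ) : PolyGrowth fun n => c n ^ m := by
  induction m with
  | zero => simpa using const 1
  | succ m ih => simpa [pow_succ] using ih.mul hc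

lemma inv_pow (m : ℕ) : PolyGrowth fun n => 1 / (n : ℝ) ^ m := by
  refine ⟨1, 0, fun n => ?_⟩
  rcases Nat.eq_zero_or_pos n with rfl | hn
  · rcases Nat.eq_zero_or_pos m with rfl | hm
    · simp
    · simp [hm.ne']
  · have : (1 : ℝ) ≤ (n : ℝ) ^ m := one_le_pow₀ (by exact_mod_cast hn)
    rw [abs_of_nonneg (by positivity)]
    simpa using inv_le_one_of_one_le₀ this

lemma div_pow (hc : PolyGrowth c) (m : ℕ) : PolyGrowth fun n => c n / (n : ℝ) ^ m := by
  simpa [div_eq_mul_inv] using hc.mul (inv_pow m)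

lemma div_nat (hc : PolyGrowth c) : PolyGrowth fun n => c n / (n : ℝ) := by
  simpa using hc.div_pow 1

lemma genHarmonic (m : ℕ) : PolyGrowth (genHarmonic m) := by
  refine ⟨1, 1, fun n => ?_⟩
  unfold _root_.genHarmonic
  rw [abs_of_nonneg (Finset.sum_nonneg fun i _ => by positivity)]
  have : ∑ j ∈ Finset.Icc 1 n, 1 / (j : ℝ) ^ m ≤ ∑ j ∈ Finset.Icc 1 n, (1 : ℝ) := by
    refine Finset.sum_le_sum fun j hj => ?_
    have : (1 : ℝ) ≤ (j : ℝ) ^ m :=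
      one_le_pow₀ (by exact_mod_cast (Finset.mem_Icc.1 hj).1)
    simpa using inv_le_one_of_one_le₀ this
  simp at this ⊢
  linarith

lemma summable_bound (k : ℕ) {r : ℝ} (hr0 : 0 ≤ r) (hr : r < 1) :
    Summable fun n : ℕ => ((n : ℝ) + 1) ^ k * r ^ n := by
  rcases eq_or_lt_of_le hr0 with rfl | h0
  · refine summable_of_ne_finset_zero (s := {0}) fun n hn => ?_
    simp at hn
    simp [hn]
  have h : Summable fun n : ℕ => ((n : ℝ)) ^ k * r ^ n :=
    summable_pow_mul_geometric_of_norm_lt_one k (by rwa [Real.norm_of_nonneg hr0])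
  -- Shifting the index by one produces an extra factor r, which is divided out; hence the separate
  -- case r = 0.
  have h2 := ((summable_nat_add_iff 1).2 h).mul_right r⁻¹
  refine h2.congr fun n => ?_
  push_cast
  field_simp
  ring

lemma summable (hc : PolyGrowth c) {x : ℝ} (hx : |x| < 1) : Summable fun n => c n * x ^ n := by
  obtain ⟨C, k, hC, h⟩ := hc.exists_nonneg
  refine Summable.of_norm_bounded ((summable_bound k (abs_nonneg x) hx).mul_left C) fun n => ?_
  rw [norm_mul, norm_pow, Real.norm_eq_abs, Real.norm_eq_abs, ← mul_assoc]
  gcongr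
  exact h n

end PolyGrowth

/-! ### Generating functions: termwise differentiation and Abel's theorem. -/

section gen

variable {c d : ℕ → ℝ} {x : ℝ}

lemma gen_zero (h0 : c 0 = 0) : gen c 0 = 0 := by
  unfold gen
  rw [tsum_eq_single 0]
  · simp [h0]
  · intro n hn
    simp [hn]

lemma gen_add (hc : PolyGrowth c) (hd : PolyGrowth d) (hx : |x| < 1) :
    gen (fun n => c n + d n) x = gen c x + gen d x := by
  unfold gen
  rw [← (hc.summable hx).tsum_add (hd.summable hx)]
  simp only [add_mul]

lemma gen_sub (hc : PolyGrowth c) (hd : PolyGrowth d) (hx : |x| < 1) :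
    gen (fun n => c n - d n) x = gen c x - gen d x := by
  unfold gen
  rw [← (hc.summable hx).tsum_sub (hd.summable hx)]
  simp only [sub_mul]

lemma gen_const_mul (a : ℝ) : gen (fun n => a * c n) x = a * gen c x := by
  unfold gen
  rw [← tsum_mul_left]
  simp only [mul_assoc]

/-- `(1 - x) ∑ c_n x^n = ∑ (c_n - c_{n-1}) x^n`. -/
lemma gen_eq_div_one_sub (hc : PolyGrowth c) (hd : PolyGrowth d) (h0 : c 0 = d 0)
    (h : ∀ n, c (n + 1) = c n + d (n + 1)) (hx : |x| < 1) : gen c x = gen d x / (1 - x) := by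
  have hx1 : 1 - x ≠ 0 := by
    have := (abs_lt.1 hx).2
    linarith
  rw [eq_div_iff hx1]
  unfold gen
  have hs := hc.summable hx
  have hs' := hd.summable hx
  have e1 : ∑' n, c n * x ^ n = c 0 + ∑' n, c (n + 1) * x ^ (n + 1) := by
    rw [hs.tsum_eq_zero_add]; simp
  have e2 : ∑' n, d n * x ^ n = d 0 + ∑' n, d (n + 1) * x ^ (n + 1) := by
    rw [hs'.tsum_eq_zero_add]; simp
  have e3 : ∑' n, c (n + 1) * x ^ (n + 1)
      = x * ∑' n, c n * x ^ n + ∑' n, d (n + 1) * x ^ (n + 1) := by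
    rw [← tsum_mul_left, ← (hs.mul_left x).tsum_add ((summable_nat_add_iff 1).2 hs')]
    refine tsum_congr fun n => ?_
    rw [h]; ring
  linear_combination e1 - e2 + e3 + h0

lemma hasDerivAt_gen (hc : PolyGrowth c) (hx : |x| < 1) :
    HasDerivAt (gen c) (∑' n : ℕ, (n : ℝ) * c n * x ^ (n - 1)) x := by
  obtain ⟨ρ, hxρ, hρ⟩ := exists_between hx
  have hρ0 : 0 < ρ := (abs_nonneg x).trans_lt hxρ
  obtain ⟨C, k, hC, h⟩ := hc.exists_nonneg
  -- Differentiation costs a factor n, absorbed by the exponent k + 1, and one power of y, absorbed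
  -- by ρ⁻¹.
  have hu := ((PolyGrowth.summable_bound (k + 1) hρ0.le hρ).mul_left (C * ρ⁻¹))
  refine hasDerivAt_tsum_of_isPreconnected (t := Metric.ball 0 ρ) (y₀ := 0) hu
    Metric.isOpen_ball (convex_ball 0 ρ).isPreconnected
    (g' := fun (n : ℕ) y => (n : ℝ) * c n * y ^ (n - 1)) ?_ ?_ (by simpa using hρ0) ?_ (by simpa using hxρ)
  · intro n y _
    simpa [mul_comm, mul_assoc, mul_left_comm] using (hasDerivAt_pow n y).const_mul (c n)
  · intro n y hy
    have hy' : |y| < ρ := by simpa using hy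
    rcases Nat.eq_zero_or_pos n with rfl | hn
    · simp; positivity
    · rw [norm_mul, norm_mul, norm_pow, Real.norm_eq_abs, Real.norm_eq_abs, Real.norm_eq_abs]
      obtain ⟨m, rfl⟩ : ∃ m, n = m + 1 := ⟨n - 1, by omega⟩
      have e : C * ρ⁻¹ * ((((m + 1 : ℕ) : ℝ) + 1) ^ (k + 1) * ρ ^ (m + 1))
          = (((m + 1 : ℕ) : ℝ) + 1) * (C * (((m + 1 : ℕ) : ℝ) + 1) ^ k) * ρ ^ m := by
        field_simp
        ring
      rw [e, Nat.add_sub_cancel]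
      gcongr
      · rw [abs_of_nonneg (by positivity)]; linarith
      · exact h _
  · exact hc.summable (by simp)

/-- Dividing coefficients by n is integration against dx/x. The closed forms of generating functions
with a division by n are checked by comparing this derivative. -/
lemma hasDerivAt_gen_div (hc : PolyGrowth c) (h0 : c 0 = 0) (hx : |x| < 1) (hx0 : x ≠ 0) :
    HasDerivAt (gen fun n => c n / n) (gen c x / x) x := by
  convert hasDerivAt_gen hc.div_nat hx using 1
  unfold gen
  rw [← tsum_div_const]
  refine tsum_congr fun n => ?_
  rcases Nat.eq_zero_or_pos n with rfl | hn
  · simp [h0]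
  · obtain ⟨m, rfl⟩ : ∃ m, n = m + 1 := ⟨n - 1, by omega⟩
    have : ((m + 1 : ℕ) : ℝ) ≠ 0 := by positivity
    rw [Nat.add_sub_cancel]
    field_simp
    ring

lemma continuousAt_gen (hc : PolyGrowth c) (hx : |x| < 1) : ContinuousAt (gen c) x :=
  (hasDerivAt_gen hc hx).continuousAt

/-- Abel's limit theorem at `-1`. -/
lemma tendsto_gen_neg_one {l : ℝ}
    (h : Tendsto (fun N => ∑ n ∈ Finset.range N, c n * (-1) ^ n) atTop (𝓝 l)) :
    Tendsto (gen c) (𝓝[>] (-1)) (𝓝 l) := by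
  have h1 := Real.tendsto_tsum_powerSeries_nhdsWithin_lt h
  have h2 : Tendsto (fun x : ℝ => -x) (𝓝[>] (-1)) (𝓝[<] 1) := by
    refine tendsto_nhdsWithin_of_tendsto_nhds_of_eventually_within _ ?_ ?_
    · exact tendsto_nhdsWithin_of_tendsto_nhds (by simpa using (continuous_neg.tendsto (-1 : ℝ)))
    · filter_upwards [self_mem_nhdsWithin] with x hx
      simp only [Set.mem_Ioi, Set.mem_Iio] at *
      linarith
  refine (h1.comp h2).congr fun x => ?_
  simp only [Function.comp, gen]
  refine tsum_congr fun n => ?_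
  rw [mul_assoc, ← mul_pow]
  simp

lemma polyLog_eq_gen {s : ℕ} (hs : s ≠ 0) (x : ℝ) : polyLog s x = gen (fun n => 1 / (n : ℝ) ^ s) x := by
  unfold polyLog gen
  -- No bound on x is needed: where the series diverges, both `tsum`s take the default value 0. The
  -- term n = 0 is 1/0 = 0 because s ≠ 0.
  by_cases h : Summable fun n : ℕ => 1 / (n : ℝ) ^ s * x ^ n
  · rw [h.tsum_eq_zero_add]
    simp only [Nat.cast_zero, zero_pow hs]
    simp only [div_zero, zero_mul, zero_add]
    refine tsum_congr fun n => ?_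
    push_cast
    ring
  · rw [tsum_eq_zero_of_not_summable h, tsum_eq_zero_of_not_summable]
    intro h'
    apply h
    rw [← summable_nat_add_iff 1]
    refine h'.congr fun n => ?_
    push_cast
    ring

/-- Two functions on `(-1, 0]` with equal derivatives on `(-1, 0)` and equal values at `0`. -/
lemma eq_of_hasDerivAt_Ioo {f g f' : ℝ → ℝ} (hf : ∀ x, -1 < x → x < 0 → HasDerivAt f (f' x) x)
    (hg : ∀ x, -1 < x → x < 0 → HasDerivAt g (f' x) x) (hf0 : ContinuousAt f 0)
    (hg0 : ContinuousAt g 0) (h0 : f 0 = g 0) (hx : -1 < x) (hx0 : x < 0) : f x = g x := by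
  -- On [x, 0] the derivative is only needed on [x, 0), so continuity suffices at 0, where the
  -- quotients by x are not available.
  have key := constant_of_has_deriv_right_zero (f := fun y => f y - g y) (a := x) (b := 0) ?_ ?_
    0 ⟨hx0.le, le_rfl⟩
  · simp only [h0] at key
    linarith
  · intro y hy
    refine ContinuousAt.continuousWithinAt ?_
    rcases eq_or_lt_of_le hy.2 with rfl | h
    · exact hf0.sub hg0
    · exact ((hf y (by linarith [hy.1]) h).sub (hg y (by linarith [hy.1]) h)).continuousAt
  · intro y hy
    have := ((hf y (by linarith [hy.1]) hy.2).sub (hg y (by linarith [hy.1]) hy.2))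
    rw [sub_self] at this
    exact this.hasDerivWithinAt

end gen

/-! ### Harmonic numbers and the majorant H_n^3. -/

lemma genHarmonic_zero (m : ℕ) : genHarmonic m 0 = 0 := by simp [genHarmonic]

lemma genHarmonic_succ (m n : ℕ) :
    genHarmonic m (n + 1) = genHarmonic m n + 1 / ((n + 1 : ℕ) : ℝ) ^ m := by
  unfold genHarmonic
  rw [Finset.sum_Icc_succ_top (by omega)]

lemma genHarmonic_nonneg (m n : ℕ) : 0 ≤ genHarmonic m n :=
  Finset.sum_nonneg fun _ _ => by positivity

lemma one_le_genHarmonic (m : ℕ) {n : ℕ} (hn : 1 ≤ n) : 1 ≤ genHarmonic m n := by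
  unfold genHarmonic
  have := Finset.single_le_sum (f := fun j : ℕ => 1 / (j : ℝ) ^ m) (s := Finset.Icc 1 n)
    (fun i _ => by positivity) (Finset.mem_Icc.2 ⟨le_rfl, hn⟩)
  simpa using this

lemma genHarmonic_two_le (n : ℕ) : genHarmonic 2 n ≤ genHarmonic 1 n := by
  refine Finset.sum_le_sum fun j hj => ?_
  have h1 : (1 : ℝ) ≤ j := by exact_mod_cast (Finset.mem_Icc.1 hj).1
  have : (j : ℝ) ^ 1 ≤ (j : ℝ) ^ 2 := pow_le_pow_right₀ h1 (by norm_num)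
  exact one_div_le_one_div_of_le (by positivity) this

lemma genHarmonic_one_le (n : ℕ) (hn : 1 ≤ n) : genHarmonic 1 n ≤ 7 * (n : ℝ) ^ (1 / 6 : ℝ) := by
  have h1 : genHarmonic 1 n = (harmonic n : ℝ) := by
    rw [harmonic_eq_sum_Icc, genHarmonic]
    push_cast
    simp
  rw [h1]
  have h2 := harmonic_le_one_add_log n
  have hn1 : (1 : ℝ) ≤ n := by exact_mod_cast hn
  -- The exponent 1/6 makes H_n^3 = O(n^(1/2)); here log n ≤ 6 n^(1/6), and 7 = 1 + 6.
  have h3 := Real.log_le_rpow_div (x := (n : ℝ)) (by positivity) (ε := 1 / 6) (by norm_num)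
  have h4 : (1 : ℝ) ≤ (n : ℝ) ^ (1 / 6 : ℝ) := Real.one_le_rpow hn1 (by norm_num)
  linarith

lemma genHarmonic_one_cube_le (n : ℕ) (hn : 1 ≤ n) :
    genHarmonic 1 n ^ 3 ≤ 343 * (n : ℝ) ^ (1 / 2 : ℝ) := by
  have h := pow_le_pow_left₀ (genHarmonic_nonneg 1 n) (genHarmonic_one_le n hn) 3
  rw [mul_pow, ← Real.rpow_natCast ((n : ℝ) ^ (1 / 6 : ℝ)), ← Real.rpow_mul (by positivity)] at h
  norm_num at h ⊢
  exact h

/-- Since H_n ≥ 1, the harmonic products occurring below are all bounded by a multiple of H_n^3, so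
this single series is the common majorant for the convergence proofs. -/
lemma summable_genHarmonic_cube : Summable fun n : ℕ => genHarmonic 1 n ^ 3 / (n : ℝ) ^ 2 := by
  have h : Summable fun n : ℕ => 343 * (1 / (n : ℝ) ^ (3 / 2 : ℝ)) :=
    (Real.summable_one_div_nat_rpow.2 (by norm_num)).mul_left _
  refine Summable.of_nonneg_of_le (fun n => ?_) (fun n => ?_) h
  · have := genHarmonic_nonneg 1 n
    positivity
  · rcases Nat.eq_zero_or_pos n with rfl | hn
    · simp
    · have hn' : (0 : ℝ) < n := by exact_mod_cast hn
      rw [div_le_iff₀ (by positivity)]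
      have e : (n : ℝ) ^ 2 = (n : ℝ) ^ (3 / 2 : ℝ) * (n : ℝ) ^ (1 / 2 : ℝ) := by
        rw [← Real.rpow_add hn']; norm_num
      rw [e]
      have := genHarmonic_one_cube_le n hn
      have h2 : (0 : ℝ) < (n : ℝ) ^ (3 / 2 : ℝ) := by positivity
      calc _ ≤ _ := this
        _ = _ := by field_simp

/-- A sequence bounded by `C H_n^3 / n^2` is summable. -/
lemma summable_of_le_genHarmonic_cube {f : ℕ → ℝ} (C : ℝ)
    (h : ∀ n, 1 ≤ n → |f n| ≤ C * (genHarmonic 1 n ^ 3 / (n : ℝ) ^ 2)) : Summable f := by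
  rw [← summable_nat_add_iff 1]
  refine Summable.of_norm_bounded
    ((summable_nat_add_iff 1).2 (summable_genHarmonic_cube.mul_left C)) fun n => ?_
  exact h _ (by omega)

lemma tendsto_genHarmonic_cube_div : Tendsto (fun n : ℕ => genHarmonic 1 n ^ 3 / n) atTop (𝓝 0) := by
  have h : Tendsto (fun n : ℕ => 343 * ((n : ℝ) ^ (-(1 / 2) : ℝ))) atTop (𝓝 (343 * 0)) :=
    ((tendsto_rpow_neg_atTop (by norm_num)).comp tendsto_natCast_atTop_atTop).const_mul _
  rw [mul_zero] at h
  refine squeeze_zero' (Eventually.of_forall fun n => ?_) ?_ h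
  · have := genHarmonic_nonneg 1 n
    positivity
  · filter_upwards [eventually_ge_atTop 1] with n hn
    have hn' : (0 : ℝ) < n := by exact_mod_cast hn
    rw [div_le_iff₀ hn']
    have e : (n : ℝ) ^ (-(1 / 2) : ℝ) * n = (n : ℝ) ^ (1 / 2 : ℝ) := by
      nth_rw 2 [← Real.rpow_one (n : ℝ)]
      rw [← Real.rpow_add hn']; norm_num
    rw [mul_assoc, e]
    exact genHarmonic_one_cube_le n hn

/-! ### Alternating sums with shifted denominators. -/

/-- The partial sums `∑_{n=1}^N c_n (-1)^(n+r) / (n+r)`. -/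
def altShift (c : ℕ → ℝ) (r N : ℕ) : ℝ :=
  ∑ n ∈ Finset.Icc 1 N, c n * (-1) ^ (n + r) / ((n : ℝ) + r)

/-- `∑_{n≥1} c_n (-1)^(n+r) / (n+r) = x`, as a limit of partial sums. -/
def HasAltShift (c : ℕ → ℝ) (r : ℕ) (x : ℝ) : Prop := Tendsto (altShift c r) atTop (𝓝 x)

namespace HasAltShift

variable {c d : ℕ → ℝ} {r : ℕ} {x y : ℝ}

lemma add (hc : HasAltShift c r x) (hd : HasAltShift d r y) :
    HasAltShift (fun n => c n + d n) r (x + y) := by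
  refine (Tendsto.add hc hd).congr fun N => ?_
  simp only [altShift, ← Finset.sum_add_distrib]
  exact Finset.sum_congr rfl fun n _ => by ring

lemma const_mul (a : ℝ) (hc : HasAltShift c r x) : HasAltShift (fun n => a * c n) r (a * x) := by
  refine (Tendsto.const_mul a hc).congr fun N => ?_
  simp only [altShift, Finset.mul_sum]
  exact Finset.sum_congr rfl fun n _ => by ring

lemma sub (hc : HasAltShift c r x) (hd : HasAltShift d r y) :
    HasAltShift (fun n => c n - d n) r (x - y) := by
  refine (Tendsto.sub hc hd).congr fun N => ?_
  simp only [altShift, ← Finset.sum_sub_distrib]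
  exact Finset.sum_congr rfl fun n _ => by ring

lemma unique (hc : HasAltShift c r x) (hd : HasAltShift c r y) : x = y :=
  tendsto_nhds_unique hc hd

end HasAltShift

/-- Substituting n + 1 for n changes c_n into c_{n+1} - d_{n+1} and leaves sign and denominator
intact; the new first term is c_1 - d_1 = c_0 = 0. -/
lemma altShift_succ {c d : ℕ → ℝ} (h0 : c 0 = 0) (h : ∀ n, c (n + 1) = c n + d (n + 1)) (r N : ℕ) :
    altShift c (r + 1) N = altShift c r (N + 1) - altShift d r (N + 1) := by
  unfold altShift
  rw [← Finset.sum_sub_distrib]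
  have e : ∀ f : ℕ → ℝ, ∑ n ∈ Finset.Icc 1 (N + 1), f n
      = f 1 + ∑ n ∈ Finset.Icc 1 N, f (n + 1) := by
    intro f
    induction N with
    | zero => simp
    | succ N ih => rw [Finset.sum_Icc_succ_top (by omega), ih, Finset.sum_Icc_succ_top (by omega)]; ring
  rw [e]
  have h1 := h 0
  rw [h0] at h1
  simp only [zero_add] at h1
  rw [h1, sub_self, zero_add]
  refine Finset.sum_congr rfl fun n _ => ?_
  rw [h n]
  push_cast
  ring

/-- Shifting the denominators by one. -/
lemma HasAltShift.succ {c d : ℕ → ℝ} {r : ℕ} {x y : ℝ} (h0 : c 0 = 0)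
    (h : ∀ n, c (n + 1) = c n + d (n + 1)) (hc : HasAltShift c r x) (hd : HasAltShift d r y) :
    HasAltShift c (r + 1) (x - y) := by
  refine (((tendsto_add_atTop_iff_nat 1).2 hc).sub ((tendsto_add_atTop_iff_nat 1).2 hd)).congr
    fun N => ?_
  rw [altShift_succ h0 h]

/-- Dividing the coefficients by `n`, by partial fractions. -/
lemma HasAltShift.div {c : ℕ → ℝ} {r : ℕ} {x y : ℝ} (hr : 1 ≤ r) (h0 : HasAltShift c 0 x)
    (hc : HasAltShift c r y) : HasAltShift (fun n => c n / n) r (((-1) ^ r * x - y) / r) := by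
  refine (((Tendsto.const_mul ((-1) ^ r) h0).sub hc).div_const (r : ℝ)).congr fun N => ?_
  simp only [altShift, Finset.mul_sum, ← Finset.sum_sub_distrib, Finset.sum_div]
  refine Finset.sum_congr rfl fun n hn => ?_
  have h1 : (n : ℝ) ≠ 0 := by
    have := (Finset.mem_Icc.1 hn).1
    positivity
  have h2 : (r : ℝ) ≠ 0 := by positivity
  have h3 : (n : ℝ) + r ≠ 0 := by positivity
  simp only [Nat.cast_zero, add_zero]
  field_simp
  ring

lemma sum_Icc_eq_sum_range {f : ℕ → ℝ} (h0 : f 0 = 0) (N : ℕ) :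
    ∑ n ∈ Finset.Icc 1 N, f n = ∑ n ∈ Finset.range (N + 1), f n := by
  induction N with
  | zero => simp [h0]
  | succ N ih => rw [Finset.sum_Icc_succ_top (by omega), ih, Finset.sum_range_succ _ (N + 1)]

lemma hasAltShift_of_summable {c : ℕ → ℝ} {r : ℕ} (h0 : c 0 = 0)
    (hs : Summable fun n : ℕ => c n * (-1) ^ (n + r) / ((n : ℝ) + r)) :
    HasAltShift c r (∑' n : ℕ, c n * (-1) ^ (n + r) / ((n : ℝ) + r)) := by
  refine ((tendsto_add_atTop_iff_nat 1).2 hs.hasSum.tendsto_sum_nat).congr fun N => ?_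
  rw [altShift, sum_Icc_eq_sum_range]
  simp [h0]

lemma summable_alt_of_summable_abs {c : ℕ → ℝ} (h : Summable fun n : ℕ => |c n| / n) :
    Summable fun n : ℕ => c n * (-1) ^ (n + 0) / ((n : ℝ) + (0 : ℕ)) := by
  refine Summable.of_norm_bounded h fun n => ?_
  simp

/-- Convergence of `∑ (-1)^n c_n / n`, when `c` grows slowly and its differences are small. -/
lemma exists_hasAltShift_zero {c d : ℕ → ℝ} (h0 : c 0 = 0) (hd0 : d 0 = 0)
    (h : ∀ n, c (n + 1) = c n + d (n + 1)) (hc : Tendsto (fun n : ℕ => c n / n) atTop (𝓝 0))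
    (hs : Summable fun n : ℕ => |c n| / (n : ℝ) ^ 2) (hd : Summable fun n : ℕ => |d n| / n) :
    ∃ x, HasAltShift c 0 x := by
  have hD := hasAltShift_of_summable hd0 (summable_alt_of_summable_abs hd)
  -- The sum of the partial sums for shifts 0 and 1 has terms c_n (-1)^n (1/n - 1/(n+1)), which
  -- converge absolutely.
  have hs' : Summable fun n : ℕ => c n * (-1) ^ n / ((n : ℝ) * (n + 1)) := by
    refine Summable.of_norm_bounded hs fun n => ?_
    rcases Nat.eq_zero_or_pos n with rfl | hn
    · simp
    · rw [norm_div, norm_mul, norm_pow, norm_neg, norm_one, one_pow, mul_one, Real.norm_eq_abs,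
        Real.norm_of_nonneg (by positivity)]
      gcongr
      nlinarith
  have hS := (tendsto_add_atTop_iff_nat 1).2 hs'.hasSum.tendsto_sum_nat
  have hlim : Tendsto (fun N => (c (N + 1) * (-1) ^ (N + 1) / ((N + 1 : ℕ) : ℝ))) atTop (𝓝 0) := by
    have := (tendsto_add_atTop_iff_nat 1).2 hc
    rw [tendsto_zero_iff_abs_tendsto_zero] at this ⊢
    refine this.congr fun N => ?_
    simp [abs_div, abs_mul]
  -- By `altShift_succ`, shift 1 at N is shift 0 at N + 1 minus the d-sum. So twice the shift 0 sum
  -- is the absolutely convergent sum plus the d-sum minus the last term, which tends to 0.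
  have hfin := ((Tendsto.add hS ((tendsto_add_atTop_iff_nat 1).2 hD)).sub hlim).div_const 2
  refine ⟨_, hfin.congr fun N => ?_⟩
  have e1 := altShift_succ h0 h 0 N
  have e2 : altShift c 0 (N + 1) = altShift c 0 N + c (N + 1) * (-1) ^ (N + 1) / ((N + 1 : ℕ) : ℝ) := by
    unfold altShift
    rw [Finset.sum_Icc_succ_top (by omega)]
    simp
  have e3 : ∑ n ∈ Finset.range (N + 1), c n * (-1) ^ n / ((n : ℝ) * (n + 1))
      = altShift c 0 N + altShift c (0 + 1) N := by
    rw [← sum_Icc_eq_sum_range (by simp)]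
    unfold altShift
    rw [← Finset.sum_add_distrib]
    refine Finset.sum_congr rfl fun n hn => ?_
    have h1 : (n : ℝ) ≠ 0 := by
      have := (Finset.mem_Icc.1 hn).1
      positivity
    have h2 : (n : ℝ) + 1 ≠ 0 := by positivity
    push_cast
    simp only [add_zero]
    field_simp
    ring
  linarith

/-- Abel's theorem: the generating function of `c_n / n` tends to `∑ (-1)^n c_n / n`. -/
lemma HasAltShift.tendsto_gen {c : ℕ → ℝ} {x : ℝ} (hc : HasAltShift c 0 x) :
    Tendsto (gen fun n => c n / n) (𝓝[>] (-1)) (𝓝 x) := by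
  refine tendsto_gen_neg_one ?_
  rw [← tendsto_add_atTop_iff_nat 1]
  refine Tendsto.congr (fun N => ?_) hc
  rw [altShift, sum_Icc_eq_sum_range (by simp)]
  refine Finset.sum_congr rfl fun n _ => ?_
  simp
  ring

/-! ### Polylogarithms on [-1, 1] and their values at ±1. -/

section polyLog

variable {x : ℝ}

lemma polyLog_one (hx : |x| < 1) : polyLog 1 x = -Real.log (1 - x) := by
  unfold polyLog
  rw [← (Real.hasSum_pow_div_log_of_abs_lt_one hx).tsum_eq]
  simp

lemma polyLog_zero_right (s : ℕ) : polyLog s 0 = 0 := by simp [polyLog]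

lemma hasDerivAt_polyLog (s : ℕ) (hx : |x| < 1) (hx0 : x ≠ 0) :
    HasDerivAt (polyLog (s + 2)) (polyLog (s + 1) x / x) x := by
  have e : polyLog (s + 2) = gen fun n => (1 / (n : ℝ) ^ (s + 1)) / n := by
    funext y
    rw [polyLog_eq_gen (by omega)]
    congr 1
    funext n
    rw [div_div, ← pow_succ]
  rw [e, polyLog_eq_gen (by omega)]
  exact hasDerivAt_gen_div (PolyGrowth.inv_pow _) (by simp) hx hx0

lemma hasDerivAt_polyLog_two (hx : |x| < 1) (hx0 : x ≠ 0) :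
    HasDerivAt (polyLog 2) (-Real.log (1 - x) / x) x := by
  simpa [polyLog_one hx] using hasDerivAt_polyLog 0 hx hx0

lemma summable_polyLog_bound {s : ℕ} (hs : 2 ≤ s) : Summable fun n : ℕ => 1 / ((n : ℝ) + 1) ^ s := by
  have := (summable_nat_add_iff 1).2 (Real.summable_one_div_nat_pow.2 (show 1 < s by omega))
  exact_mod_cast this

lemma continuousOn_polyLog {s : ℕ} (hs : 2 ≤ s) : ContinuousOn (polyLog s) (Set.Icc (-1) 1) := by
  refine continuousOn_tsum (fun n => ?_) (summable_polyLog_bound hs) fun n y hy => ?_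
  · exact ((continuous_pow _).div_const _).continuousOn
  · rw [norm_div, norm_pow, Real.norm_of_nonneg (by positivity : (0 : ℝ) ≤ ((n : ℝ) + 1) ^ s)]
    gcongr
    exact pow_le_one₀ (norm_nonneg _) (abs_le.2 ⟨hy.1, hy.2⟩)

lemma continuousAt_polyLog {s : ℕ} (hs : 2 ≤ s) (hx : |x| < 1) : ContinuousAt (polyLog s) x :=
  (continuousOn_polyLog hs).continuousAt
    (Icc_mem_nhds (abs_lt.1 hx).1 (abs_lt.1 hx).2)

lemma zetaVal_eq_tsum {s : ℕ} (hs : 2 ≤ s) : zetaVal s = ∑' n : ℕ, 1 / (n : ℝ) ^ s := by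
  unfold zetaVal
  rw [zeta_nat_eq_tsum_of_gt_one (by omega)]
  have : ∑' n : ℕ, 1 / (n : ℂ) ^ s = ((∑' n : ℕ, 1 / (n : ℝ) ^ s : ℝ) : ℂ) := by
    push_cast; rfl
  rw [this, Complex.ofReal_re]

lemma polyLog_one_right {s : ℕ} (hs : 2 ≤ s) : polyLog s 1 = zetaVal s := by
  rw [polyLog_eq_gen (by omega), zetaVal_eq_tsum hs]
  simp [gen]

/-- Even terms minus odd terms is twice the even part minus the whole, and the even part is 2^(-s)
ζ(s). -/
lemma polyLog_neg_one {s : ℕ} (hs : 2 ≤ s) :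
    polyLog s (-1) = -(1 - 2 / 2 ^ s) * zetaVal s := by
  rw [polyLog_eq_gen (by omega), zetaVal_eq_tsum hs]
  have h : Summable fun n : ℕ => 1 / (n : ℝ) ^ s := Real.summable_one_div_nat_pow.2 (by omega)
  have he : Summable fun n : ℕ => 1 / ((2 * n : ℕ) : ℝ) ^ s :=
    h.comp_injective (mul_right_injective₀ (two_ne_zero (α := ℕ)))
  have ho : Summable fun n : ℕ => 1 / ((2 * n + 1 : ℕ) : ℝ) ^ s :=
    h.comp_injective (i := fun n : ℕ => 2 * n + 1) fun a b hab => by simpa using hab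
  have e1 := tsum_even_add_odd (f := fun n : ℕ => 1 / (n : ℝ) ^ s) he ho
  have e2 : ∑' n : ℕ, 1 / ((2 * n : ℕ) : ℝ) ^ s = 1 / 2 ^ s * ∑' n : ℕ, 1 / (n : ℝ) ^ s := by
    rw [← tsum_mul_left]
    refine tsum_congr fun n => ?_
    rw [Nat.cast_mul, mul_pow, one_div_mul_one_div]
    simp
  have he' : (fun n : ℕ => 1 / ((2 * n : ℕ) : ℝ) ^ s * (-1) ^ (2 * n))
      = fun n : ℕ => 1 / ((2 * n : ℕ) : ℝ) ^ s := by
    funext n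
    rw [pow_mul, neg_one_sq, one_pow, mul_one]
  have ho' : (fun n : ℕ => 1 / ((2 * n + 1 : ℕ) : ℝ) ^ s * (-1) ^ (2 * n + 1))
      = fun n : ℕ => -(1 / ((2 * n + 1 : ℕ) : ℝ) ^ s) := by
    funext n
    rw [pow_succ, pow_mul, neg_one_sq, one_pow, one_mul, mul_neg, mul_one]
  have e3 := tsum_even_add_odd (f := fun n : ℕ => 1 / (n : ℝ) ^ s * (-1) ^ n)
    (by rw [he']; exact he) (by rw [ho']; exact ho.neg)
  rw [he', ho', tsum_neg] at e3
  unfold gen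
  rw [← e3]
  linear_combination 2 * e2 - e1

/-- Needed because Li_2(-1)^2 appears in the limits while the final constants are written with ζ(4).
-/
lemma zetaVal_two_sq : zetaVal 2 ^ 2 = 5 / 2 * zetaVal 4 := by
  have h2 : zetaVal 2 = Real.pi ^ 2 / 6 := by
    unfold zetaVal
    rw [Nat.cast_ofNat, riemannZeta_two]
    norm_cast
  have h4 : zetaVal 4 = Real.pi ^ 4 / 90 := by
    unfold zetaVal
    rw [Nat.cast_ofNat, riemannZeta_four]
    norm_cast
  rw [h2, h4]
  ring

end polyLog

/-! ### Closed forms of the generating functions on (-1, 0). -/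

section identities

/-- `∑ H_n x^n / n^2`. -/
def genH2 (x : ℝ) : ℝ := gen (fun n => genHarmonic 1 n / n / n) x

/-- The antiderivative of `log(1-x)^2 / x`. -/
def logSqInt (x : ℝ) : ℝ := 2 * genH2 x - 2 * polyLog 3 x

variable {x : ℝ}

lemma gen_genHarmonic {m : ℕ} (hm : m ≠ 0) (hx : |x| < 1) :
    gen (genHarmonic m) x = polyLog m x / (1 - x) := by
  rw [polyLog_eq_gen hm]
  refine gen_eq_div_one_sub (.genHarmonic m) (.inv_pow m) (by simp [genHarmonic, hm])
    (fun n => ?_) hx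
  rw [genHarmonic_succ]

lemma hasDerivAt_log_one_sub (h : x < 1) :
    HasDerivAt (fun y => Real.log (1 - y)) (-1 / (1 - x)) x := by
  have := ((hasDerivAt_id x).const_sub 1).log (by simp only [id]; linarith)
  simpa using this

lemma abs_lt_one_of_neg (h1 : -1 < x) (h0 : x < 0) : |x| < 1 := abs_lt.2 ⟨h1, by linarith⟩

lemma continuousAt_log_one_sub_zero : ContinuousAt (fun y : ℝ => Real.log (1 - y)) 0 :=
  (hasDerivAt_log_one_sub (by norm_num)).continuousAt

/-- The derivative is -log(1-x) / (x(1-x)), and 1/(x(1-x)) = 1/x + 1/(1-x) separates it into the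
derivatives of the two terms. Only (-1, 0) is treated, since the limit at -1 is what matters. -/
lemma gen_genHarmonic_div (h1 : -1 < x) (h0 : x < 0) :
    gen (fun n => genHarmonic 1 n / n) x = polyLog 2 x + Real.log (1 - x) ^ 2 / 2 := by
  refine eq_of_hasDerivAt_Ioo (f := gen fun n => genHarmonic 1 n / n)
    (g := fun x => polyLog 2 x + Real.log (1 - x) ^ 2 / 2)
    (f' := fun x => gen (genHarmonic 1) x / x) (fun x h1 h0 => ?_) (fun x h1 h0 => ?_) ?_ ?_ ?_ h1 h0
  · exact hasDerivAt_gen_div (.genHarmonic 1) (genHarmonic_zero _) (abs_lt_one_of_neg h1 h0) h0.ne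
  · have hx := abs_lt_one_of_neg h1 h0
    refine HasDerivAt.congr_deriv ((hasDerivAt_polyLog_two hx h0.ne).add
      (((hasDerivAt_log_one_sub (by linarith)).pow 2).div_const 2)) ?_
    rw [gen_genHarmonic one_ne_zero hx, polyLog_one hx]
    have h2 : 1 - x ≠ 0 := by linarith
    have h3 := h0.ne
    field_simp
    ring
  · exact continuousAt_gen (PolyGrowth.div_nat (.genHarmonic 1)) (by simp)
  · exact (continuousAt_polyLog le_rfl (by simp)).add
      ((continuousAt_log_one_sub_zero.pow 2).div_const 2)
  · rw [gen_zero (by simp)]; simp [polyLog_zero_right]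

lemma polyGrowth_H_div : PolyGrowth fun n => genHarmonic 1 n / n := (PolyGrowth.genHarmonic 1).div_nat

lemma hasDerivAt_genH2 (h1 : -1 < x) (h0 : x < 0) :
    HasDerivAt genH2 ((polyLog 2 x + Real.log (1 - x) ^ 2 / 2) / x) x := by
  rw [← gen_genHarmonic_div h1 h0]
  exact hasDerivAt_gen_div polyGrowth_H_div (by simp) (abs_lt_one_of_neg h1 h0) h0.ne

lemma hasDerivAt_logSqInt (h1 : -1 < x) (h0 : x < 0) :
    HasDerivAt logSqInt (Real.log (1 - x) ^ 2 / x) x := by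
  have := ((hasDerivAt_genH2 h1 h0).const_mul 2).sub
    ((hasDerivAt_polyLog 1 (abs_lt_one_of_neg h1 h0) h0.ne).const_mul 2)
  refine HasDerivAt.congr_deriv (this) ?_
  ring

lemma continuousAt_genH2_zero : ContinuousAt genH2 0 :=
  continuousAt_gen polyGrowth_H_div.div_nat (by simp)

lemma continuousAt_logSqInt_zero : ContinuousAt logSqInt 0 :=
  (continuousAt_genH2_zero.const_mul 2).sub
    ((continuousAt_polyLog (by norm_num) (by simp)).const_mul 2)

lemma genH2_zero : genH2 0 = 0 := gen_zero (by simp)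

lemma logSqInt_zero : logSqInt 0 = 0 := by simp [logSqInt, genH2_zero, polyLog_zero_right]

/-- After the same splitting, Li_2(x)/(1-x) is integrated by parts, which leaves log(1-x)^2 / x and
hence `logSqInt`. -/
lemma gen_genHarmonic_two_div (h1 : -1 < x) (h0 : x < 0) :
    gen (fun n => genHarmonic 2 n / n) x
      = polyLog 3 x - Real.log (1 - x) * polyLog 2 x - logSqInt x := by
  refine eq_of_hasDerivAt_Ioo (f := gen fun n => genHarmonic 2 n / n)
    (g := fun x => polyLog 3 x - Real.log (1 - x) * polyLog 2 x - logSqInt x)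
    (f' := fun x => gen (genHarmonic 2) x / x) (fun x h1 h0 => ?_) (fun x h1 h0 => ?_) ?_ ?_ ?_ h1 h0
  · exact hasDerivAt_gen_div (.genHarmonic 2) (genHarmonic_zero _) (abs_lt_one_of_neg h1 h0) h0.ne
  · have hx := abs_lt_one_of_neg h1 h0
    refine HasDerivAt.congr_deriv (((hasDerivAt_polyLog 1 hx h0.ne).sub ((hasDerivAt_log_one_sub (by linarith)).mul
      (hasDerivAt_polyLog_two hx h0.ne))).sub (hasDerivAt_logSqInt h1 h0)) ?_
    rw [gen_genHarmonic two_ne_zero hx]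
    have h2 : 1 - x ≠ 0 := by linarith
    have h3 := h0.ne
    field_simp
    ring
  · exact continuousAt_gen (PolyGrowth.div_nat (.genHarmonic 2)) (by simp)
  · exact ((continuousAt_polyLog (by norm_num) (by simp)).sub
      (continuousAt_log_one_sub_zero.mul (continuousAt_polyLog le_rfl (by simp)))).sub
      continuousAt_logSqInt_zero
  · rw [gen_zero (by simp)]; simp [polyLog_zero_right, logSqInt_zero]

lemma polyGrowth_HH : PolyGrowth fun n => genHarmonic 1 n ^ 2 := (PolyGrowth.genHarmonic 1).pow 2

/-- `(1 - x) ∑ H_n^2 x^n`. -/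
lemma gen_genHarmonic_sq (h1 : -1 < x) (h0 : x < 0) :
    gen (fun n => genHarmonic 1 n ^ 2) x = (polyLog 2 x + Real.log (1 - x) ^ 2) / (1 - x) := by
  have hx := abs_lt_one_of_neg h1 h0
  have hd : PolyGrowth fun n => 2 * (genHarmonic 1 n / n) := (PolyGrowth.const 2).mul polyGrowth_H_div
  rw [gen_eq_div_one_sub (d := fun n => 2 * (genHarmonic 1 n / n) - 1 / (n : ℝ) ^ 2) polyGrowth_HH
    (hd.sub (.inv_pow 2)) (by simp [genHarmonic]) (fun n => ?_) hx,
    gen_sub hd (.inv_pow 2) hx, gen_const_mul, gen_genHarmonic_div h1 h0, ← polyLog_eq_gen two_ne_zero]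
  · ring
  · rw [genHarmonic_succ]
    field_simp
    ring

lemma gen_genHarmonic_sq_div (h1 : -1 < x) (h0 : x < 0) :
    gen (fun n => genHarmonic 1 n ^ 2 / n) x = 2 * genH2 x - polyLog 3 x
      - Real.log (1 - x) ^ 3 / 3 - Real.log (1 - x) * polyLog 2 x - logSqInt x := by
  refine eq_of_hasDerivAt_Ioo (f := gen fun n => genHarmonic 1 n ^ 2 / n)
    (g := fun x => 2 * genH2 x - polyLog 3 x
      - Real.log (1 - x) ^ 3 / 3 - Real.log (1 - x) * polyLog 2 x - logSqInt x)
    (f' := fun x => gen (fun n => genHarmonic 1 n ^ 2) x / x) (fun x h1 h0 => ?_)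
    (fun x h1 h0 => ?_) ?_ ?_ ?_ h1 h0
  · exact hasDerivAt_gen_div polyGrowth_HH (by simp [genHarmonic]) (abs_lt_one_of_neg h1 h0) h0.ne
  · have hx := abs_lt_one_of_neg h1 h0
    have hl := hasDerivAt_log_one_sub (x := x) (by linarith)
    refine HasDerivAt.congr_deriv ((((((hasDerivAt_genH2 h1 h0).const_mul 2).sub (hasDerivAt_polyLog 1 hx h0.ne)).sub
      ((hl.pow 3).div_const 3)).sub (hl.mul
      (hasDerivAt_polyLog_two hx h0.ne))).sub (hasDerivAt_logSqInt h1 h0)) ?_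
    rw [gen_genHarmonic_sq h1 h0]
    have h2 : 1 - x ≠ 0 := by linarith
    have h3 := h0.ne
    field_simp
    ring
  · exact continuousAt_gen polyGrowth_HH.div_nat (by simp)
  · exact ((((continuousAt_genH2_zero.const_mul 2).sub
      (continuousAt_polyLog (by norm_num) (by simp))).sub
      ((continuousAt_log_one_sub_zero.pow 3).div_const 3)).sub
      (continuousAt_log_one_sub_zero.mul (continuousAt_polyLog le_rfl (by simp)))).sub
      continuousAt_logSqInt_zero
  · rw [gen_zero (by simp)]; simp [polyLog_zero_right, logSqInt_zero, genH2_zero]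

/-- The differences of `H_n H_n^{(2)}`. -/
def diff12 (n : ℕ) : ℝ := genHarmonic 1 n / n / n + genHarmonic 2 n / n - 1 / (n : ℝ) ^ 3

/-- The differences of `H_n^3`. -/
def diff111 (n : ℕ) : ℝ :=
  3 * (genHarmonic 1 n ^ 2 / n) - 3 * (genHarmonic 1 n / n / n) + 1 / (n : ℝ) ^ 3

lemma mul_succ_eq_add_diff12 (n : ℕ) :
    genHarmonic 1 (n + 1) * genHarmonic 2 (n + 1) = genHarmonic 1 n * genHarmonic 2 n
      + diff12 (n + 1) := by
  rw [diff12, genHarmonic_succ, genHarmonic_succ]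
  field_simp
  ring

lemma cube_succ_eq_add_diff111 (n : ℕ) :
    genHarmonic 1 (n + 1) ^ 3 = genHarmonic 1 n ^ 3 + diff111 (n + 1) := by
  rw [diff111, genHarmonic_succ]
  field_simp
  ring

lemma polyGrowth_H2_div : PolyGrowth fun n => genHarmonic 2 n / n := (PolyGrowth.genHarmonic 2).div_nat

lemma polyGrowth_diff12 : PolyGrowth diff12 :=
  (polyGrowth_H_div.div_nat.add polyGrowth_H2_div).sub (.inv_pow 3)

lemma polyGrowth_diff111 : PolyGrowth diff111 :=
  (((PolyGrowth.const 3).mul polyGrowth_HH.div_nat).sub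
    ((PolyGrowth.const 3).mul polyGrowth_H_div.div_nat)).add (.inv_pow 3)

lemma gen_diff12 (hx : |x| < 1) : gen diff12 x
    = genH2 x + gen (fun n => genHarmonic 2 n / n) x - polyLog 3 x := by
  rw [polyLog_eq_gen three_ne_zero, genH2, ← gen_add polyGrowth_H_div.div_nat polyGrowth_H2_div hx,
    ← gen_sub (polyGrowth_H_div.div_nat.add polyGrowth_H2_div) (.inv_pow 3) hx]
  rfl

lemma gen_diff111 (hx : |x| < 1) : gen diff111 x
    = 3 * gen (fun n => genHarmonic 1 n ^ 2 / n) x - 3 * genH2 x + polyLog 3 x := by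
  rw [polyLog_eq_gen three_ne_zero, genH2, ← gen_const_mul, ← gen_const_mul, ← gen_sub, ← gen_add]
  · rfl
  · exact ((PolyGrowth.const 3).mul polyGrowth_HH.div_nat).sub
      ((PolyGrowth.const 3).mul polyGrowth_H_div.div_nat)
  · exact .inv_pow 3
  · exact hx
  · exact (PolyGrowth.const 3).mul polyGrowth_HH.div_nat
  · exact (PolyGrowth.const 3).mul polyGrowth_H_div.div_nat
  · exact hx

lemma hasDerivAt_gen_diff12 (h1 : -1 < x) (h0 : x < 0) : HasDerivAt (gen diff12)
    ((Real.log (1 - x) ^ 2 / 2 + polyLog 2 x / (1 - x)) / x) x := by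
  have hx := abs_lt_one_of_neg h1 h0
  have hg : HasDerivAt (gen fun n => genHarmonic 2 n / n) (gen (genHarmonic 2) x / x) x :=
    hasDerivAt_gen_div (.genHarmonic 2) (genHarmonic_zero _) hx h0.ne
  have := ((hasDerivAt_genH2 h1 h0).add hg).sub (hasDerivAt_polyLog 1 hx h0.ne)
  rw [gen_genHarmonic two_ne_zero hx] at this
  refine (this.congr_of_eventuallyEq ?_).congr_deriv (by ring)
  filter_upwards [Ioo_mem_nhds h1 h0] with y hy
  exact gen_diff12 (abs_lt_one_of_neg hy.1 hy.2)

/-- `∑ H_n H_n^{(2)} x^{n+1} / (n+1)` in closed form. -/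
def shiftGen12 (x : ℝ) : ℝ :=
  -(Real.log (1 - x) * gen diff12 x) - polyLog 2 x ^ 2 / 2 - Real.log (1 - x) ^ 2 * polyLog 2 x / 2

/-- `∑ H_n^3 x^{n+1} / (n+1)` in closed form. -/
def shiftGen111 (x : ℝ) : ℝ :=
  Real.log (1 - x) ^ 4 / 4 + 3 * shiftGen12 x
    + 2 * (Real.log (1 - x) * polyLog 3 x + polyLog 2 x ^ 2 / 2)

/-- With L = log(1-x), integration by parts leaves L^3/(2x) + L Li_2/(1-x) + L Li_2/x. The first two
terms form the derivative of -L^2 Li_2/2 and the third that of -Li_2^2/2, so no new transcendental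
function arises. -/
lemma hasDerivAt_shiftGen12 (h1 : -1 < x) (h0 : x < 0) :
    HasDerivAt shiftGen12 (gen diff12 x / (1 - x)) x := by
  have hx := abs_lt_one_of_neg h1 h0
  have hl := hasDerivAt_log_one_sub (x := x) (by linarith)
  have h2 := hasDerivAt_polyLog_two hx h0.ne
  refine HasDerivAt.congr_deriv (((hl.mul (hasDerivAt_gen_diff12 h1 h0)).neg.sub ((h2.pow 2).div_const 2)).sub
    (((hl.pow 2).mul h2).div_const 2)) ?_
  have h2 : 1 - x ≠ 0 := by linarith
  have h3 := h0.ne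
  simp only [Pi.pow_apply]
  field_simp
  ring

/-- The closed forms give `gen diff111` = 3 `gen diff12` - 2 Li_3 - L^3 with L = log(1-x). Divided
by 1 - x, the last two terms integrate to 2(L Li_3 + Li_2^2/2) and L^4/4. -/
lemma hasDerivAt_shiftGen111 (h1 : -1 < x) (h0 : x < 0) :
    HasDerivAt shiftGen111 (gen diff111 x / (1 - x)) x := by
  have hx := abs_lt_one_of_neg h1 h0
  have hl := hasDerivAt_log_one_sub (x := x) (by linarith)
  have h2 := hasDerivAt_polyLog_two hx h0.ne
  refine HasDerivAt.congr_deriv ((((hl.pow 4).div_const 4).add ((hasDerivAt_shiftGen12 h1 h0).const_mul 3)).add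
    (((hl.mul (hasDerivAt_polyLog 1 hx h0.ne)).add ((h2.pow 2).div_const 2)).const_mul 2)) ?_
  rw [gen_diff111 hx, gen_diff12 hx, gen_genHarmonic_sq_div h1 h0, gen_genHarmonic_two_div h1 h0]
  have h2 : 1 - x ≠ 0 := by linarith
  have h3 := h0.ne
  field_simp
  ring

lemma continuousAt_shiftGen12_zero : ContinuousAt shiftGen12 0 := by
  have hl := continuousAt_log_one_sub_zero
  have h2 := continuousAt_polyLog (x := 0) (s := 2) le_rfl (by simp)
  exact ((hl.mul (continuousAt_gen polyGrowth_diff12 (by simp))).neg.sub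
    ((h2.pow 2).div_const 2)).sub (((hl.pow 2).mul h2).div_const 2)

lemma continuousAt_shiftGen111_zero : ContinuousAt shiftGen111 0 := by
  have hl := continuousAt_log_one_sub_zero
  have h2 := continuousAt_polyLog (x := 0) (s := 2) le_rfl (by simp)
  have h3 := continuousAt_polyLog (x := 0) (s := 3) (by norm_num) (by simp)
  exact (((hl.pow 4).div_const 4).add (continuousAt_shiftGen12_zero.const_mul 3)).add
    (((hl.mul h3).add ((h2.pow 2).div_const 2)).const_mul 2)

/-- `∑ c_n x^n / n = ∑ d_n x^n / n + ∑ c_n x^{n+1} / (n+1)`, with `d` the differences of `c` and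
the last series given by its derivative. -/
lemma gen_div_eq_add {c d : ℕ → ℝ} {F : ℝ → ℝ} (hc : PolyGrowth c) (hd : PolyGrowth d)
    (hc0 : c 0 = 0) (hd0 : d 0 = 0) (h : ∀ n, c (n + 1) = c n + d (n + 1))
    (hF : ∀ x, -1 < x → x < 0 → HasDerivAt F (gen d x / (1 - x)) x) (hFc : ContinuousAt F 0)
    (hF0 : F 0 = 0) (h1 : -1 < x) (h0 : x < 0) :
    gen (fun n => c n / n) x = gen (fun n => d n / n) x + F x := by
  refine eq_of_hasDerivAt_Ioo (f := gen fun n => c n / n)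
    (g := fun x => gen (fun n => d n / n) x + F x)
    (f' := fun x => gen c x / x) (fun x h1 h0 => ?_)
    (fun x h1 h0 => ?_) ?_ ?_ ?_ h1 h0
  · exact hasDerivAt_gen_div hc hc0 (abs_lt_one_of_neg h1 h0) h0.ne
  · have hx := abs_lt_one_of_neg h1 h0
    refine HasDerivAt.congr_deriv ((hasDerivAt_gen_div hd hd0 hx h0.ne).add (hF x h1 h0)) ?_
    -- Now 1/(x(1-x)) = 1/x + 1/(1-x) splits the derivative into those of the two summands.
    rw [gen_eq_div_one_sub hc hd (hc0.trans hd0.symm) h hx]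
    have h2 : 1 - x ≠ 0 := by linarith
    have h3 := h0.ne
    field_simp
    ring
  · exact continuousAt_gen hc.div_nat (by simp)
  · exact (continuousAt_gen hd.div_nat (by simp)).add hFc
  · rw [gen_zero (by simp), gen_zero (by simp), hF0, add_zero]

lemma diff12_zero : diff12 0 = 0 := by simp [diff12]

lemma diff111_zero : diff111 0 = 0 := by simp [diff111]

lemma gen_H_mul_H2_div (h1 : -1 < x) (h0 : x < 0) :
    gen (fun n => genHarmonic 1 n * genHarmonic 2 n / n) x
      = gen (fun n => diff12 n / n) x + shiftGen12 x :=
  gen_div_eq_add ((PolyGrowth.genHarmonic 1).mul (.genHarmonic 2)) polyGrowth_diff12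
    (by simp [genHarmonic]) diff12_zero mul_succ_eq_add_diff12
    (fun _ => hasDerivAt_shiftGen12) continuousAt_shiftGen12_zero
    (by simp [shiftGen12, polyLog_zero_right]) h1 h0

lemma gen_H_cube_div (h1 : -1 < x) (h0 : x < 0) :
    gen (fun n => genHarmonic 1 n ^ 3 / n) x
      = gen (fun n => diff111 n / n) x + shiftGen111 x :=
  gen_div_eq_add ((PolyGrowth.genHarmonic 1).pow 3) polyGrowth_diff111
    (by simp [genHarmonic]) diff111_zero cube_succ_eq_add_diff111
    (fun _ => hasDerivAt_shiftGen111) continuousAt_shiftGen111_zero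
    (by simp [shiftGen111, shiftGen12, polyLog_zero_right]) h1 h0

/-- The coefficients of the antiderivative of `log(1-x)^3 / x`, up to a factor `1 / n`. -/
def cubeCoeff (n : ℕ) : ℝ :=
  genHarmonic 1 n ^ 2 / n - genHarmonic 2 n / n - 2 * (genHarmonic 1 n / n / n) + 2 * (1 / (n : ℝ) ^ 3)

/-- The antiderivative of `log(1-x)^3 / x`. -/
def logCubeInt (x : ℝ) : ℝ := -3 * gen (fun n => cubeCoeff n / n) x

lemma polyGrowth_cubeCoeff : PolyGrowth cubeCoeff :=
  ((polyGrowth_HH.div_nat.sub polyGrowth_H2_div).sub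
    ((PolyGrowth.const 2).mul polyGrowth_H_div.div_nat)).add ((PolyGrowth.const 2).mul (.inv_pow 3))

lemma gen_cubeCoeff (hx : |x| < 1) : gen cubeCoeff x
    = gen (fun n => genHarmonic 1 n ^ 2 / n) x - gen (fun n => genHarmonic 2 n / n) x
      - 2 * genH2 x + 2 * polyLog 3 x := by
  rw [polyLog_eq_gen three_ne_zero, genH2, ← gen_const_mul, ← gen_const_mul, ← gen_sub, ← gen_sub,
    ← gen_add]
  · rfl
  · exact (polyGrowth_HH.div_nat.sub polyGrowth_H2_div).sub
      ((PolyGrowth.const 2).mul polyGrowth_H_div.div_nat)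
  · exact (PolyGrowth.const 2).mul (.inv_pow 3)
  · exact hx
  · exact polyGrowth_HH.div_nat.sub polyGrowth_H2_div
  · exact (PolyGrowth.const 2).mul polyGrowth_H_div.div_nat
  · exact hx
  · exact polyGrowth_HH.div_nat
  · exact polyGrowth_H2_div
  · exact hx

/-- In the combination `cubeCoeff` all polylogarithms cancel: its generating function is -log(1-x)^3
/ 3. -/
lemma hasDerivAt_logCubeInt (h1 : -1 < x) (h0 : x < 0) :
    HasDerivAt logCubeInt (Real.log (1 - x) ^ 3 / x) x := by
  have hx := abs_lt_one_of_neg h1 h0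
  refine HasDerivAt.congr_deriv ((hasDerivAt_gen_div polyGrowth_cubeCoeff (by simp [cubeCoeff]) hx h0.ne).const_mul (-3)) ?_
  rw [gen_cubeCoeff hx, gen_genHarmonic_sq_div h1 h0, gen_genHarmonic_two_div h1 h0]
  unfold logSqInt
  have h3 := h0.ne
  field_simp
  ring

end identities

/-! ### Convergence of the alternating sums at shift 0, as Abel's theorem requires. -/

section convergence

lemma exists_hasAltShift_of_le {d : ℕ → ℝ} (C : ℝ) (h0 : d 0 = 0)
    (h : ∀ n : ℕ, 1 ≤ n → |d n| / n ≤ C * (genHarmonic 1 n ^ 3 / (n : ℝ) ^ 2)) :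
    ∃ x, HasAltShift d 0 x := by
  refine ⟨_, hasAltShift_of_summable h0 (summable_alt_of_summable_abs ?_)⟩
  refine summable_of_le_genHarmonic_cube C fun n hn => ?_
  rw [abs_of_nonneg (by positivity)]
  exact h n hn

/-- Quotients by `n` of sequences bounded by `C H_n^3`. -/
lemma exists_hasAltShift_div {d : ℕ → ℝ} (C : ℝ)
    (h : ∀ n : ℕ, 1 ≤ n → |d n| ≤ C * genHarmonic 1 n ^ 3) :
    ∃ x, HasAltShift (fun n => d n / n) 0 x := by
  refine exists_hasAltShift_of_le C (by simp) fun n hn => ?_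
  have hn' : (0 : ℝ) < n := by exact_mod_cast hn
  rw [abs_div, abs_of_pos hn', div_div, ← sq, ← mul_div_assoc]
  gcongr
  exact h n hn

/-- The conditionally convergent case: harmonic products not divided by n, whose differences gain a
factor 1/n. -/
lemma exists_hasAltShift_zero_of_le {c d : ℕ → ℝ} (C D : ℝ) (h0 : c 0 = 0) (hd0 : d 0 = 0)
    (h : ∀ n, c (n + 1) = c n + d (n + 1))
    (hc : ∀ n : ℕ, 1 ≤ n → |c n| ≤ C * genHarmonic 1 n ^ 3)
    (hd : ∀ n : ℕ, 1 ≤ n → |d n| ≤ D * genHarmonic 1 n ^ 3 / n) :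
    ∃ x, HasAltShift c 0 x := by
  refine exists_hasAltShift_zero h0 hd0 h ?_ ?_ ?_
  · rw [tendsto_zero_iff_abs_tendsto_zero]
    have := tendsto_genHarmonic_cube_div.const_mul C
    rw [mul_zero] at this
    refine squeeze_zero' (Eventually.of_forall fun n => abs_nonneg _) ?_ this
    filter_upwards [eventually_ge_atTop 1] with n hn
    have hn' : (0 : ℝ) < n := by exact_mod_cast hn
    simp only [Function.comp]
    rw [abs_div, abs_of_pos hn', ← mul_div_assoc]
    gcongr
    exact hc n hn
  · refine summable_of_le_genHarmonic_cube C fun n hn => ?_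
    have hn' : (0 : ℝ) < n := by exact_mod_cast hn
    rw [abs_of_nonneg (by positivity), ← mul_div_assoc]
    gcongr
    exact hc n hn
  · refine summable_of_le_genHarmonic_cube D fun n hn => ?_
    have hn' : (0 : ℝ) < n := by exact_mod_cast hn
    rw [abs_of_nonneg (by positivity), div_le_iff₀ hn']
    refine (hd n hn).trans (le_of_eq ?_)
    field_simp

section bounds

variable {n : ℕ}

lemma one_le_cube (hn : 1 ≤ n) : 1 ≤ genHarmonic 1 n ^ 3 := one_le_pow₀ (one_le_genHarmonic 1 hn)

lemma H_le_cube (hn : 1 ≤ n) : genHarmonic 1 n ≤ genHarmonic 1 n ^ 3 :=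
  le_self_pow₀ (one_le_genHarmonic 1 hn) (by norm_num)

lemma H_sq_le_cube (hn : 1 ≤ n) : genHarmonic 1 n ^ 2 ≤ genHarmonic 1 n ^ 3 :=
  pow_le_pow_right₀ (one_le_genHarmonic 1 hn) (by norm_num)

lemma H2_le_cube (hn : 1 ≤ n) : genHarmonic 2 n ≤ genHarmonic 1 n ^ 3 :=
  (genHarmonic_two_le n).trans (H_le_cube hn)

lemma H_mul_H2_le_cube (hn : 1 ≤ n) : genHarmonic 1 n * genHarmonic 2 n ≤ genHarmonic 1 n ^ 3 := by
  refine le_trans ?_ (H_sq_le_cube hn)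
  rw [sq]
  exact mul_le_mul_of_nonneg_left (genHarmonic_two_le n) (genHarmonic_nonneg 1 n)

lemma inv_pow_le_cube_div (hn : 1 ≤ n) (m : ℕ) : |1 / (n : ℝ) ^ (m + 1)| ≤ genHarmonic 1 n ^ 3 / n := by
  have hn' : (1 : ℝ) ≤ n := by exact_mod_cast hn
  rw [abs_of_nonneg (by positivity), pow_succ, ← div_div]
  gcongr
  refine le_trans ?_ (one_le_cube hn)
  rw [div_le_one (by positivity)]
  exact one_le_pow₀ hn'

lemma div_sq_le_cube_div (hn : 1 ≤ n) {a : ℝ} (h : |a| ≤ genHarmonic 1 n ^ 3) :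
    |a / n / n| ≤ genHarmonic 1 n ^ 3 / n := by
  have hn' : (1 : ℝ) ≤ n := by exact_mod_cast hn
  rw [abs_div, abs_div, Nat.abs_cast]
  gcongr
  refine le_trans ?_ h
  exact div_le_self (abs_nonneg _) hn'

end bounds

lemma exists_inv_pow (m : ℕ) : ∃ x, HasAltShift (fun n => 1 / (n : ℝ) ^ (m + 1)) 0 x := by
  refine exists_hasAltShift_of_le 1 (by simp) fun n hn => ?_
  have hn' : (0 : ℝ) < n := by exact_mod_cast hn
  rw [div_le_iff₀ hn']
  refine (inv_pow_le_cube_div hn m).trans (le_of_eq ?_)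
  field_simp

lemma exists_H_div : ∃ x, HasAltShift (fun n => genHarmonic 1 n / n) 0 x :=
  exists_hasAltShift_div 1 fun n hn => by
    rw [abs_of_nonneg (genHarmonic_nonneg 1 n), one_mul]
    exact H_le_cube hn

lemma exists_H2_div : ∃ x, HasAltShift (fun n => genHarmonic 2 n / n) 0 x :=
  exists_hasAltShift_div 1 fun n hn => by
    rw [abs_of_nonneg (genHarmonic_nonneg 2 n), one_mul]
    exact H2_le_cube hn

lemma exists_H_sq_div : ∃ x, HasAltShift (fun n => genHarmonic 1 n ^ 2 / n) 0 x :=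
  exists_hasAltShift_div 1 fun n hn => by
    rw [abs_of_nonneg (sq_nonneg _), one_mul]
    exact H_sq_le_cube hn

lemma exists_H_div_div : ∃ x, HasAltShift (fun n => genHarmonic 1 n / n / n) 0 x :=
  exists_hasAltShift_div 1 fun n hn => by
    have hn' : (1 : ℝ) ≤ n := by exact_mod_cast hn
    have := genHarmonic_nonneg 1 n
    rw [abs_of_nonneg (by positivity), one_mul]
    exact (div_le_self this hn').trans (H_le_cube hn)

lemma exists_H : ∃ x, HasAltShift (genHarmonic 1) 0 x :=
  exists_hasAltShift_zero_of_le (d := fun n => 1 / (n : ℝ) ^ 1) 1 1 (genHarmonic_zero 1) (by simp)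
    (genHarmonic_succ 1)
    (fun n hn => by
      rw [abs_of_nonneg (genHarmonic_nonneg 1 n), one_mul]
      exact H_le_cube hn)
    fun n hn => by simpa using inv_pow_le_cube_div hn 0

lemma exists_H2 : ∃ x, HasAltShift (genHarmonic 2) 0 x :=
  exists_hasAltShift_zero_of_le (d := fun n => 1 / (n : ℝ) ^ 2) 1 1 (genHarmonic_zero 2) (by simp)
    (genHarmonic_succ 2)
    (fun n hn => by
      rw [abs_of_nonneg (genHarmonic_nonneg 2 n), one_mul]
      exact H2_le_cube hn)
    fun n hn => by simpa using inv_pow_le_cube_div hn 1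

/-- The differences of `H_n^2`. -/
def diff11 (n : ℕ) : ℝ := 2 * (genHarmonic 1 n / n) - 1 / (n : ℝ) ^ 2

lemma sq_succ_eq_add_diff11 (n : ℕ) :
    genHarmonic 1 (n + 1) ^ 2 = genHarmonic 1 n ^ 2 + diff11 (n + 1) := by
  rw [diff11, genHarmonic_succ]
  field_simp
  ring

lemma div_le_cube_div {n : ℕ} {a : ℝ} (ha : 0 ≤ a) (h : a ≤ genHarmonic 1 n ^ 3) :
    |a / n| ≤ genHarmonic 1 n ^ 3 / n := by
  rw [abs_of_nonneg (by positivity)]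
  gcongr

lemma exists_H_sq : ∃ x, HasAltShift (fun n => genHarmonic 1 n ^ 2) 0 x :=
  exists_hasAltShift_zero_of_le (d := diff11) 1 3 (by simp [genHarmonic]) (by simp [diff11])
    sq_succ_eq_add_diff11
    (fun n hn => by
      rw [abs_of_nonneg (sq_nonneg _), one_mul]
      exact H_sq_le_cube hn)
    fun n hn => by
      have h1 := div_le_cube_div (genHarmonic_nonneg 1 n) (H_le_cube hn)
      have h2 := inv_pow_le_cube_div hn 1
      rw [mul_div_assoc]
      unfold diff11
      rw [abs_le] at *
      constructor <;> linarith [h1.1, h1.2, h2.1, h2.2]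

lemma exists_H_mul_H2 : ∃ x, HasAltShift (fun n => genHarmonic 1 n * genHarmonic 2 n) 0 x :=
  exists_hasAltShift_zero_of_le (d := diff12) 1 3 (by simp [genHarmonic]) diff12_zero
    mul_succ_eq_add_diff12
    (fun n hn => by
      rw [abs_of_nonneg (mul_nonneg (genHarmonic_nonneg 1 n) (genHarmonic_nonneg 2 n)), one_mul]
      exact H_mul_H2_le_cube hn)
    fun n hn => by
      have h1 := div_sq_le_cube_div hn (a := genHarmonic 1 n) (by
        rw [abs_of_nonneg (genHarmonic_nonneg 1 n)]; exact H_le_cube hn)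
      have h2 := inv_pow_le_cube_div hn 2
      have h3 := div_le_cube_div (genHarmonic_nonneg 2 n) (H2_le_cube hn)
      rw [mul_div_assoc]
      unfold diff12
      rw [abs_le] at *
      constructor <;> linarith [h1.1, h1.2, h2.1, h2.2, h3.1, h3.2]

lemma exists_H_cube : ∃ x, HasAltShift (fun n => genHarmonic 1 n ^ 3) 0 x :=
  -- The constant 7 = 3 + 3 + 1 adds the absolute values of the coefficients in `diff111`.
  exists_hasAltShift_zero_of_le (d := diff111) 1 7 (by simp [genHarmonic]) diff111_zero
    cube_succ_eq_add_diff111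
    (fun n hn => by
      rw [abs_of_nonneg (pow_nonneg (genHarmonic_nonneg 1 n) 3), one_mul])
    fun n hn => by
      have h1 := div_sq_le_cube_div hn (a := genHarmonic 1 n) (by
        rw [abs_of_nonneg (genHarmonic_nonneg 1 n)]; exact H_le_cube hn)
      have h2 := inv_pow_le_cube_div hn 2
      have h3 := div_le_cube_div (sq_nonneg (genHarmonic 1 n)) (H_sq_le_cube hn)
      rw [mul_div_assoc]
      unfold diff111
      rw [abs_le] at *
      constructor <;> linarith [h1.1, h1.2, h2.1, h2.2, h3.1, h3.2]

end convergence

/-! ### Boundary values at -1. -/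

section limits

lemma tendsto_polyLog_neg_one {s : ℕ} (hs : 2 ≤ s) :
    Tendsto (polyLog s) (𝓝[>] (-1)) (𝓝 (polyLog s (-1))) :=
  ((continuousOn_polyLog hs) (-1) (by simp)).mono_left <| by
    rw [← nhdsWithin_Ioo_eq_nhdsGT (show (-1 : ℝ) < 1 by norm_num)]
    exact nhdsWithin_mono _ Set.Ioo_subset_Icc_self

lemma tendsto_log_one_sub_neg_one :
    Tendsto (fun x : ℝ => Real.log (1 - x)) (𝓝[>] (-1)) (𝓝 (Real.log 2)) := by
  have : ContinuousAt (fun x : ℝ => Real.log (1 - x)) (-1) :=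
    (hasDerivAt_log_one_sub (by norm_num)).continuousAt
  have h := this.tendsto
  norm_num at h
  exact tendsto_nhdsWithin_of_tendsto_nhds h

lemma eventually_Ioo_neg_one : ∀ᶠ x : ℝ in 𝓝[>] (-1), -1 < x ∧ x < 0 :=
  Ioo_mem_nhdsGT (by norm_num)

/-- Identify an alternating sum through a closed form of its generating function. -/
lemma HasAltShift.of_gen {c : ℕ → ℝ} {F : ℝ → ℝ} {y : ℝ} (h : ∃ x, HasAltShift c 0 x)
    (hF : ∀ x, -1 < x → x < 0 → gen (fun n => c n / n) x = F x)
    (hy : Tendsto F (𝓝[>] (-1)) (𝓝 y)) : HasAltShift c 0 y := by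
  obtain ⟨x, hx⟩ := h
  have h1 := hx.tendsto_gen
  have h2 : Tendsto F (𝓝[>] (-1)) (𝓝 x) := h1.congr' <| by
    filter_upwards [eventually_Ioo_neg_one] with t ht
    exact hF t ht.1 ht.2
  rwa [tendsto_nhds_unique hy h2]

lemma hasAltShift_inv_pow (m : ℕ) :
    HasAltShift (fun n => 1 / (n : ℝ) ^ (m + 1)) 0 (polyLog (m + 2) (-1)) := by
  refine HasAltShift.of_gen (exists_inv_pow m) (fun x _ _ => ?_)
    (tendsto_polyLog_neg_one (by omega))
  rw [polyLog_eq_gen (by omega)]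
  congr 1
  funext n
  rw [div_div, ← pow_succ]

/-- The constant sequence does not vanish at n = 0, so convergence comes from the alternating series
test instead of the difference criterion. -/
lemma hasAltShift_one : HasAltShift (fun _ => 1) 0 (-Real.log 2) := by
  refine HasAltShift.of_gen (F := fun x => -Real.log (1 - x)) ?_ (fun x h1 h0 => ?_)
    tendsto_log_one_sub_neg_one.neg
  · have hanti : Antitone fun n : ℕ => 1 / ((n : ℝ) + 1) := fun a b hab => by
      simp only
      gcongr
    obtain ⟨l, hl⟩ := hanti.tendsto_alternating_series_of_tendsto_zero
      tendsto_one_div_add_atTop_nhds_zero_nat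
    refine ⟨-l, hl.neg.congr fun N => ?_⟩
    induction N with
    | zero => simp [altShift]
    | succ N ih =>
      rw [Finset.sum_range_succ, neg_add, ih, altShift, altShift, Finset.sum_Icc_succ_top (by omega)]
      push_cast
      ring
  · rw [← polyLog_one (abs_lt_one_of_neg h1 h0), polyLog_eq_gen one_ne_zero]
    simp

lemma hasAltShift_H : HasAltShift (genHarmonic 1) 0
    (polyLog 2 (-1) + Real.log 2 ^ 2 / 2) :=
  .of_gen exists_H (fun _ => gen_genHarmonic_div) <|
    (tendsto_polyLog_neg_one le_rfl).add ((tendsto_log_one_sub_neg_one.pow 2).div_const 2)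

variable {h : ℝ}

/-- The value h of ∑ (-1)^n H_n / n^2 stays a parameter, because it is determined from this very
limit in `hasAltShift_H_div`. -/
lemma tendsto_logSqInt (hh : HasAltShift (fun n => genHarmonic 1 n / n) 0 h) :
    Tendsto logSqInt (𝓝[>] (-1)) (𝓝 (2 * h - 2 * polyLog 3 (-1))) :=
  (hh.tendsto_gen.const_mul 2).sub ((tendsto_polyLog_neg_one (by norm_num)).const_mul 2)

lemma hasAltShift_H2 (hh : HasAltShift (fun n => genHarmonic 1 n / n) 0 h) :
    HasAltShift (genHarmonic 2) 0 (polyLog 3 (-1) - Real.log 2 * polyLog 2 (-1)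
      - (2 * h - 2 * polyLog 3 (-1))) :=
  .of_gen exists_H2 (fun _ => gen_genHarmonic_two_div) <|
    ((tendsto_polyLog_neg_one (by norm_num)).sub (tendsto_log_one_sub_neg_one.mul
      (tendsto_polyLog_neg_one le_rfl))).sub (tendsto_logSqInt hh)

lemma hasAltShift_H_sq (hh : HasAltShift (fun n => genHarmonic 1 n / n) 0 h) :
    HasAltShift (fun n => genHarmonic 1 n ^ 2) 0 (2 * h - polyLog 3 (-1)
      - Real.log 2 ^ 3 / 3 - Real.log 2 * polyLog 2 (-1) - (2 * h - 2 * polyLog 3 (-1))) :=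
  .of_gen exists_H_sq (fun _ => gen_genHarmonic_sq_div) <|
    ((((hh.tendsto_gen.const_mul 2).sub (tendsto_polyLog_neg_one (by norm_num))).sub
      ((tendsto_log_one_sub_neg_one.pow 3).div_const 3)).sub (tendsto_log_one_sub_neg_one.mul
      (tendsto_polyLog_neg_one le_rfl))).sub (tendsto_logSqInt hh)

lemma tendsto_gen_diff12 (hh : HasAltShift (fun n => genHarmonic 1 n / n) 0 h) :
    Tendsto (gen diff12) (𝓝[>] (-1)) (𝓝 (polyLog 2 (-1) * -Real.log 2 - h + 2 * polyLog 3 (-1))) := by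
  have h2 := (hasAltShift_H2 hh).tendsto_gen
  have := (hh.tendsto_gen.add h2).sub (tendsto_polyLog_neg_one (s := 3) (by norm_num))
  have e : h + (polyLog 3 (-1) - Real.log 2 * polyLog 2 (-1)
      - (2 * h - 2 * polyLog 3 (-1))) - polyLog 3 (-1)
      = polyLog 2 (-1) * -Real.log 2 - h + 2 * polyLog 3 (-1) := by ring
  rw [e] at this
  refine this.congr' ?_
  filter_upwards [eventually_Ioo_neg_one] with t ht
  rw [gen_diff12 (abs_lt_one_of_neg ht.1 ht.2)]
  rfl

/-- The value of `shiftGen12` at `-1`, in terms of that of `genH2`. -/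
def shiftVal12 (h : ℝ) : ℝ :=
  -(Real.log 2 * (polyLog 2 (-1) * -Real.log 2 - h + 2 * polyLog 3 (-1))) - polyLog 2 (-1) ^ 2 / 2
    - Real.log 2 ^ 2 * polyLog 2 (-1) / 2

/-- The value of `shiftGen111` at `-1`, in terms of that of `genH2`. -/
def shiftVal111 (h : ℝ) : ℝ :=
  Real.log 2 ^ 4 / 4 + 3 * shiftVal12 h
    + 2 * (Real.log 2 * polyLog 3 (-1) + polyLog 2 (-1) ^ 2 / 2)

lemma tendsto_shiftGen12 (hh : HasAltShift (fun n => genHarmonic 1 n / n) 0 h) :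
    Tendsto shiftGen12 (𝓝[>] (-1)) (𝓝 (shiftVal12 h)) :=
  ((tendsto_log_one_sub_neg_one.mul (tendsto_gen_diff12 hh)).neg.sub
    (((tendsto_polyLog_neg_one le_rfl).pow 2).div_const 2)).sub
    (((tendsto_log_one_sub_neg_one.pow 2).mul (tendsto_polyLog_neg_one le_rfl)).div_const 2)

lemma tendsto_shiftGen111 (hh : HasAltShift (fun n => genHarmonic 1 n / n) 0 h) :
    Tendsto shiftGen111 (𝓝[>] (-1)) (𝓝 (shiftVal111 h)) :=
  (((tendsto_log_one_sub_neg_one.pow 4).div_const 4).add ((tendsto_shiftGen12 hh).const_mul 3)).add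
    (((tendsto_log_one_sub_neg_one.mul (tendsto_polyLog_neg_one (by norm_num))).add
      (((tendsto_polyLog_neg_one le_rfl).pow 2).div_const 2)).const_mul 2)

lemma hasAltShift_H_mul_H2 {q : ℝ} (hh : HasAltShift (fun n => genHarmonic 1 n / n) 0 h)
    (hq : HasAltShift diff12 0 q) :
    HasAltShift (fun n => genHarmonic 1 n * genHarmonic 2 n) 0 (q + shiftVal12 h) :=
  .of_gen exists_H_mul_H2 (fun _ => gen_H_mul_H2_div) (hq.tendsto_gen.add (tendsto_shiftGen12 hh))

lemma hasAltShift_H_cube {q : ℝ} (hh : HasAltShift (fun n => genHarmonic 1 n / n) 0 h)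
    (hq : HasAltShift diff111 0 q) :
    HasAltShift (fun n => genHarmonic 1 n ^ 3) 0 (q + shiftVal111 h) :=
  .of_gen exists_H_cube (fun _ => gen_H_cube_div) (hq.tendsto_gen.add (tendsto_shiftGen111 hh))

end limits

/-! ### Antiderivatives of powers of log w against polylogarithms. -/

section logInt

/-- Iterated integration by parts: an antiderivative of `log^m w * Li_{s-1}(σ w) / w`. -/
def logInt (σ : ℝ) : ℕ → ℕ → ℝ → ℝ
  | 0, s => fun w => polyLog s (σ * w)
  | m + 1, s => fun w => Real.log w ^ (m + 1) * polyLog s (σ * w) - (m + 1) * logInt σ m (s + 1) w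

variable {σ w : ℝ}

lemma abs_mul_lt_one (hσ : |σ| = 1) (h0 : 0 < w) (h1 : w < 1) : |σ * w| < 1 := by
  rwa [abs_mul, hσ, one_mul, abs_of_pos h0]

lemma hasDerivAt_polyLog_mul (s : ℕ) (hσ : |σ| = 1) (h0 : 0 < w) (h1 : w < 1) :
    HasDerivAt (fun w => polyLog (s + 2) (σ * w)) (polyLog (s + 1) (σ * w) / w) w := by
  have hσ0 : σ ≠ 0 := by rintro rfl; simp at hσ
  have h := HasDerivAt.comp w (hasDerivAt_polyLog s (abs_mul_lt_one hσ h0 h1)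
    (mul_ne_zero hσ0 h0.ne')) ((hasDerivAt_id w).const_mul σ)
  refine h.congr_deriv ?_
  field_simp

lemma hasDerivAt_logInt (hσ : |σ| = 1) (h0 : 0 < w) (h1 : w < 1) (m s : ℕ) :
    HasDerivAt (logInt σ m (s + 2)) (Real.log w ^ m * polyLog (s + 1) (σ * w) / w) w := by
  induction m generalizing s with
  | zero => exact (hasDerivAt_polyLog_mul s hσ h0 h1).congr_deriv (by simp)
  | succ m ih =>
    have := (((Real.hasDerivAt_log h0.ne').pow (m + 1)).mul (hasDerivAt_polyLog_mul s hσ h0 h1)).sub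
      ((ih (s + 1)).const_mul ((m : ℝ) + 1))
    refine this.congr_deriv ?_
    simp only [Pi.pow_apply, Nat.add_sub_cancel]
    push_cast
    field_simp
    ring

/-- The bottom case s = 1, with Li_0(σw)/w = σ/(1-σw): this is the integrand produced by the
substitutions below. -/
lemma hasDerivAt_logInt_one (hσ : |σ| = 1) (h0 : 0 < w) (h1 : w < 1) (m : ℕ) :
    HasDerivAt (logInt σ (m + 1) 1) (Real.log w ^ (m + 1) * (σ / (1 - σ * w))) w := by
  have hw := abs_mul_lt_one hσ h0 h1
  have hp : HasDerivAt (fun w => polyLog 1 (σ * w)) (σ / (1 - σ * w)) w := by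
    have h := (HasDerivAt.comp w (hasDerivAt_log_one_sub (abs_lt.1 hw).2)
      ((hasDerivAt_id w).const_mul σ)).neg
    refine (h.congr_of_eventuallyEq ?_).congr_deriv (by ring)
    filter_upwards [Ioo_mem_nhds h0 h1] with y hy
    simp [polyLog_one (abs_mul_lt_one hσ hy.1 hy.2)]
  have := (((Real.hasDerivAt_log h0.ne').pow (m + 1)).mul hp).sub
    ((hasDerivAt_logInt hσ h0 h1 m 0).const_mul ((m : ℝ) + 1))
  refine this.congr_deriv ?_
  simp only [Pi.pow_apply, Nat.add_sub_cancel]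
  push_cast
  field_simp
  ring

lemma tendsto_mul_log_pow (m : ℕ) :
    Tendsto (fun w : ℝ => w * Real.log w ^ m) (𝓝[>] 0) (𝓝 0) := by
  have h := (Real.isLittleO_pow_log_id_atTop (n := m)).tendsto_div_nhds_zero.comp
    (tendsto_inv_nhdsGT_zero (𝕜 := ℝ))
  have h2 := h.const_mul ((-1) ^ m)
  rw [mul_zero] at h2
  refine h2.congr fun w => ?_
  simp only [Function.comp, Real.log_inv, id, div_inv_eq_mul]
  rw [← mul_assoc, ← mul_pow]
  simp [mul_comm]

lemma abs_polyLog_le (s : ℕ) {y : ℝ} (hy : |y| < 1) : |polyLog s y| ≤ |y| / (1 - |y|) := by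
  have hg := (hasSum_geometric_of_lt_one (abs_nonneg y) hy).mul_left |y|
  rw [← div_eq_mul_inv] at hg
  rw [← Real.norm_eq_abs (polyLog s y)]
  unfold polyLog
  refine tsum_of_norm_bounded hg fun n => ?_
  rw [norm_div, norm_pow, Real.norm_eq_abs, ← pow_succ']
  refine div_le_self (by positivity) ?_
  rw [Real.norm_of_nonneg (by positivity)]
  exact one_le_pow₀ (by linarith [Nat.cast_nonneg (α := ℝ) n])

lemma tendsto_log_pow_mul_polyLog (hσ : |σ| = 1) (m s : ℕ) :
    Tendsto (fun w => Real.log w ^ m * polyLog s (σ * w)) (𝓝[>] 0) (𝓝 0) := by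
  have h := (tendsto_mul_log_pow m).abs.const_mul 2
  rw [abs_zero, mul_zero] at h
  refine squeeze_zero_norm' ?_ h
  filter_upwards [Ioo_mem_nhdsGT (show (0 : ℝ) < 1 / 2 by norm_num)] with w hw
  have hw1 : |σ * w| = w := by rw [abs_mul, hσ, one_mul, abs_of_pos hw.1]
  have h1 := abs_polyLog_le s (y := σ * w) (by rw [hw1]; linarith [hw.2])
  rw [hw1] at h1
  have h2 : w / (1 - w) ≤ 2 * w := by
    rw [div_le_iff₀ (by linarith [hw.2])]
    nlinarith [hw.1, hw.2]
  rw [norm_mul, Real.norm_eq_abs, Real.norm_eq_abs, abs_mul, abs_of_pos hw.1]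
  calc _ ≤ |Real.log w ^ m| * (2 * w) := by gcongr; exact h1.trans h2
    _ = _ := by ring

lemma tendsto_logInt_zero (hσ : |σ| = 1) (m s : ℕ) :
    Tendsto (logInt σ m s) (𝓝[>] 0) (𝓝 0) := by
  induction m generalizing s with
  | zero => simpa [logInt] using tendsto_log_pow_mul_polyLog hσ 0 s
  | succ m ih =>
    have := (tendsto_log_pow_mul_polyLog hσ (m + 1) s).sub ((ih (s + 1)).const_mul ((m : ℝ) + 1))
    rw [mul_zero, sub_zero] at this
    exact this

lemma tendsto_log_one : Tendsto Real.log (𝓝[<] 1) (𝓝 0) := by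
  have := (Real.continuousAt_log one_ne_zero).tendsto
  rw [Real.log_one] at this
  exact tendsto_nhdsWithin_of_tendsto_nhds this

lemma tendsto_polyLog_mul_one (hσ : |σ| = 1) {s : ℕ} (hs : 2 ≤ s) :
    Tendsto (fun w => polyLog s (σ * w)) (𝓝[<] 1) (𝓝 (polyLog s σ)) := by
  have hmem : σ ∈ Set.Icc (-1 : ℝ) 1 := abs_le.1 hσ.le
  refine (continuousOn_polyLog hs σ hmem).tendsto.comp ?_
  refine tendsto_nhdsWithin_of_tendsto_nhds_of_eventually_within _ ?_ ?_
  · have : Tendsto (fun w : ℝ => σ * w) (𝓝 1) (𝓝 (σ * 1)) := (continuous_const_mul σ).tendsto 1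
    rw [mul_one] at this
    exact tendsto_nhdsWithin_of_tendsto_nhds this
  · filter_upwards [Ioo_mem_nhdsLT (show (0 : ℝ) < 1 by norm_num)] with w hw
    exact abs_le.1 (abs_mul_lt_one hσ hw.1 hw.2).le

/-- At w = 1 each term with a power of log w vanishes; only the last term of the iterated
integration by parts survives. -/
lemma tendsto_logInt_of_two_le (hσ : |σ| = 1) (m s : ℕ) (hs : 2 ≤ s) :
    Tendsto (logInt σ m s) (𝓝[<] 1) (𝓝 ((-1) ^ m * (m.factorial : ℝ) * polyLog (s + m) σ)) := by
  induction m generalizing s with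
  | zero => simpa [logInt] using tendsto_polyLog_mul_one hσ hs
  | succ m ih =>
    have := ((tendsto_log_one.pow (m + 1)).mul (tendsto_polyLog_mul_one hσ hs)).sub
      ((ih (s + 1) (by omega)).const_mul ((m : ℝ) + 1))
    have e : (0 : ℝ) ^ (m + 1) * polyLog s σ - ((m : ℝ) + 1) *
        ((-1) ^ m * (m.factorial : ℝ) * polyLog (s + 1 + m) σ)
        = (-1) ^ (m + 1) * ((m + 1).factorial : ℝ) * polyLog (s + (m + 1)) σ := by
      rw [show s + 1 + m = s + (m + 1) by ring, Nat.factorial_succ]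
      push_cast
      simp
      ring
    rw [e] at this
    exact this

lemma tendsto_one_sub_nhdsLT : Tendsto (fun u : ℝ => 1 - u) (𝓝[<] 1) (𝓝[>] 0) := by
  refine tendsto_nhdsWithin_of_tendsto_nhds_of_eventually_within _ ?_ ?_
  · have : Tendsto (fun u : ℝ => 1 - u) (𝓝 1) (𝓝 (1 - 1)) := (continuous_const.sub continuous_id).tendsto 1
    rw [sub_self] at this
    exact tendsto_nhdsWithin_of_tendsto_nhds this
  · filter_upwards [self_mem_nhdsWithin] with w hw
    simp only [Set.mem_Iio, Set.mem_Ioi] at *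
    linarith

lemma tendsto_one_sub_nhdsGT : Tendsto (fun u : ℝ => 1 - u) (𝓝[>] 0) (𝓝[<] 1) := by
  refine tendsto_nhdsWithin_of_tendsto_nhds_of_eventually_within _ ?_ ?_
  · have : Tendsto (fun u : ℝ => 1 - u) (𝓝 0) (𝓝 (1 - 0)) := (continuous_const.sub continuous_id).tendsto 0
    rw [sub_zero] at this
    exact tendsto_nhdsWithin_of_tendsto_nhds this
  · filter_upwards [self_mem_nhdsWithin] with w hw
    simp only [Set.mem_Iio, Set.mem_Ioi] at *
    linarith

lemma tendsto_one_sub_mul_log : Tendsto (fun u : ℝ => (1 - u) * Real.log (1 - u)) (𝓝[<] 1) (𝓝 0) := by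
  refine ((tendsto_mul_log_pow 1).comp tendsto_one_sub_nhdsLT).congr fun u => ?_
  simp

lemma tendsto_log_mul_log : Tendsto (fun u : ℝ => Real.log u * Real.log (1 - u)) (𝓝[<] 1) (𝓝 0) := by
  have h := tendsto_one_sub_mul_log.abs.const_mul 2
  rw [abs_zero, mul_zero] at h
  refine squeeze_zero_norm' ?_ h
  filter_upwards [Ioo_mem_nhdsLT (show (1 / 2 : ℝ) < 1 by norm_num)] with u hu
  have h0 : 0 < u := by linarith [hu.1]
  have h1 := Real.one_sub_inv_le_log_of_pos h0
  have h2 : Real.log u ≤ 0 := Real.log_nonpos h0.le hu.2.le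
  rw [norm_mul, Real.norm_eq_abs, Real.norm_eq_abs, abs_mul, ← mul_assoc, abs_of_nonpos h2,
    abs_of_pos (show 0 < 1 - u by linarith [hu.2])]
  gcongr
  have h3 : u⁻¹ - 1 ≤ 2 * (1 - u) := by
    rw [sub_le_iff_le_add, inv_le_iff_one_le_mul₀ h0]
    nlinarith [hu.1, hu.2]
  linarith

lemma tendsto_log_mul_polyLog_one (hσ : σ = 1 ∨ σ = -1) :
    Tendsto (fun w => Real.log w * polyLog 1 (σ * w)) (𝓝[<] 1) (𝓝 0) := by
  rcases hσ with rfl | rfl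
  · have := tendsto_log_mul_log.neg
    rw [neg_zero] at this
    refine this.congr' ?_
    filter_upwards [Ioo_mem_nhdsLT (show (0 : ℝ) < 1 by norm_num)] with w hw
    rw [one_mul, polyLog_one (abs_lt.2 ⟨by linarith [hw.1], hw.2⟩)]
    ring
  · have hc : ContinuousAt (fun w : ℝ => -Real.log (1 + w)) 1 :=
      ((continuousAt_const.add continuousAt_id).log (by norm_num)).neg
    have := tendsto_log_one.mul (tendsto_nhdsWithin_of_tendsto_nhds hc.tendsto)
    rw [zero_mul] at this
    refine this.congr' ?_
    filter_upwards [Ioo_mem_nhdsLT (show (0 : ℝ) < 1 by norm_num)] with w hw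
    rw [polyLog_one (by rw [neg_one_mul, abs_neg]; exact abs_lt.2 ⟨by linarith [hw.1], hw.2⟩)]
    ring_nf

/-- For σ = 1 the function Li_1 has a logarithmic pole at w = 1; one factor log w cancels it, whence
the exponent m + 1. -/
lemma tendsto_logInt_one (hσ : σ = 1 ∨ σ = -1) (m : ℕ) :
    Tendsto (logInt σ (m + 1) 1) (𝓝[<] 1)
      (𝓝 ((-1) ^ (m + 1) * ((m + 1).factorial : ℝ) * polyLog (m + 2) σ)) := by
  have hσ' : |σ| = 1 := by rcases hσ with rfl | rfl <;> simp
  have h1 : Tendsto (fun w => Real.log w ^ (m + 1) * polyLog 1 (σ * w)) (𝓝[<] 1) (𝓝 0) := by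
    have := (tendsto_log_one.pow m).mul (tendsto_log_mul_polyLog_one hσ)
    rw [mul_zero] at this
    refine this.congr fun w => ?_
    ring
  have := h1.sub ((tendsto_logInt_of_two_le hσ' m 2 le_rfl).const_mul ((m : ℝ) + 1))
  have e : (0 : ℝ) - ((m : ℝ) + 1) * ((-1) ^ m * (m.factorial : ℝ) * polyLog (2 + m) σ)
      = (-1) ^ (m + 1) * ((m + 1).factorial : ℝ) * polyLog (m + 2) σ := by
    rw [add_comm 2 m, Nat.factorial_succ]
    push_cast
    ring
  rw [e] at this
  exact this

end logInt

/-! ### Comparing limits of antiderivatives; the quadratic relation. -/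

section relations

/-- This replaces improper integrals over (0, 1): a linear relation between integrands makes a
combination of antiderivatives constant, and its two end limits agree. -/
lemma eq_of_tendsto_of_hasDerivAt_zero {f : ℝ → ℝ} {p q : ℝ}
    (hf : ∀ u, 0 < u → u < 1 → HasDerivAt f 0 u) (hp : Tendsto f (𝓝[>] 0) (𝓝 p))
    (hq : Tendsto f (𝓝[<] 1) (𝓝 q)) : p = q := by
  have hconst : ∀ u ∈ Set.Ioo (0 : ℝ) 1, f u = f (1 / 2) := by
    intro u hu
    refine isOpen_Ioo.is_const_of_deriv_eq_zero (convex_Ioo (0 : ℝ) 1).isPreconnected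
      (fun y hy => (hf y hy.1 hy.2).differentiableAt.differentiableWithinAt)
      (fun y hy => (hf y hy.1 hy.2).deriv) hu (by norm_num)
  have h1 : Tendsto f (𝓝[>] 0) (𝓝 (f (1 / 2))) := tendsto_const_nhds.congr' <| by
    filter_upwards [Ioo_mem_nhdsGT (show (0 : ℝ) < 1 by norm_num)] with u hu
    exact (hconst u hu).symm
  have h2 : Tendsto f (𝓝[<] 1) (𝓝 (f (1 / 2))) := tendsto_const_nhds.congr' <| by
    filter_upwards [Ioo_mem_nhdsLT (show (0 : ℝ) < 1 by norm_num)] with u hu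
    exact (hconst u hu).symm
  rw [tendsto_nhds_unique hp h1, tendsto_nhds_unique hq h2]

/-- The antiderivative of `log(1-u)^m / u`. -/
def powIntSub (m : ℕ) (u : ℝ) : ℝ := -logInt 1 m 1 (1 - u)

/-- The antiderivative of `log(1-u^2)^m / u`. -/
def powIntSq (m : ℕ) (u : ℝ) : ℝ := powIntSub m (u ^ 2) / 2

/-- The antiderivative of `log((1-u)/(1+u))^m / u`. -/
def powIntRatio (m : ℕ) (u : ℝ) : ℝ :=
  -(logInt 1 m 1 ((1 - u) / (1 + u)) - logInt (-1) m 1 ((1 - u) / (1 + u)))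

variable {u : ℝ}

lemma hasDerivAt_powIntSub (m : ℕ) (h0 : 0 < u) (h1 : u < 1) :
    HasDerivAt (powIntSub (m + 1)) (Real.log (1 - u) ^ (m + 1) / u) u := by
  have h := (HasDerivAt.comp u (hasDerivAt_logInt_one (σ := 1) (by simp) (by linarith : 0 < 1 - u)
    (by linarith) m) ((hasDerivAt_id u).const_sub 1)).neg
  refine h.congr_deriv ?_
  rw [show 1 - 1 * (1 - u) = u by ring]
  ring

lemma hasDerivAt_powIntSq (m : ℕ) (h0 : 0 < u) (h1 : u < 1) :
    HasDerivAt (powIntSq (m + 1)) ((Real.log (1 - u) + Real.log (1 + u)) ^ (m + 1) / u) u := by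
  have h := (HasDerivAt.comp (h := fun u : ℝ => u ^ 2) u (hasDerivAt_powIntSub m
    (by positivity : 0 < u ^ 2) (by nlinarith)) (hasDerivAt_pow 2 u)).div_const 2
  refine h.congr_deriv ?_
  rw [← Real.log_mul (by linarith) (by linarith), show (1 - u) * (1 + u) = 1 - u ^ 2 by ring]
  field_simp
  ring

/-- For v = (1-u)/(1+u) one has du/u = -(1/(1-v) + 1/(1+v)) dv, which is why both signs σ = ±1 of
`logInt` occur. -/
lemma hasDerivAt_powIntRatio (m : ℕ) (h0 : 0 < u) (h1 : u < 1) :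
    HasDerivAt (powIntRatio (m + 1)) ((Real.log (1 - u) - Real.log (1 + u)) ^ (m + 1) / u) u := by
  have hv0 : 0 < (1 - u) / (1 + u) := div_pos (by linarith) (by linarith)
  have hv1 : (1 - u) / (1 + u) < 1 := by rw [div_lt_one (by linarith)]; linarith
  have hv : HasDerivAt (fun u : ℝ => (1 - u) / (1 + u)) (-2 / (1 + u) ^ 2) u := by
    refine (((hasDerivAt_id u).const_sub 1).div ((hasDerivAt_id u).const_add 1)
      (by simp only [id]; linarith)).congr_deriv ?_
    simp only [id]
    ring
  have h := ((HasDerivAt.comp u (hasDerivAt_logInt_one (σ := 1) (by simp) hv0 hv1 m) hv).sub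
    (HasDerivAt.comp u (hasDerivAt_logInt_one (σ := -1) (by simp) hv0 hv1 m) hv)).neg
  refine h.congr_deriv ?_
  rw [← Real.log_div (by linarith) (by linarith)]
  have e1 : 1 - 1 * ((1 - u) / (1 + u)) = 2 * u / (1 + u) := by
    have : 1 + u ≠ 0 := by linarith
    field_simp
    ring
  have e2 : 1 - -1 * ((1 - u) / (1 + u)) = 2 / (1 + u) := by
    have : 1 + u ≠ 0 := by linarith
    field_simp
    ring
  rw [e1, e2]
  have : 1 + u ≠ 0 := by linarith
  generalize Real.log ((1 - u) / (1 + u)) ^ (m + 1) = z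
  field_simp
  ring

lemma tendsto_powIntSub_zero (m : ℕ) : Tendsto (powIntSub (m + 1)) (𝓝[>] 0)
    (𝓝 (-((-1) ^ (m + 1) * ((m + 1).factorial : ℝ) * polyLog (m + 2) 1))) :=
  ((tendsto_logInt_one (Or.inl rfl) m).comp tendsto_one_sub_nhdsGT).neg

lemma tendsto_powIntSub_one (m : ℕ) : Tendsto (powIntSub (m + 1)) (𝓝[<] 1) (𝓝 0) := by
  have := ((tendsto_logInt_zero (σ := 1) (by simp) (m + 1) 1).comp tendsto_one_sub_nhdsLT).neg
  rw [neg_zero] at this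
  exact this

lemma tendsto_powIntSq_zero (m : ℕ) : Tendsto (powIntSq (m + 1)) (𝓝[>] 0)
    (𝓝 (-((-1) ^ (m + 1) * ((m + 1).factorial : ℝ) * polyLog (m + 2) 1) / 2)) := by
  refine ((tendsto_powIntSub_zero m).comp ?_).div_const 2
  refine tendsto_nhdsWithin_of_tendsto_nhds_of_eventually_within _ ?_ ?_
  · have : Tendsto (fun u : ℝ => u ^ 2) (𝓝 0) (𝓝 (0 ^ 2)) := (continuous_pow 2).tendsto 0
    rw [zero_pow two_ne_zero] at this
    exact tendsto_nhdsWithin_of_tendsto_nhds this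
  · filter_upwards [self_mem_nhdsWithin] with w hw
    simp only [Set.mem_Ioi] at *
    positivity

lemma tendsto_powIntSq_one (m : ℕ) : Tendsto (powIntSq (m + 1)) (𝓝[<] 1) (𝓝 0) := by
  rw [← zero_div (2 : ℝ)]
  refine ((tendsto_powIntSub_one m).comp ?_).div_const 2
  refine tendsto_nhdsWithin_of_tendsto_nhds_of_eventually_within _ ?_ ?_
  · have : Tendsto (fun u : ℝ => u ^ 2) (𝓝 1) (𝓝 (1 ^ 2)) := (continuous_pow 2).tendsto 1
    rw [one_pow] at this
    exact tendsto_nhdsWithin_of_tendsto_nhds this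
  · filter_upwards [Ioo_mem_nhdsLT (show (0 : ℝ) < 1 by norm_num)] with w hw
    simp only [Set.mem_Iio]
    nlinarith [hw.1, hw.2]

lemma tendsto_ratio_zero : Tendsto (fun u : ℝ => (1 - u) / (1 + u)) (𝓝[>] 0) (𝓝[<] 1) := by
  refine tendsto_nhdsWithin_of_tendsto_nhds_of_eventually_within _ ?_ ?_
  · have : ContinuousAt (fun u : ℝ => (1 - u) / (1 + u)) 0 :=
      (continuousAt_const.sub continuousAt_id).div (continuousAt_const.add continuousAt_id) (by norm_num)
    have h := this.tendsto
    norm_num at h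
    exact tendsto_nhdsWithin_of_tendsto_nhds h
  · filter_upwards [self_mem_nhdsWithin] with w hw
    simp only [Set.mem_Ioi, Set.mem_Iio] at *
    rw [div_lt_one (by linarith)]
    linarith

lemma tendsto_ratio_one : Tendsto (fun u : ℝ => (1 - u) / (1 + u)) (𝓝[<] 1) (𝓝[>] 0) := by
  refine tendsto_nhdsWithin_of_tendsto_nhds_of_eventually_within _ ?_ ?_
  · have : ContinuousAt (fun u : ℝ => (1 - u) / (1 + u)) 1 :=
      (continuousAt_const.sub continuousAt_id).div (continuousAt_const.add continuousAt_id) (by norm_num)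
    have h := this.tendsto
    norm_num at h
    exact tendsto_nhdsWithin_of_tendsto_nhds h
  · filter_upwards [Ioo_mem_nhdsLT (show (0 : ℝ) < 1 by norm_num)] with w hw
    have h1 : (0 : ℝ) < 1 - w := sub_pos.2 hw.2
    have h2 : (0 : ℝ) < 1 + w := add_pos one_pos hw.1
    exact div_pos h1 h2

lemma tendsto_powIntRatio_zero (m : ℕ) : Tendsto (powIntRatio (m + 1)) (𝓝[>] 0)
    (𝓝 (-((-1) ^ (m + 1) * ((m + 1).factorial : ℝ) * polyLog (m + 2) 1
      - (-1) ^ (m + 1) * ((m + 1).factorial : ℝ) * polyLog (m + 2) (-1)))) :=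
  (((tendsto_logInt_one (Or.inl rfl) m).comp tendsto_ratio_zero).sub
    ((tendsto_logInt_one (Or.inr rfl) m).comp tendsto_ratio_zero)).neg

lemma tendsto_powIntRatio_one (m : ℕ) : Tendsto (powIntRatio (m + 1)) (𝓝[<] 1) (𝓝 0) := by
  have := (((tendsto_logInt_zero (σ := 1) (by simp) (m + 1) 1).comp tendsto_ratio_one).sub
    ((tendsto_logInt_zero (σ := -1) (by simp) (m + 1) 1).comp tendsto_ratio_one)).neg
  rw [sub_zero, neg_zero] at this
  exact this

lemma tendsto_neg_nhdsLT_one : Tendsto (fun u : ℝ => -u) (𝓝[<] 1) (𝓝[>] (-1)) := by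
  refine tendsto_nhdsWithin_of_tendsto_nhds_of_eventually_within _ ?_ ?_
  · exact tendsto_nhdsWithin_of_tendsto_nhds (continuous_neg.tendsto 1)
  · filter_upwards [self_mem_nhdsWithin] with x hx
    simp only [Set.mem_Ioi, Set.mem_Iio] at *
    linarith

lemma tendsto_neg_nhdsGT_zero {f : ℝ → ℝ} (hf : ContinuousAt f 0) :
    Tendsto (fun u : ℝ => f (-u)) (𝓝[>] 0) (𝓝 (f 0)) := by
  have : ContinuousAt (fun u : ℝ => f (-u)) 0 :=
    ContinuousAt.comp (by simpa using hf) continuous_neg.continuousAt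
  simpa using tendsto_nhdsWithin_of_tendsto_nhds (s := Set.Ioi 0) this.tendsto

lemma hasDerivAt_comp_neg {f : ℝ → ℝ} {d : ℝ} (hf : HasDerivAt f d (-u)) :
    HasDerivAt (fun u => f (-u)) (-d) u :=
  ((HasDerivAt.comp u hf (hasDerivAt_id u).neg)).congr_deriv (by simp)

/-- `∫ log(1+u)^2 / u = ζ(3) / 4` on `(0, 1)`, so that `∑ (-1)^n H_n / n^2 = -5/8 ζ(3)`. -/
lemma hasAltShift_H_div :
    HasAltShift (fun n => genHarmonic 1 n / n) 0 (-(5 / 8) * zetaVal 3) := by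
  obtain ⟨h, hh⟩ := exists_H_div
  -- With a = log(1-u), b = log(1+u): 2a^2 + 2b^2 = (a+b)^2 + (a-b)^2. The function `logSqInt (-u)`
  -- is an antiderivative of b^2/u, and the other three are known at both ends.
  have key := eq_of_tendsto_of_hasDerivAt_zero
    (f := fun u => 2 * powIntSub 2 u + 2 * logSqInt (-u) - powIntSq 2 u - powIntRatio 2 u)
    (fun u h0 h1 => ?_)
    ((((tendsto_powIntSub_zero 1).const_mul 2).add
      ((tendsto_neg_nhdsGT_zero continuousAt_logSqInt_zero).const_mul 2)).sub
      (tendsto_powIntSq_zero 1) |>.sub (tendsto_powIntRatio_zero 1))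
    ((((tendsto_powIntSub_one 1).const_mul 2).add
      (((tendsto_logSqInt hh).comp tendsto_neg_nhdsLT_one).const_mul 2)).sub
      (tendsto_powIntSq_one 1) |>.sub (tendsto_powIntRatio_one 1))
  · norm_num [logSqInt_zero, polyLog_one_right, polyLog_neg_one, Nat.factorial] at key
    have e : h = -(5 / 8) * zetaVal 3 := by linarith
    rwa [← e]
  · have hJ := hasDerivAt_comp_neg (hasDerivAt_logSqInt (x := -u) (by linarith) (by linarith))
    refine (((((hasDerivAt_powIntSub 1 h0 h1).const_mul 2).add (hJ.const_mul 2)).sub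
      (hasDerivAt_powIntSq 1 h0 h1)).sub (hasDerivAt_powIntRatio 1 h0 h1)).congr_deriv ?_
    rw [sub_neg_eq_add]
    field_simp
    ring

end relations

/-! ### Polylogarithms at 1/2 and the integral of log(1+u)^3 / u. -/

section half

variable {u : ℝ}

/-- The antiderivative of `log(1+u)^m / u` obtained from the substitution `v = 1/(1+u)`. -/
def powIntInv (m : ℕ) (u : ℝ) : ℝ :=
  (-1) ^ (m + 1) * (Real.log (1 + u)⁻¹ ^ (m + 1) / (m + 1) + logInt 1 m 1 (1 + u)⁻¹)

/-- For v = 1/(1+u) one has log(1+u) = -log v and du/u = -(1/v + 1/(1-v)) dv. At u = 1 the point is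
v = 1/2. -/
lemma hasDerivAt_powIntInv (m : ℕ) (h0 : 0 < u) :
    HasDerivAt (powIntInv (m + 1)) (Real.log (1 + u) ^ (m + 1) / u) u := by
  have hp : 0 < 1 + u := by linarith
  have hv0 : 0 < (1 + u)⁻¹ := by positivity
  have hv1 : (1 + u)⁻¹ < 1 := inv_lt_one_of_one_lt₀ (by linarith)
  have hv : HasDerivAt (fun u : ℝ => (1 + u)⁻¹) (-1 / (1 + u) ^ 2) u :=
    ((hasDerivAt_id u).const_add 1).inv hp.ne'
  have h := (((((Real.hasDerivAt_log hv0.ne').comp u hv).pow (m + 2)).div_const ((m + 1 : ℕ) + 1 : ℝ)).add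
    (HasDerivAt.comp u (hasDerivAt_logInt_one (σ := 1) (by simp) hv0 hv1 m) hv)).const_mul
    ((-1 : ℝ) ^ (m + 1 + 1))
  refine h.congr_deriv ?_
  have e1 : 1 - 1 * (1 + u)⁻¹ = u / (1 + u) := by
    field_simp
    ring
  rw [e1]
  simp only [Function.comp, Real.log_inv]
  rw [show m + 2 - 1 = m + 1 from rfl, neg_pow (Real.log (1 + u))]
  have h2 : ((-1 : ℝ) ^ (m + 1)) * (-1) ^ (m + 1) = 1 := by rw [← mul_pow]; simp
  generalize Real.log (1 + u) ^ (m + 1) = z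
  rw [pow_succ ((-1 : ℝ)) (m + 1)]
  generalize ((-1 : ℝ) ^ (m + 1)) = s at *
  push_cast
  field_simp
  linear_combination (z * (1 + u) * (m + 2)) * h2

lemma tendsto_inv_one_add_zero : Tendsto (fun u : ℝ => (1 + u)⁻¹) (𝓝[>] 0) (𝓝[<] 1) := by
  refine tendsto_nhdsWithin_of_tendsto_nhds_of_eventually_within _ ?_ ?_
  · have : ContinuousAt (fun u : ℝ => (1 + u)⁻¹) 0 :=
      (continuousAt_const.add continuousAt_id).inv₀ (by norm_num)
    have h := this.tendsto
    norm_num at h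
    exact tendsto_nhdsWithin_of_tendsto_nhds h
  · filter_upwards [self_mem_nhdsWithin] with w hw
    simp only [Set.mem_Ioi, Set.mem_Iio] at *
    exact inv_lt_one_of_one_lt₀ (by linarith)

lemma tendsto_powIntInv_zero (m : ℕ) : Tendsto (powIntInv (m + 1)) (𝓝[>] 0)
    (𝓝 (-(((m + 1).factorial : ℝ) * polyLog (m + 2) 1))) := by
  have h1 := ((tendsto_log_one.comp tendsto_inv_one_add_zero).pow (m + 2)).div_const
    ((m + 1 : ℕ) + 1 : ℝ)
  have h := (h1.add ((tendsto_logInt_one (Or.inl rfl) m).comp tendsto_inv_one_add_zero)).const_mul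
    ((-1 : ℝ) ^ (m + 1 + 1))
  have e : (-1 : ℝ) ^ (m + 1 + 1) * ((0 : ℝ) ^ (m + 2) / ((m + 1 : ℕ) + 1 : ℝ) +
      (-1) ^ (m + 1) * ((m + 1).factorial : ℝ) * polyLog (m + 2) 1)
      = -(((m + 1).factorial : ℝ) * polyLog (m + 2) 1) := by
    have h2 : ((-1 : ℝ) ^ (m + 1)) * (-1) ^ (m + 1) = 1 := by rw [← mul_pow]; simp
    rw [pow_succ ((-1 : ℝ)) (m + 1), zero_pow (by omega), zero_div]
    linear_combination (-((m + 1).factorial : ℝ) * polyLog (m + 2) 1) * h2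
  rw [e] at h
  exact h

lemma tendsto_powIntInv_one (m : ℕ) : Tendsto (powIntInv (m + 1)) (𝓝[<] 1)
    (𝓝 (powIntInv (m + 1) 1)) :=
  tendsto_nhdsWithin_of_tendsto_nhds (hasDerivAt_powIntInv m one_pos).continuousAt.tendsto

/-- The value of `∫ log(1+u)^m / u` on `(0, 1)` through polylogarithms at `1/2`. -/
lemma eq_powIntInv_of_hasDerivAt {F : ℝ → ℝ} (m : ℕ) {y : ℝ}
    (hF : ∀ u, 0 < u → u < 1 → HasDerivAt (fun u => F (-u)) (Real.log (1 + u) ^ (m + 1) / u) u)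
    (hF0 : ContinuousAt F 0) (h0 : F 0 = 0) (hy : Tendsto F (𝓝[>] (-1)) (𝓝 y)) :
    y = powIntInv (m + 1) 1 + ((m + 1).factorial : ℝ) * polyLog (m + 2) 1 := by
  have key := eq_of_tendsto_of_hasDerivAt_zero (f := fun u => F (-u) - powIntInv (m + 1) u)
    (fun u h0 h1 => ((hF u h0 h1).sub (hasDerivAt_powIntInv m h0)).congr_deriv (sub_self _))
    ((tendsto_neg_nhdsGT_zero hF0).sub (tendsto_powIntInv_zero m))
    ((hy.comp tendsto_neg_nhdsLT_one).sub (tendsto_powIntInv_one m))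
  rw [h0] at key
  linarith

lemma polyLog_one_half : polyLog 1 (1 / 2) = Real.log 2 := by
  rw [polyLog_one (by rw [abs_of_pos] <;> norm_num), ← Real.log_inv]
  norm_num

lemma log_one_half : Real.log (1 / 2) = -Real.log 2 := by
  rw [one_div, Real.log_inv]

/-- The integral of log(1+u)/u is -Li_2(-1), already known, so the substitution formula is solved
for Li_2(1/2). The next exponent yields Li_3(1/2) in the same way. -/
lemma polyLog_two_half : polyLog 2 (1 / 2) = zetaVal 2 / 2 - Real.log 2 ^ 2 / 2 := by
  have h := eq_powIntInv_of_hasDerivAt (F := fun x => -polyLog 2 x) 0 (fun u h0 h1 => ?_)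
    (continuousAt_polyLog le_rfl (by simp)).neg (by simp [polyLog_zero_right])
    (tendsto_polyLog_neg_one le_rfl).neg
  · have e := polyLog_one_half
    norm_num [powIntInv, logInt, polyLog_one_right, polyLog_neg_one, Real.log_inv] at h e
    rw [log_one_half, e] at h
    norm_num
    linarith
  · have := hasDerivAt_comp_neg (hasDerivAt_polyLog_two (x := -u) (by
      rw [abs_neg, abs_of_pos h0]; exact h1) (by linarith))
    refine this.neg.congr_deriv ?_
    rw [sub_neg_eq_add]
    field_simp
    ring

lemma polyLog_three_half : polyLog 3 (1 / 2)
    = 7 / 8 * zetaVal 3 - zetaVal 2 * Real.log 2 / 2 + Real.log 2 ^ 3 / 6 := by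
  have h := eq_powIntInv_of_hasDerivAt (F := logSqInt) 1 (fun u h0 h1 => ?_)
    continuousAt_logSqInt_zero logSqInt_zero (tendsto_logSqInt hasAltShift_H_div)
  · have e := polyLog_one_half
    have e2 := polyLog_two_half
    norm_num [powIntInv, logInt, polyLog_one_right, polyLog_neg_one, Real.log_inv] at h e e2
    rw [log_one_half, e, e2] at h
    norm_num
    linarith
  · have := hasDerivAt_comp_neg (hasDerivAt_logSqInt (x := -u) (by linarith) (by linarith))
    refine this.congr_deriv ?_
    rw [sub_neg_eq_add]
    field_simp

lemma exists_cubeCoeff : ∃ x, HasAltShift cubeCoeff 0 x := by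
  obtain ⟨a, ha⟩ := exists_H_sq_div
  obtain ⟨b, hb⟩ := exists_H2_div
  obtain ⟨c, hc⟩ := exists_H_div_div
  obtain ⟨d, hd⟩ := exists_inv_pow 2
  exact ⟨_, ((ha.sub hb).sub (hc.const_mul 2)).add (hd.const_mul 2)⟩

/-- Here the formula is read in the other direction: the boundary sum is the unknown, and Li_4(1/2)
remains in the answer. -/
lemma hasAltShift_cubeCoeff : HasAltShift cubeCoeff 0 (-(1 / 3) * (6 * zetaVal 4 - 6 * polyLog 4 (1 / 2)
    - Real.log 2 ^ 4 / 4 + 3 / 2 * zetaVal 2 * Real.log 2 ^ 2 - 21 / 4 * zetaVal 3 * Real.log 2)) := by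
  obtain ⟨y, hy⟩ := exists_cubeCoeff
  have h := eq_powIntInv_of_hasDerivAt (F := logCubeInt) 2 (fun u h0 h1 => ?_)
    ((continuousAt_gen polyGrowth_cubeCoeff.div_nat (by simp)).const_mul _)
    (by simp [logCubeInt, gen_zero]) (hy.tendsto_gen.const_mul _)
  · have e := polyLog_one_half
    have e2 := polyLog_two_half
    have e3 := polyLog_three_half
    norm_num [powIntInv, logInt, polyLog_one_right, Real.log_inv, Nat.factorial] at h e e2 e3
    rw [log_one_half, e, e2, e3] at h
    convert hy using 1
    norm_num
    linarith
  · have := hasDerivAt_comp_neg (hasDerivAt_logCubeInt (x := -u) (by linarith) (by linarith))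
    refine this.congr_deriv ?_
    rw [sub_neg_eq_add]
    field_simp

end half

/-! ### The integral of log(1-u) log(1+u)^2 / u. -/

section mixed

variable {u : ℝ}

/-- The antiderivative of `u^(n-1) log(1-u)` vanishing at `0`. -/
def momentInt (n : ℕ) (u : ℝ) : ℝ :=
  ((u ^ n - 1) * Real.log (1 - u) - ∑ i ∈ Finset.Icc 1 n, u ^ i / i) / n

/-- Integration by parts with the primitive (u^n - 1)/n, which vanishes at u = 1; the leftover (u^n
- 1)/(u - 1) is a geometric sum. -/
lemma hasDerivAt_momentInt {n : ℕ} (hn : 1 ≤ n) (h1 : u < 1) :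
    HasDerivAt (momentInt n) (u ^ (n - 1) * Real.log (1 - u)) u := by
  have hs : HasDerivAt (fun u : ℝ => ∑ i ∈ Finset.Icc 1 n, u ^ i / i)
      (∑ i ∈ Finset.Icc 1 n, u ^ (i - 1)) u := by
    refine HasDerivAt.fun_sum fun i hi => ?_
    have : (i : ℝ) ≠ 0 := by
      have := (Finset.mem_Icc.1 hi).1
      positivity
    refine ((hasDerivAt_pow i u).div_const (i : ℝ)).congr_deriv ?_
    field_simp
  have h := (((((hasDerivAt_pow n u).sub_const 1).mul (hasDerivAt_log_one_sub h1)).sub hs)).div_const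
    (n : ℝ)
  refine h.congr_deriv ?_
  have hg : ∑ i ∈ Finset.Icc 1 n, u ^ (i - 1) = (u ^ n - 1) / (u - 1) := by
    rw [← geom_sum_eq h1.ne n]
    clear h hs hn
    induction n with
    | zero => simp
    | succ n ih => rw [Finset.sum_Icc_succ_top (by omega), ih, Finset.sum_range_succ, Nat.add_sub_cancel]
  rw [hg]
  have h2 : 1 - u ≠ 0 := by linarith
  have h3 : u - 1 ≠ 0 := by linarith
  have h4 : (n : ℝ) ≠ 0 := by positivity
  field_simp
  ring

lemma momentInt_zero_right (n : ℕ) : momentInt n 0 = 0 := by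
  unfold momentInt
  rw [Finset.sum_eq_zero]
  · simp
  · intro i hi
    have := (Finset.mem_Icc.1 hi).1
    rw [zero_pow (by omega), zero_div]

lemma momentInt_zero_left : momentInt 0 u = 0 := by simp [momentInt]

/-- The function decreases from 0, hence is nonpositive; its lower bound holds since (u^n - 1)
log(1-u) ≥ 0. Being uniform in u, the bound serves for dominated convergence at both ends. -/
lemma abs_momentInt_le (n : ℕ) (h0 : 0 < u) (h1 : u < 1) :
    |momentInt n u| ≤ genHarmonic 1 n / n := by
  rcases Nat.eq_zero_or_pos n with rfl | hn
  · simp [momentInt]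
  have hle : momentInt n u ≤ momentInt n 0 := by
    have hanti : AntitoneOn (momentInt n) (Set.Icc 0 u) := by
      refine antitoneOn_of_deriv_nonpos (convex_Icc 0 u) ?_ ?_ ?_
      · intro y hy
        exact (hasDerivAt_momentInt hn (hy.2.trans_lt h1)).continuousAt.continuousWithinAt
      · intro y hy
        rw [interior_Icc] at hy
        exact (hasDerivAt_momentInt hn (hy.2.trans h1)).differentiableAt.differentiableWithinAt
      · intro y hy
        rw [interior_Icc] at hy
        rw [(hasDerivAt_momentInt hn (hy.2.trans h1)).deriv]
        exact mul_nonpos_of_nonneg_of_nonpos (pow_nonneg hy.1.le _)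
          (Real.log_nonpos (by linarith [hy.2]) (by linarith [hy.1]))
    exact hanti ⟨le_rfl, h0.le⟩ ⟨h0.le, le_rfl⟩ h0.le
  rw [momentInt_zero_right] at hle
  rw [abs_of_nonpos hle]
  have hl : Real.log (1 - u) ≤ 0 := Real.log_nonpos (by linarith) (by linarith)
  have hp : u ^ n - 1 ≤ 0 := by linarith [pow_le_one₀ h0.le h1.le (n := n)]
  unfold momentInt
  rw [← neg_div]
  have hs : ∑ i ∈ Finset.Icc 1 n, u ^ i / i ≤ genHarmonic 1 n := by
    refine Finset.sum_le_sum fun i _ => ?_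
    rw [pow_one]
    gcongr
    exact pow_le_one₀ h0.le h1.le
  gcongr
  linarith [mul_nonneg_of_nonpos_of_nonpos hp hl]

lemma tendsto_momentInt_zero (n : ℕ) : Tendsto (momentInt n) (𝓝[>] 0) (𝓝 0) := by
  rcases Nat.eq_zero_or_pos n with rfl | hn
  · exact tendsto_const_nhds.congr fun u => momentInt_zero_left.symm
  · have := (hasDerivAt_momentInt hn (u := 0) one_pos).continuousAt.tendsto
    rw [momentInt_zero_right] at this
    exact tendsto_nhdsWithin_of_tendsto_nhds this

lemma tendsto_momentInt_one (n : ℕ) :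
    Tendsto (momentInt n) (𝓝[<] 1) (𝓝 (-(genHarmonic 1 n / n))) := by
  have h1 : Tendsto (fun u : ℝ => (u ^ n - 1) * Real.log (1 - u)) (𝓝[<] 1) (𝓝 0) := by
    have hc : ContinuousAt (fun u : ℝ => -∑ i ∈ Finset.range n, u ^ i) 1 :=
      (continuous_finsetSum _ fun i _ => continuous_pow i).neg.continuousAt
    have := (tendsto_nhdsWithin_of_tendsto_nhds (s := Set.Iio 1) hc.tendsto).mul
      tendsto_one_sub_mul_log
    rw [mul_zero] at this
    refine this.congr fun u => ?_
    rw [← geom_sum_mul u n]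
    ring
  have h2 : Tendsto (fun u : ℝ => ∑ i ∈ Finset.Icc 1 n, u ^ i / i) (𝓝[<] 1)
      (𝓝 (genHarmonic 1 n)) := by
    have hc : Continuous (fun u : ℝ => ∑ i ∈ Finset.Icc 1 n, u ^ i / i) :=
      continuous_finsetSum _ fun i _ => (continuous_pow i).div_const _
    have h := hc.tendsto 1
    have e : ∑ i ∈ Finset.Icc 1 n, (1 : ℝ) ^ i / i = genHarmonic 1 n := by simp [genHarmonic]
    rw [e] at h
    exact tendsto_nhdsWithin_of_tendsto_nhds h
  have := (h1.sub h2).div_const (n : ℝ)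
  rw [zero_sub, neg_div] at this
  exact this

/-- The coefficients of `log(1+u)^2`, up to sign. -/
def sqCoeff (n : ℕ) : ℝ := 2 * (genHarmonic 1 n / n) - 2 * (1 / (n : ℝ) ^ 2)

/-- The antiderivative of `log(1-u) log(1+u)^2 / u`. -/
def mixedInt (u : ℝ) : ℝ := ∑' n : ℕ, sqCoeff n * (-1) ^ n * momentInt n u

lemma sqCoeff_nonneg (n : ℕ) : 0 ≤ sqCoeff n := by
  rcases Nat.eq_zero_or_pos n with rfl | hn
  · simp [sqCoeff]
  have hn' : (1 : ℝ) ≤ n := by exact_mod_cast hn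
  have h1 : 1 / (n : ℝ) ^ 2 ≤ genHarmonic 1 n / n := by
    rw [sq, ← div_div]
    gcongr
    exact (div_le_one (by positivity)).2 hn' |>.trans (one_le_genHarmonic 1 hn)
  unfold sqCoeff
  linarith

lemma sqCoeff_le (n : ℕ) : sqCoeff n ≤ 2 * (genHarmonic 1 n / n) := by
  have : (0 : ℝ) ≤ 1 / (n : ℝ) ^ 2 := by positivity
  unfold sqCoeff
  linarith

lemma polyGrowth_sqCoeff : PolyGrowth sqCoeff :=
  ((PolyGrowth.const 2).mul polyGrowth_H_div).sub ((PolyGrowth.const 2).mul (.inv_pow 2))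

lemma gen_sqCoeff (h0 : 0 < u) (h1 : u < 1) : gen sqCoeff (-u) = Real.log (1 + u) ^ 2 := by
  have hx : |-u| < 1 := by rwa [abs_neg, abs_of_pos h0]
  have := gen_sub ((PolyGrowth.const 2).mul polyGrowth_H_div) ((PolyGrowth.const 2).mul (.inv_pow 2)) hx
  rw [gen_const_mul, gen_const_mul, gen_genHarmonic_div (by linarith) (by linarith),
    ← polyLog_eq_gen two_ne_zero, sub_neg_eq_add] at this
  calc gen sqCoeff (-u) = _ := this
    _ = _ := by ring

lemma summable_mixed : Summable fun n : ℕ => 2 * (genHarmonic 1 n / n) * (genHarmonic 1 n / n) := by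
  refine summable_of_le_genHarmonic_cube 2 fun n hn => ?_
  have h0 := genHarmonic_nonneg 1 n
  rw [abs_of_nonneg (by positivity)]
  have : 2 * (genHarmonic 1 n / n) * (genHarmonic 1 n / n) = 2 * (genHarmonic 1 n ^ 2 / (n : ℝ) ^ 2) := by
    field_simp
  rw [this]
  gcongr
  · exact one_le_genHarmonic 1 hn
  · norm_num

lemma norm_mixed_le (n : ℕ) (h0 : 0 < u) (h1 : u < 1) :
    ‖sqCoeff n * (-1) ^ n * momentInt n u‖
      ≤ 2 * (genHarmonic 1 n / n) * (genHarmonic 1 n / n) := by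
  rw [norm_mul, norm_mul, norm_pow, norm_neg, norm_one, one_pow, mul_one,
    Real.norm_of_nonneg (sqCoeff_nonneg n), Real.norm_eq_abs]
  exact mul_le_mul (sqCoeff_le n) (abs_momentInt_le n h0 h1) (abs_nonneg _)
    (mul_nonneg zero_le_two (div_nonneg (genHarmonic_nonneg 1 n) (Nat.cast_nonneg n)))

lemma hasDerivAt_mixedInt (h0 : 0 < u) (h1 : u < 1) :
    HasDerivAt mixedInt (Real.log (1 - u) * Real.log (1 + u) ^ 2 / u) u := by
  obtain ⟨ρ, huρ, hρ⟩ := exists_between h1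
  have hρ0 : 0 < ρ := h0.trans huρ
  -- On (0, ρ) the logarithm is bounded by |log(1-ρ)|, and ρ⁻¹ accounts for the exponent n - 1.
  have hs := (polyGrowth_sqCoeff.summable (x := ρ) (by rwa [abs_of_pos hρ0])).mul_right
    (ρ⁻¹ * |Real.log (1 - ρ)|)
  have h := hasDerivAt_tsum_of_isPreconnected (t := Set.Ioo 0 ρ) (y₀ := u)
    (g := fun (n : ℕ) u => sqCoeff n * (-1) ^ n * momentInt n u)
    (g' := fun (n : ℕ) u => sqCoeff n * (-1) ^ n * (u ^ (n - 1) * Real.log (1 - u))) hs isOpen_Ioo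
    (convex_Ioo 0 ρ).isPreconnected ?_ ?_ ⟨h0, huρ⟩ ?_ ⟨h0, huρ⟩
  · refine h.congr_deriv ?_
    rw [← gen_sqCoeff h0 h1, gen, ← tsum_mul_left, ← tsum_div_const]
    refine tsum_congr fun n => ?_
    rcases Nat.eq_zero_or_pos n with rfl | hn
    · simp [sqCoeff]
    · obtain ⟨m, rfl⟩ : ∃ m, n = m + 1 := ⟨n - 1, by omega⟩
      rw [Nat.add_sub_cancel, neg_pow u]
      field_simp
      ring
  · intro n y hy
    rcases Nat.eq_zero_or_pos n with rfl | hn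
    · simpa [sqCoeff] using hasDerivAt_const y (0 : ℝ)
    · exact (hasDerivAt_momentInt hn (hy.2.trans hρ)).const_mul _
  · intro n y hy
    rcases Nat.eq_zero_or_pos n with rfl | hn
    · simp [sqCoeff]
    · obtain ⟨m, rfl⟩ : ∃ m, n = m + 1 := ⟨n - 1, by omega⟩
      rw [Nat.add_sub_cancel, norm_mul, norm_mul, norm_mul, norm_pow, norm_pow, norm_neg, norm_one,
        one_pow, mul_one, Real.norm_of_nonneg (sqCoeff_nonneg _), Real.norm_of_nonneg hy.1.le,
        Real.norm_eq_abs]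
      have hl : |Real.log (1 - y)| ≤ |Real.log (1 - ρ)| := by
        have a1 : Real.log (1 - y) ≤ 0 := Real.log_nonpos (by linarith [hy.2]) (by linarith [hy.1])
        have a2 : Real.log (1 - ρ) ≤ Real.log (1 - y) :=
          Real.log_le_log (by linarith) (by linarith [hy.2])
        rw [abs_of_nonpos a1, abs_of_nonpos (a2.trans a1)]
        linarith
      have e : sqCoeff (m + 1) * ρ ^ (m + 1) * (ρ⁻¹ * |Real.log (1 - ρ)|)
          = sqCoeff (m + 1) * (ρ ^ m * |Real.log (1 - ρ)|) := by
        rw [pow_succ]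
        field_simp
      rw [e]
      have := sqCoeff_nonneg (m + 1)
      have h3 := hy.1.le
      have h4 := hy.2.le
      gcongr
  · exact Summable.of_norm_bounded summable_mixed fun n => norm_mixed_le n h0 h1

lemma tendsto_mixedInt_zero : Tendsto mixedInt (𝓝[>] 0) (𝓝 0) := by
  have := tendsto_tsum_of_dominated_convergence (𝓕 := 𝓝[>] (0 : ℝ)) summable_mixed
    (f := fun u (n : ℕ) => sqCoeff n * (-1) ^ n * momentInt n u)
    (g := fun n => sqCoeff n * (-1) ^ n * 0) (fun n => (tendsto_momentInt_zero n).const_mul _) (by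
      filter_upwards [Ioo_mem_nhdsGT (show (0 : ℝ) < 1 by norm_num)] with u hu n
      exact norm_mixed_le n hu.1 hu.2)
  simp only [mul_zero, tsum_zero] at this
  exact this

lemma tendsto_mixedInt_one : Tendsto mixedInt (𝓝[<] 1)
    (𝓝 (∑' n : ℕ, sqCoeff n * (-1) ^ n * -(genHarmonic 1 n / n))) :=
  tendsto_tsum_of_dominated_convergence (𝓕 := 𝓝[<] (1 : ℝ)) summable_mixed
    (f := fun u (n : ℕ) => sqCoeff n * (-1) ^ n * momentInt n u)
    (fun n => (tendsto_momentInt_one n).const_mul _) (by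
      filter_upwards [Ioo_mem_nhdsLT (show (0 : ℝ) < 1 by norm_num)] with u hu n
      exact norm_mixed_le n hu.1 hu.2)

/-- With a = log(1-u), b = log(1+u): a^3 + 3ab^2 = ((a+b)^3 + (a-b)^3)/2, a combination free of b^3
in which only the integral of ab^2/u is unknown. -/
lemma tsum_mixed : ∑' n : ℕ, sqCoeff n * (-1) ^ n * -(genHarmonic 1 n / n)
    = -(3 / 8) * zetaVal 4 := by
  have key := eq_of_tendsto_of_hasDerivAt_zero
    (f := fun u => powIntSub 3 u + 3 * mixedInt u - (powIntSq 3 u + powIntRatio 3 u) / 2)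
    (fun u h0 h1 => ?_)
    (((tendsto_powIntSub_zero 2).add (tendsto_mixedInt_zero.const_mul 3)).sub
      (((tendsto_powIntSq_zero 2).add (tendsto_powIntRatio_zero 2)).div_const 2))
    (((tendsto_powIntSub_one 2).add (tendsto_mixedInt_one.const_mul 3)).sub
      (((tendsto_powIntSq_one 2).add (tendsto_powIntRatio_one 2)).div_const 2))
  · generalize ∑' n : ℕ, sqCoeff n * (-1) ^ n * -(genHarmonic 1 n / n) = y at *
    norm_num [polyLog_one_right, polyLog_neg_one, Nat.factorial] at key
    linarith
  · refine (((hasDerivAt_powIntSub 2 h0 h1).add ((hasDerivAt_mixedInt h0 h1).const_mul 3)).sub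
      (((hasDerivAt_powIntSq 2 h0 h1).add (hasDerivAt_powIntRatio 2 h0 h1)).div_const 2)).congr_deriv ?_
    field_simp
    ring

/-- `∑ (-1)^n (H_n^2 / n^2 - H_n / n^3) = 3/16 ζ(4)`. -/
lemma hasAltShift_sq_sub : HasAltShift (fun n => genHarmonic 1 n ^ 2 / n - genHarmonic 1 n / n / n) 0
    (3 / 16 * zetaVal 4) := by
  have hs : Summable fun n : ℕ => (genHarmonic 1 n ^ 2 / n - genHarmonic 1 n / n / n) * (-1) ^ (n + 0)
      / ((n : ℝ) + (0 : ℕ)) := by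
    refine Summable.of_norm_bounded (summable_mixed.div_const 2) fun n => ?_
    have h1 := sqCoeff_nonneg n
    have h2 := sqCoeff_le n
    have h3 : 0 ≤ genHarmonic 1 n / n := div_nonneg (genHarmonic_nonneg 1 n) (Nat.cast_nonneg n)
    have e : (genHarmonic 1 n ^ 2 / n - genHarmonic 1 n / n / n) * (-1) ^ (n + 0)
      / ((n : ℝ) + (0 : ℕ)) = sqCoeff n * (-1) ^ n * (genHarmonic 1 n / n) / 2 := by
      simp [sqCoeff]
      field_simp
    rw [e, norm_div, norm_mul, norm_mul, norm_pow, norm_neg, norm_one, one_pow, mul_one,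
      Real.norm_of_nonneg h1, Real.norm_of_nonneg h3]
    norm_num
    gcongr
  have h := hasAltShift_of_summable (by simp) hs
  convert h using 1
  have := tsum_mixed
  have e : ∀ n : ℕ, (genHarmonic 1 n ^ 2 / n - genHarmonic 1 n / n / n) * (-1) ^ (n + 0)
      / ((n : ℝ) + (0 : ℕ)) = -(1 / 2) * (sqCoeff n * (-1) ^ n * -(genHarmonic 1 n / n)) := by
    intro n
    simp [sqCoeff]
    field_simp

  rw [tsum_congr e, tsum_mul_left, this]
  ring

end mixed

/-! ### The weight four constants at shift 0. -/

lemma hasAltShift_diff111 : HasAltShift diff111 0 (-(5 / 16) * zetaVal 4) := by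
  have h := (hasAltShift_sq_sub.const_mul 3).add (hasAltShift_inv_pow 2)
  rw [polyLog_neg_one (by norm_num)] at h
  have e : diff111 = fun n : ℕ => 3 * (genHarmonic 1 n ^ 2 / n - genHarmonic 1 n / n / n)
      + 1 / (n : ℝ) ^ (2 + 1) := by
    funext n
    rw [diff111]
    ring
  rw [e]
  convert h using 1
  norm_num
  ring

/-- Unlike `diff111`, this sequence needs `cubeCoeff` besides H_n^2/n - H_n/n^2 and 1/n^3, and so
picks up Li_4(1/2). -/
lemma hasAltShift_diff12 : HasAltShift diff12 0 (21 / 16 * zetaVal 4 - 2 * polyLog 4 (1 / 2)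
    - Real.log 2 ^ 4 / 12 + 1 / 2 * zetaVal 2 * Real.log 2 ^ 2 - 7 / 4 * zetaVal 3 * Real.log 2) := by
  have h := (hasAltShift_sq_sub.sub hasAltShift_cubeCoeff).add (hasAltShift_inv_pow 2)
  rw [polyLog_neg_one (by norm_num)] at h
  have e : diff12 = fun n : ℕ => genHarmonic 1 n ^ 2 / n - genHarmonic 1 n / n / n - cubeCoeff n
      + 1 / (n : ℝ) ^ (2 + 1) := by
    funext n
    rw [diff12, cubeCoeff]
    ring
  rw [e]
  convert h using 1
  norm_num
  ring

lemma hasAltShift_base12 :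
    HasAltShift (fun n => genHarmonic 1 n * genHarmonic 2 n) 0 (-baseClosed12) := by
  convert hasAltShift_H_mul_H2 hasAltShift_H_div hasAltShift_diff12 using 1
  have := zetaVal_two_sq
  norm_num [baseClosed12, shiftVal12, polyLog_neg_one]
  -- The factor 1/8 comes from Li_2(-1)^2 / 2 = ζ(2)^2 / 8.
  linear_combination (1 / 8) * this

lemma hasAltShift_base111 :
    HasAltShift (fun n => genHarmonic 1 n ^ 3) 0 (-baseClosed111) := by
  convert hasAltShift_H_cube hasAltShift_H_div hasAltShift_diff111 using 1
  have := zetaVal_two_sq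
  norm_num [baseClosed111, shiftVal111, shiftVal12, polyLog_neg_one]
  linear_combination (1 / 8) * this

/-! ### Recursion in the shift, producing star sums. -/

section recursion

lemma starSum_cons_succ (n : ℕ) (s : ℤ) (t : List ℤ) : starSum (n + 1) (s :: t)
    = starSum n (s :: t)
      + ((s.sign : ℤ) : ℝ) ^ (n + 1) / ((n + 1 : ℕ) : ℝ) ^ s.natAbs * starSum (n + 1) t := by
  simp only [starSum]
  rw [Finset.sum_Icc_succ_top (by omega)]

lemma starSum_succ_pos (n k : ℕ) (t : List ℤ) : starSum (n + 1) (((k + 1 : ℕ) : ℤ) :: t)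
    = starSum n (((k + 1 : ℕ) : ℤ) :: t) + 1 / ((n : ℝ) + 1) ^ (k + 1) * starSum (n + 1) t := by
  rw [starSum_cons_succ, Int.sign_natCast_of_ne_zero (by omega), Int.natAbs_natCast]
  simp

lemma starSum_succ_neg (n k : ℕ) (t : List ℤ) : starSum (n + 1) ((-(k + 1 : ℕ) : ℤ) :: t)
    = starSum n ((-(k + 1 : ℕ) : ℤ) :: t)
      + -(-1) ^ n / ((n : ℝ) + 1) ^ (k + 1) * starSum (n + 1) t := by
  rw [starSum_cons_succ, Int.sign_neg, Int.sign_natCast_of_ne_zero (by omega), Int.natAbs_neg,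
    Int.natAbs_natCast]
  push_cast
  ring

/-- This and the next five are instances with literal entries, the form in which `simp` meets them
in the closed forms. -/
lemma starSum_succ_one (n : ℕ) (t : List ℤ) : starSum (n + 1) (1 :: t)
    = starSum n (1 :: t) + 1 / ((n : ℝ) + 1) ^ 1 * starSum (n + 1) t := starSum_succ_pos n 0 t

lemma starSum_succ_neg_one (n : ℕ) (t : List ℤ) : starSum (n + 1) (-1 :: t)
    = starSum n (-1 :: t) + -(-1) ^ n / ((n : ℝ) + 1) ^ 1 * starSum (n + 1) t :=
  starSum_succ_neg n 0 t

lemma starSum_succ_two (n : ℕ) (t : List ℤ) : starSum (n + 1) (2 :: t)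
    = starSum n (2 :: t) + 1 / ((n : ℝ) + 1) ^ 2 * starSum (n + 1) t := starSum_succ_pos n 1 t

lemma starSum_succ_neg_two (n : ℕ) (t : List ℤ) : starSum (n + 1) (-2 :: t)
    = starSum n (-2 :: t) + -(-1) ^ n / ((n : ℝ) + 1) ^ 2 * starSum (n + 1) t :=
  starSum_succ_neg n 1 t

lemma starSum_succ_three (n : ℕ) (t : List ℤ) : starSum (n + 1) (3 :: t)
    = starSum n (3 :: t) + 1 / ((n : ℝ) + 1) ^ 3 * starSum (n + 1) t := starSum_succ_pos n 2 t

lemma starSum_succ_neg_three (n : ℕ) (t : List ℤ) : starSum (n + 1) (-3 :: t)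
    = starSum n (-3 :: t) + -(-1) ^ n / ((n : ℝ) + 1) ^ 3 * starSum (n + 1) t :=
  starSum_succ_neg n 2 t

lemma starSum_zero_cons (s : ℤ) (t : List ℤ) : starSum 0 (s :: t) = 0 := by simp [starSum]

lemma starSum_nil (n : ℕ) : starSum n [] = 1 := by simp [starSum]

lemma genHarmonic_one_eq_starSum (n : ℕ) : genHarmonic 1 n = starSum n [1] := by
  simp [genHarmonic, starSum]

/-- A tail of the series for ln 2. `HasAltShift.succ` does not apply, since the constant sequence is
not 0 at n = 0; each shift drops the first term. -/
lemma hasAltShift_one_eq (r : ℕ) :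
    HasAltShift (fun _ => 1) r (-Real.log 2 - starSum r [-1]) := by
  induction r with
  | zero => simpa [starSum] using hasAltShift_one
  | succ r ih =>
    have h := (tendsto_add_atTop_iff_nat 1).2 ih
    have h2 := h.sub_const ((-1) ^ (r + 1) / ((r : ℝ) + 1))
    rw [starSum_cons_succ, starSum_nil]
    have e : -Real.log 2 - starSum r [-1] - (-1) ^ (r + 1) / ((r : ℝ) + 1)
      = -Real.log 2 - (starSum r [-1]
        + (((-1 : ℤ).sign : ℤ) : ℝ) ^ (r + 1) / ((r + 1 : ℕ) : ℝ) ^ (-1 : ℤ).natAbs * 1) := by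
      simp
      ring
    rw [e] at h2
    refine h2.congr fun N => ?_
    unfold altShift
    induction N with
    | zero => simp; ring
    | succ N ihN =>
      rw [Finset.sum_Icc_succ_top (by omega), add_sub_right_comm, ihN,
        Finset.sum_Icc_succ_top (by omega) (fun n : ℕ => (1 : ℝ) * (-1) ^ (n + (r + 1)) / _)]
      push_cast
      ring

variable {r : ℕ}

/-- The value of `∑ (-1)^(n+r) / (n (n+r))`. -/
def invShift (r : ℕ) : ℝ := ((-1) ^ r * -Real.log 2 - (-Real.log 2 - starSum r [-1])) / r

lemma hasAltShift_inv (hr : 1 ≤ r) : HasAltShift (fun n => 1 / (n : ℝ)) r (invShift r) :=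
  hasAltShift_one.div hr (hasAltShift_one_eq r)

/-- The value of `∑ (-1)^(n+r) / (n^2 (n+r))`. -/
def invSqShift (r : ℕ) : ℝ := ((-1) ^ r * (-(1 / 2) * zetaVal 2) - invShift r) / r

lemma hasAltShift_inv_sq (hr : 1 ≤ r) :
    HasAltShift (fun n => 1 / (n : ℝ) ^ 2) r (invSqShift r) := by
  have h := hasAltShift_inv_pow 0
  rw [polyLog_neg_one (by norm_num)] at h
  norm_num at h
  have := HasAltShift.div hr (by simpa using h) (hasAltShift_inv hr)
  simpa [sq, invSqShift, div_eq_mul_inv] using this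

/-- The value of `∑ (-1)^(n+r) / (n^3 (n+r))`. -/
def invCubeShift (r : ℕ) : ℝ := ((-1) ^ r * (-(3 / 4) * zetaVal 3) - invSqShift r) / r

lemma hasAltShift_inv_cube (hr : 1 ≤ r) :
    HasAltShift (fun n => 1 / (n : ℝ) ^ 3) r (invCubeShift r) := by
  have h := hasAltShift_inv_pow 1
  rw [polyLog_neg_one (by norm_num)] at h
  norm_num at h
  have := HasAltShift.div hr (by simpa using h) (hasAltShift_inv_sq hr)
  simpa [pow_succ, invCubeShift, div_eq_mul_inv, mul_assoc] using this

/-- The value of `∑ H_m (-1)^(m+n+1) / (m+n+1)`. -/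
def harmShift (n : ℕ) : ℝ :=
  Real.log 2 ^ 2 / 2 + Real.log 2 * (starSum n [-1] - starSum n [1]) - starSum n [1, -1]

/-- The value of `∑ H_m^{(2)} (-1)^(m+n+1) / (m+n+1)`. -/
def harmTwoShift (n : ℕ) : ℝ :=
  Real.log 2 * zetaVal 2 / 2 - zetaVal 3 / 4 + zetaVal 2 / 2 * starSum n [-1]
    - Real.log 2 * (starSum n [-2] - starSum n [2]) + starSum n [2, -1]

/-- The value of `∑ H_m^2 (-1)^(m+n+1) / (m+n+1)`. -/
def harmSqShift (n : ℕ) : ℝ :=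
  -(Real.log 2 ^ 3 / 3) + Real.log 2 * zetaVal 2 / 2 - zetaVal 3 / 4
    - ((Real.log 2 ^ 2 - zetaVal 2) * starSum n [-1] - Real.log 2 ^ 2 * starSum n [1]
      - 2 * Real.log 2 * (starSum n [1, -1] - starSum n [1, 1])
      + 2 * Real.log 2 * (starSum n [-2] - starSum n [2])
      + 2 * starSum n [1, 1, -1] - 2 * starSum n [2, -1])
    + (-(zetaVal 2 / 2) * starSum n [-1] + Real.log 2 * (starSum n [-2] - starSum n [2])
      - starSum n [2, -1])

lemma hasAltShift_H_zero :
    HasAltShift (genHarmonic 1) 0 (-(zetaVal 2 / 2) + Real.log 2 ^ 2 / 2) := by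
  convert hasAltShift_H using 2
  rw [polyLog_neg_one le_rfl]
  norm_num
  ring

lemma hasAltShift_H2_zero :
    HasAltShift (genHarmonic 2) 0 (-zetaVal 3 + Real.log 2 * zetaVal 2 / 2) := by
  convert hasAltShift_H2 hasAltShift_H_div using 1
  rw [polyLog_neg_one le_rfl, polyLog_neg_one (by norm_num)]
  norm_num
  ring

lemma hasAltShift_H_sq_zero : HasAltShift (fun n => genHarmonic 1 n ^ 2) 0
    (-(3 / 4) * zetaVal 3 - Real.log 2 ^ 3 / 3 + Real.log 2 * zetaVal 2 / 2) := by
  convert hasAltShift_H_sq hasAltShift_H_div using 1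
  rw [polyLog_neg_one le_rfl, polyLog_neg_one (by norm_num)]
  norm_num
  ring

/-- Pattern of all the recursions below: shift 1 comes from shift 0, and each further shift
subtracts the known value for the differences. Once the star sums at n + 1 are expanded, what
remains is an algebraic identity in n + 1, (-1)^n and star sums at n. -/
lemma hasAltShift_H_succ (n : ℕ) : HasAltShift (genHarmonic 1) (n + 1) (harmShift n) := by
  induction n with
  | zero =>
    have h := hasAltShift_inv_pow 0
    rw [polyLog_neg_one (by norm_num)] at h
    convert HasAltShift.succ (genHarmonic_zero 1) (genHarmonic_succ 1) hasAltShift_H_zero h using 1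
    simp only [harmShift, starSum_zero_cons]
    norm_num
    ring
  | succ n ih =>
    have h := hasAltShift_inv (r := n + 1) (by omega)
    convert HasAltShift.succ (d := fun n => 1 / (n : ℝ) ^ 1) (genHarmonic_zero 1)
      (genHarmonic_succ 1) ih (by simpa using h) using 1
    simp only [harmShift, invShift, starSum_succ_one,
      starSum_succ_neg_one,
      starSum_nil, Nat.cast_add, Nat.cast_one, pow_succ (-1 : ℝ)]
    have : (n : ℝ) + 1 ≠ 0 := by positivity
    field_simp
    ring

lemma hasAltShift_H2_succ (n : ℕ) : HasAltShift (genHarmonic 2) (n + 1) (harmTwoShift n) := by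
  induction n with
  | zero =>
    have h := hasAltShift_inv_pow 1
    rw [polyLog_neg_one (by norm_num)] at h
    convert HasAltShift.succ (genHarmonic_zero 2) (genHarmonic_succ 2) hasAltShift_H2_zero h using 1
    simp only [harmTwoShift, starSum_zero_cons]
    norm_num
    ring
  | succ n ih =>
    have h := hasAltShift_inv_sq (r := n + 1) (by omega)
    convert HasAltShift.succ (genHarmonic_zero 2) (genHarmonic_succ 2) ih h using 1
    simp only [harmTwoShift, invSqShift, invShift, starSum_succ_two,
      starSum_succ_neg_one, starSum_succ_neg_two,
      starSum_nil, Nat.cast_add, Nat.cast_one, pow_succ (-1 : ℝ)]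
    have : (n : ℝ) + 1 ≠ 0 := by positivity
    field_simp
    ring

/-- The value of `∑ H_m / m (-1)^(m+n+1) / (m+n+1)`. -/
def harmDivShift (n : ℕ) : ℝ :=
  ((-1) ^ (n + 1) * (-(zetaVal 2 / 2) + Real.log 2 ^ 2 / 2) - harmShift n) / (n + 1 : ℕ)

lemma hasAltShift_H_div_succ (n : ℕ) :
    HasAltShift (fun m => genHarmonic 1 m / m) (n + 1) (harmDivShift n) :=
  hasAltShift_H_zero.div (by omega) (hasAltShift_H_succ n)

/-- The value of `∑ H_m / m^2 (-1)^(m+n+1) / (m+n+1)`. -/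
def harmDivSqShift (n : ℕ) : ℝ :=
  ((-1) ^ (n + 1) * (-(5 / 8) * zetaVal 3) - harmDivShift n) / (n + 1 : ℕ)

lemma hasAltShift_H_div_div_succ (n : ℕ) :
    HasAltShift (fun m => genHarmonic 1 m / m / m) (n + 1) (harmDivSqShift n) :=
  hasAltShift_H_div.div (by omega) (hasAltShift_H_div_succ n)

/-- The value of `∑ H_m^{(2)} / m (-1)^(m+n+1) / (m+n+1)`. -/
def harmTwoDivShift (n : ℕ) : ℝ :=
  ((-1) ^ (n + 1) * (-zetaVal 3 + Real.log 2 * zetaVal 2 / 2) - harmTwoShift n) / (n + 1 : ℕ)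

lemma hasAltShift_H2_div_succ (n : ℕ) :
    HasAltShift (fun m => genHarmonic 2 m / m) (n + 1) (harmTwoDivShift n) :=
  hasAltShift_H2_zero.div (by omega) (hasAltShift_H2_succ n)

lemma hasAltShift_H_sq_succ (n : ℕ) :
    HasAltShift (fun m => genHarmonic 1 m ^ 2) (n + 1) (harmSqShift n) := by
  induction n with
  | zero =>
    have h := hasAltShift_inv_pow 1
    rw [polyLog_neg_one (by norm_num)] at h
    convert HasAltShift.succ (by simp [genHarmonic]) sq_succ_eq_add_diff11 hasAltShift_H_sq_zero
      ((hasAltShift_H_div.const_mul 2).sub h) using 1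
    simp only [harmSqShift, starSum_zero_cons]
    norm_num
    ring
  | succ n ih =>
    convert HasAltShift.succ (by simp [genHarmonic]) sq_succ_eq_add_diff11 ih
      (((hasAltShift_H_div_succ n).const_mul 2).sub (hasAltShift_inv_sq (r := n + 1) (by omega)))
      using 1
    simp only [harmSqShift, harmDivShift, harmShift, invSqShift, invShift, starSum_succ_one, starSum_succ_two,
      starSum_succ_neg_one, starSum_succ_neg_two,
      starSum_nil, Nat.cast_add, Nat.cast_one, pow_succ (-1 : ℝ)]
    have : (n : ℝ) + 1 ≠ 0 := by positivity
    field_simp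
    ring

/-- The value of `∑ H_m^2 / m (-1)^(m+n+1) / (m+n+1)`. -/
def harmSqDivShift (n : ℕ) : ℝ :=
  ((-1) ^ (n + 1) * (-(3 / 4) * zetaVal 3 - Real.log 2 ^ 3 / 3 + Real.log 2 * zetaVal 2 / 2)
    - harmSqShift n) / (n + 1 : ℕ)

lemma hasAltShift_H_sq_div_succ (n : ℕ) :
    HasAltShift (fun m => genHarmonic 1 m ^ 2 / m) (n + 1) (harmSqDivShift n) :=
  hasAltShift_H_sq_zero.div (by omega) (hasAltShift_H_sq_succ n)

lemma hasAltShift_diff12_succ (n : ℕ) : HasAltShift diff12 (n + 1)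
    (harmDivSqShift n + harmTwoDivShift n - invCubeShift (n + 1)) :=
  ((hasAltShift_H_div_div_succ n).add (hasAltShift_H2_div_succ n)).sub
    (hasAltShift_inv_cube (by omega))

lemma hasAltShift_diff111_succ (n : ℕ) : HasAltShift diff111 (n + 1)
    (3 * harmSqDivShift n - 3 * harmDivSqShift n + invCubeShift (n + 1)) :=
  (((hasAltShift_H_sq_div_succ n).const_mul 3).sub ((hasAltShift_H_div_div_succ n).const_mul 3)).add
    (hasAltShift_inv_cube (by omega))

lemma hasAltShift_shiftClosed12 (n : ℕ) :
    HasAltShift (fun m => genHarmonic 1 m * genHarmonic 2 m) (n + 1) (shiftClosed12 (n + 1)) := by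
  induction n with
  | zero =>
    -- The Li_4(1/2) of the base value and that of `diff12` cancel here, so it is absent from every
    -- shifted sum.
    convert HasAltShift.succ (by simp [genHarmonic]) mul_succ_eq_add_diff12 hasAltShift_base12
      hasAltShift_diff12 using 1
    simp only [shiftClosed12, baseClosed12, Nat.zero_add, Nat.sub_self, starSum_zero_cons,
      genHarmonic_zero]
    ring
  | succ n ih =>
    convert HasAltShift.succ (by simp [genHarmonic]) mul_succ_eq_add_diff12 ih
      (hasAltShift_diff12_succ n) using 1
    simp only [shiftClosed12, Nat.add_sub_cancel, genHarmonic_one_eq_starSum, harmDivSqShift,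
      harmTwoDivShift, harmTwoShift, invCubeShift, harmDivShift, harmShift, invSqShift, invShift,
      starSum_succ_one, starSum_succ_two,
      starSum_succ_three, starSum_succ_neg_one, starSum_succ_neg_two, starSum_succ_neg_three,
      starSum_nil, Nat.cast_add, Nat.cast_one, pow_succ (-1 : ℝ)]
    have : (n : ℝ) + 1 ≠ 0 := by positivity
    field_simp
    ring

lemma hasAltShift_shiftClosed111 (n : ℕ) :
    HasAltShift (fun m => genHarmonic 1 m ^ 3) (n + 1) (shiftClosed111 (n + 1)) := by
  induction n with
  | zero =>
    convert HasAltShift.succ (by simp [genHarmonic]) cube_succ_eq_add_diff111 hasAltShift_base111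
      hasAltShift_diff111 using 1
    simp only [shiftClosed111, baseClosed111, Nat.zero_add, Nat.sub_self, starSum_zero_cons,
      genHarmonic_zero]
    ring
  | succ n ih =>
    convert HasAltShift.succ (by simp [genHarmonic]) cube_succ_eq_add_diff111 ih
      (hasAltShift_diff111_succ n) using 1
    simp only [shiftClosed111, Nat.add_sub_cancel, genHarmonic_one_eq_starSum, harmDivSqShift,
      harmSqDivShift, harmSqShift, invCubeShift, harmDivShift, harmShift, invSqShift, invShift,
      starSum_succ_one, starSum_succ_two,
      starSum_succ_three, starSum_succ_neg_one, starSum_succ_neg_two, starSum_succ_neg_three,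
      starSum_nil, Nat.cast_add, Nat.cast_one, pow_succ (-1 : ℝ)]
    have : (n : ℝ) + 1 ≠ 0 := by positivity
    field_simp
    ring

end recursion

/-! ### Partial fractions in n and the reduction to shifted sums. -/

section partialFractions

/-- A k-th finite difference of 1/x: by Pascal's rule the sum for k + 1 at x is the sum for k at x
minus the one at x + 1. -/
lemma sum_neg_one_pow_choose_div (k : ℕ) (x : ℝ) (hx : 0 < x) :
    ∑ r ∈ Finset.range (k + 1), (-1 : ℝ) ^ r * k.choose r / (x + r)
      = (k.factorial : ℝ) / ∏ j ∈ Finset.range (k + 1), (x + j) := by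
  induction k generalizing x with
  | zero => simp
  | succ k ih =>
    have h1 := ih x hx
    have h2 := ih (x + 1) (by linarith)
    have e : ∑ r ∈ Finset.range (k + 1 + 1), (-1 : ℝ) ^ r * (k + 1).choose r / (x + r)
        = ∑ r ∈ Finset.range (k + 1), (-1 : ℝ) ^ r * k.choose r / (x + r)
          - ∑ r ∈ Finset.range (k + 1), (-1 : ℝ) ^ r * k.choose r / (x + 1 + r) := by
      rw [Finset.sum_range_succ']
      have e1 : ∑ r ∈ Finset.range (k + 1), (-1 : ℝ) ^ r * k.choose r / (x + r)
          = ∑ r ∈ Finset.range (k + 1), (-1 : ℝ) ^ (r + 1) * k.choose (r + 1) / (x + (r + 1 : ℕ))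
            + (-1) ^ 0 * k.choose 0 / (x + (0 : ℕ)) := by
        rw [← Finset.sum_range_succ' (fun r : ℕ => (-1 : ℝ) ^ r * k.choose r / (x + r)),
          Finset.sum_range_succ _ (k + 1)]
        simp
      rw [e1, add_sub_right_comm, ← Finset.sum_sub_distrib]
      congr 1
      · refine Finset.sum_congr rfl fun r _ => ?_
        rw [Nat.choose_succ_succ]
        push_cast
        rw [show x + 1 + (r : ℝ) = x + (r + 1) by ring]
        ring
      · simp
    rw [e, h1, h2]
    have p1 : ∏ j ∈ Finset.range (k + 1 + 1), (x + j)
        = (∏ j ∈ Finset.range (k + 1), (x + j)) * (x + (k + 1 : ℕ)) := Finset.prod_range_succ _ _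
    have p2 : ∏ j ∈ Finset.range (k + 1 + 1), (x + j)
        = (∏ j ∈ Finset.range (k + 1), (x + 1 + j)) * x := by
      rw [Finset.prod_range_succ']
      simp only [Nat.cast_zero, add_zero]
      congr 1
      refine Finset.prod_congr rfl fun j _ => ?_
      push_cast
      ring
    have q1 : 0 < ∏ j ∈ Finset.range (k + 1), (x + j) :=
      Finset.prod_pos fun j _ => by positivity
    have q2 : 0 < ∏ j ∈ Finset.range (k + 1), (x + 1 + j) :=
      Finset.prod_pos fun j _ => by positivity
    have q3 : 0 < ∏ j ∈ Finset.range (k + 1 + 1), (x + j) :=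
      Finset.prod_pos fun j _ => by positivity
    rw [Nat.factorial_succ, div_sub_div _ _ q1.ne' q2.ne', div_eq_div_iff (by positivity) q3.ne']
    have e3 := p1.symm.trans p2
    push_cast at *
    rw [p1]
    generalize ∏ j ∈ Finset.range (k + 1), (x + (j : ℝ)) = P at *
    generalize ∏ j ∈ Finset.range (k + 1), (x + 1 + (j : ℝ)) = Q at *
    linear_combination (-(k.factorial : ℝ) * P) * e3

lemma prod_eq_factorial_mul_choose (n k : ℕ) :
    ∏ j ∈ Finset.range (k + 1), ((n : ℝ) + j) = n * (k.factorial * ((n + k).choose k : ℝ)) := by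
  rw [Finset.prod_range_succ', mul_comm]
  simp only [Nat.cast_zero, add_zero]
  congr 1
  have h := Nat.ascFactorial_eq_factorial_mul_choose n k
  have h2 := Nat.ascFactorial_eq_prod_range (n + 1) k
  rw [h2] at h
  rw [← Nat.cast_mul, ← h]
  push_cast
  exact Finset.prod_congr rfl fun j _ => by ring

lemma sum_choose_div_add {n : ℕ} (hn : 1 ≤ n) (k : ℕ) :
    ∑ r ∈ Finset.Icc 1 k, (-1 : ℝ) ^ r * k.choose r / ((n : ℝ) + r)
      = 1 / ((n : ℝ) * ((n + k).choose k : ℝ)) - 1 / n := by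
  have hn' : (0 : ℝ) < n := by exact_mod_cast hn
  have h := sum_neg_one_pow_choose_div k n hn'
  rw [prod_eq_factorial_mul_choose, Finset.sum_range_eq_add_Ico _ (by omega)] at h
  have h3 : Finset.Ico 1 (k + 1) = Finset.Icc 1 k := rfl
  rw [h3] at h
  have hf : (k.factorial : ℝ) ≠ 0 := by positivity
  have hc : ((n + k).choose k : ℝ) ≠ 0 := by
    have := Nat.choose_pos (show k ≤ n + k by omega)
    positivity
  rw [eq_sub_iff_add_eq]
  simp only [pow_zero, Nat.choose_zero_right, Nat.cast_zero, add_zero, Nat.cast_one, mul_one] at h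
  rw [add_comm, h]
  field_simp

lemma sum_neg_one_pow_succ_choose {k : ℕ} (hk : 1 ≤ k) :
    ∑ r ∈ Finset.Icc 1 k, (-1 : ℝ) ^ (r + 1) * k.choose r = 1 := by
  have h := Int.alternating_sum_range_choose_of_ne (show k ≠ 0 by omega)
  rw [Finset.sum_range_eq_add_Ico _ (by omega)] at h
  have h3 : Finset.Ico 1 (k + 1) = Finset.Icc 1 k := rfl
  rw [h3] at h
  have h4 : ((1 + ∑ r ∈ Finset.Icc 1 k, (-1) ^ r * (k.choose r : ℤ) : ℤ) : ℝ) = 0 := by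
    rw [← Int.cast_zero, ← h]
    simp
  push_cast at h4
  simp only [pow_succ, mul_neg, mul_one, neg_mul, Finset.sum_neg_distrib]
  linarith

/-- Partial fractions of `1 / (n * binom(n+k, k))`. -/
lemma one_div_mul_choose {n k : ℕ} (hn : 1 ≤ n) (hk : 1 ≤ k) :
    1 / ((n : ℝ) * ((n + k).choose k : ℝ))
      = ∑ r ∈ Finset.Icc 1 k, (-1 : ℝ) ^ (r + 1) * k.choose r * (1 / n - 1 / ((n : ℝ) + r)) := by
  have h1 := sum_choose_div_add hn k
  have h2 := sum_neg_one_pow_succ_choose hk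
  have e : ∑ r ∈ Finset.Icc 1 k, (-1 : ℝ) ^ (r + 1) * k.choose r * (1 / n - 1 / ((n : ℝ) + r))
      = (∑ r ∈ Finset.Icc 1 k, (-1 : ℝ) ^ (r + 1) * k.choose r) * (1 / n)
        + ∑ r ∈ Finset.Icc 1 k, (-1 : ℝ) ^ r * k.choose r / ((n : ℝ) + r) := by
    rw [Finset.sum_mul, ← Finset.sum_add_distrib]
    exact Finset.sum_congr rfl fun r _ => by ring
  rw [e, h1, h2]
  ring

/-- Partial fractions of `1 / binom(n+k, k)`. -/
lemma one_div_choose {n k : ℕ} (hn : 1 ≤ n) (hk : 1 ≤ k) :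
    1 / ((n + k).choose k : ℝ)
      = ∑ r ∈ Finset.Icc 1 k, (-1 : ℝ) ^ (r + 1) * (r * k.choose r) / ((n : ℝ) + r) := by
  have hn' : (n : ℝ) ≠ 0 := by positivity
  have h := congrArg (fun t => (n : ℝ) * t) (one_div_mul_choose hn hk)
  simp only [Finset.mul_sum] at h
  have e : (n : ℝ) * (1 / ((n : ℝ) * ((n + k).choose k : ℝ))) = 1 / ((n + k).choose k : ℝ) := by
    field_simp
  rw [← e, h]
  refine Finset.sum_congr rfl fun r _ => ?_
  have : (n : ℝ) + r ≠ 0 := by positivity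
  field_simp
  ring

/-- Convergence is only conditional, so the sums are exchanged at a finite N before the limit. The
sign (-1)^(r+1) of the partial fraction merges with (-1)^(n+1) into (-1)^(n+r). -/
lemma isAltSum_zero {m : List ℕ} {c : ℕ → ℝ} {f : ℕ → ℝ} {k : ℕ} (hk : 1 ≤ k)
    (hm : ∀ n, (m.map fun i => genHarmonic i n).prod = c n)
    (hc : ∀ r, HasAltShift c (r + 1) (f (r + 1))) :
    IsAltSum m 0 k (∑ r ∈ Finset.Icc 1 k, (r : ℝ) * (k.choose r : ℝ) * f r) := by
  have h : Tendsto (fun N => ∑ r ∈ Finset.Icc 1 k, (r : ℝ) * (k.choose r : ℝ) * altShift c r N) atTop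
      (𝓝 (∑ r ∈ Finset.Icc 1 k, (r : ℝ) * (k.choose r : ℝ) * f r)) := by
    refine tendsto_finsetSum _ fun r hr => ?_
    obtain ⟨s, rfl⟩ : ∃ s, r = s + 1 := ⟨r - 1, by have := (Finset.mem_Icc.1 hr).1; omega⟩
    exact Tendsto.const_mul _ (hc s)
  refine h.congr fun N => ?_
  simp only [altSumPartial, altShift, Finset.mul_sum]
  rw [Finset.sum_comm]
  refine Finset.sum_congr rfl fun n hn => ?_
  rw [hm, pow_zero, one_mul, div_eq_mul_one_div, one_div_choose (Finset.mem_Icc.1 hn).1 hk,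
    Finset.mul_sum, Finset.sum_mul]
  refine Finset.sum_congr rfl fun r _ => ?_
  rw [pow_add, pow_add, pow_add]
  ring

lemma isAltSum_one {m : List ℕ} {c : ℕ → ℝ} {f : ℕ → ℝ} {b : ℝ} {k : ℕ} (hk : 1 ≤ k)
    (hm : ∀ n, (m.map fun i => genHarmonic i n).prod = c n) (hb : HasAltShift c 0 (-b))
    (hc : ∀ r, HasAltShift c (r + 1) (f (r + 1))) :
    IsAltSum m 1 k (∑ r ∈ Finset.Icc 1 k, (-1 : ℝ) ^ (r + 1) * (k.choose r : ℝ) *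
      (b - (-1 : ℝ) ^ (r + 1) * f r)) := by
  have h : Tendsto (fun N => ∑ r ∈ Finset.Icc 1 k, (-1 : ℝ) ^ (r + 1) * (k.choose r : ℝ) *
      (-altShift c 0 N - (-1 : ℝ) ^ (r + 1) * altShift c r N)) atTop
      (𝓝 (∑ r ∈ Finset.Icc 1 k, (-1 : ℝ) ^ (r + 1) * (k.choose r : ℝ) *
      (- -b - (-1 : ℝ) ^ (r + 1) * f r))) := by
    refine tendsto_finsetSum _ fun r hr => ?_
    obtain ⟨s, rfl⟩ : ∃ s, r = s + 1 := ⟨r - 1, by have := (Finset.mem_Icc.1 hr).1; omega⟩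
    exact ((Tendsto.neg hb).sub (Tendsto.const_mul _ (hc s))).const_mul _
  rw [neg_neg] at h
  refine h.congr fun N => ?_
  simp only [altSumPartial, altShift, Finset.mul_sum, ← Finset.sum_neg_distrib,
    ← Finset.sum_sub_distrib]
  rw [Finset.sum_comm]
  refine Finset.sum_congr rfl fun n hn => ?_
  rw [hm, pow_one, div_eq_mul_one_div (c n) (_ * _), one_div_mul_choose (Finset.mem_Icc.1 hn).1 hk,
    Finset.mul_sum, Finset.sum_mul]
  refine Finset.sum_congr rfl fun r _ => ?_
  simp only [Nat.cast_zero, add_zero]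
  have hs : ((-1 : ℝ) ^ r) * (-1) ^ r = 1 := by rw [← mul_pow]; simp
  rw [pow_add, pow_add, pow_add]
  generalize (-1 : ℝ) ^ r = s at *
  linear_combination (-(c n * (-1) ^ n / (n + r) * s * k.choose r)) * hs

end partialFractions

/-! ### Spans filtered by weight and depth. -/

section span

/-- Rational combinations of monomials of weight at most `w` and depth at most `d`. -/
def gradedSpan (w d : ℕ) : Submodule ℚ ℝ :=
  Submodule.span ℚ {x : ℝ | ∃ w' d' : ℕ, w' ≤ w ∧ d' ≤ d ∧ StarMonomial w' d' x}

lemma StarMonomial.mul {w d w' d' : ℕ} {x y : ℝ} (hx : StarMonomial w d x)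
    (hy : StarMonomial w' d' y) : StarMonomial (w + w') (d + d') (x * y) := by
  induction hx with
  | one => simpa using hy
  | zeta_mul m hm _ ih =>
    rw [add_assoc, add_assoc, mul_assoc]
    exact .zeta_mul m hm ih
  | starSum_mul n s hs _ ih =>
    rw [add_assoc, add_assoc, mul_assoc]
    exact .starSum_mul n s hs ih
  | starLim_mul s hs v hv _ ih =>
    rw [add_assoc, add_assoc, mul_assoc]
    exact .starLim_mul s hs v hv ih

lemma gradedSpan_mono {w d w' d' : ℕ} (hw : w ≤ w') (hd : d ≤ d') :
    gradedSpan w d ≤ gradedSpan w' d' :=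
  Submodule.span_mono fun _ ⟨a, b, ha, hb, h⟩ => ⟨a, b, ha.trans hw, hb.trans hd, h⟩

lemma mem_gradedSpan_mul {w d w' d' : ℕ} {x y : ℝ} (hx : x ∈ gradedSpan w d)
    (hy : y ∈ gradedSpan w' d') : x * y ∈ gradedSpan (w + w') (d + d') := by
  have h := Submodule.mul_mem_mul hx hy
  rw [gradedSpan, gradedSpan, Submodule.span_mul_span] at h
  refine Submodule.span_mono ?_ h
  rintro _ ⟨x, ⟨a, b, ha, hb, hx⟩, y, ⟨a', b', ha', hb', hy⟩, rfl⟩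
  exact ⟨_, _, add_le_add ha ha', add_le_add hb hb', hx.mul hy⟩

lemma mem_gradedSpan_pow {w d : ℕ} {x : ℝ} (hx : x ∈ gradedSpan w d) (n : ℕ) :
    x ^ n ∈ gradedSpan (n * w) (n * d) := by
  induction n with
  | zero =>
    have : (1 : ℝ) ∈ gradedSpan 0 0 := Submodule.subset_span ⟨0, 0, le_rfl, le_rfl, .one⟩
    simpa using this
  | succ n ih => simpa [pow_succ, add_mul] using mem_gradedSpan_mul ih hx

lemma mem_starSpan_of_le {w d : ℕ} {x : ℝ} (hx : x ∈ gradedSpan w d) (hw : w ≤ 4 := by norm_num)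
    (hd : d ≤ 4 := by norm_num) :
    x ∈ starSpan := gradedSpan_mono hw hd hx

lemma zetaVal_mem {m : ℕ} (hm : 2 ≤ m) : zetaVal m ∈ gradedSpan m 1 :=
  Submodule.subset_span ⟨_, _, le_rfl, le_rfl, by simpa using StarMonomial.zeta_mul m hm .one⟩

lemma starSum_mem (n : ℕ) {s : List ℤ} {w d : ℕ} (hs : ∀ a ∈ s, a ≠ 0 := by simp)
    (hw : starWeight s = w := by simp [starWeight]) (hd : s.length = d := by simp) : starSum n s ∈ gradedSpan w d :=
  Submodule.subset_span ⟨w, d, le_rfl, le_rfl, by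
    simpa [hw, hd] using StarMonomial.starSum_mul n s hs .one⟩

lemma starLim_mem {s : List ℤ} {w d : ℕ} (hs : ∀ a ∈ s, a ≠ 0) (hw : starWeight s = w)
    (hd : s.length = d) {v : ℝ} (hv : Tendsto (fun n => starSum n s) atTop (𝓝 v)) :
    v ∈ gradedSpan w d :=
  Submodule.subset_span ⟨w, d, le_rfl, le_rfl, by
    simpa [hw, hd] using StarMonomial.starLim_mul s hs v hv .one⟩

/-- A star sum with a negative first entry is itself an alternating partial sum of shift 0, whose
denominator supplies the last of the k + 1 powers of n. -/
lemma HasAltShift.tendsto_starSum {k : ℕ} {s : ℤ} {t : List ℤ} {c : ℕ → ℝ} {x : ℝ} (hc : HasAltShift c 0 x)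
    (hs : s = -((k + 1 : ℕ) : ℤ)) (h : ∀ n, 1 ≤ n → c n = starSum n t / (n : ℝ) ^ k) :
    Tendsto (fun n => starSum n (s :: t)) atTop (𝓝 x) := by
  subst hs
  refine Tendsto.congr (fun N => ?_) hc
  simp only [altShift, starSum]
  refine Finset.sum_congr rfl fun n hn => ?_
  rw [h n (Finset.mem_Icc.1 hn).1, Int.sign_neg, Int.sign_natCast_of_ne_zero (by omega),
    Int.natAbs_neg, Int.natAbs_natCast, pow_succ]
  simp
  ring

/-- Indeed ln 2 = -ζ⋆(-1), of weight and depth one. -/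
lemma log_two_mem : Real.log 2 ∈ gradedSpan 1 1 := by
  have h : Tendsto (fun n => starSum n [-1]) atTop (𝓝 (-Real.log 2)) :=
    hasAltShift_one.tendsto_starSum (k := 0) (t := []) (by norm_num) fun n _ => by simp [starSum]
  have h2 : -Real.log 2 ∈ gradedSpan 1 1 :=
    starLim_mem (by simp) (by simp [starWeight]) (by simp) h
  exact (Submodule.neg_mem_iff (gradedSpan 1 1)).1 h2

lemma ratCast_mem (q : ℚ) : (q : ℝ) ∈ gradedSpan 0 0 := by
  have h : (1 : ℝ) ∈ gradedSpan 0 0 := Submodule.subset_span ⟨0, 0, le_rfl, le_rfl, .one⟩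
  simpa [Rat.smul_def] using (gradedSpan 0 0).smul_mem q h

lemma mem_starSpan_ratMul {w d : ℕ} {x : ℝ} (q : ℚ) (hx : x ∈ gradedSpan w d)
    {a : ℝ} (ha : (q : ℝ) = a := by norm_num) (hw : w ≤ 4 := by norm_num)
    (hd : d ≤ 4 := by norm_num) : a * x ∈ starSpan := by
  have := (gradedSpan w d).smul_mem q hx
  rw [Rat.smul_def, ha] at this
  exact mem_starSpan_of_le this hw hd

end span

/-! ### Membership of the closed forms in the span. -/

section membership

lemma shiftClosed12_mem (r : ℕ) : shiftClosed12 r ∈ starSpan := by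
  have z2 := zetaVal_mem (m := 2) le_rfl
  have z3 := zetaVal_mem (m := 3) (by norm_num)
  have z4 := zetaVal_mem (m := 4) (by norm_num)
  have l := log_two_mem
  have l2 := mem_gradedSpan_pow l 2
  have n1 : starSum (r - 1) [-1] ∈ gradedSpan 1 1 := starSum_mem _
  have p1 : starSum (r - 1) [1] ∈ gradedSpan 1 1 := starSum_mem _
  have n2 : starSum (r - 1) [-2] ∈ gradedSpan 2 1 := starSum_mem _
  have p2 : starSum (r - 1) [2] ∈ gradedSpan 2 1 := starSum_mem _
  have n3 : starSum (r - 1) [-3] ∈ gradedSpan 3 1 := starSum_mem _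
  have p3 : starSum (r - 1) [3] ∈ gradedSpan 3 1 := starSum_mem _
  have n31 : starSum (r - 1) [3, -1] ∈ gradedSpan 4 2 := starSum_mem _
  have n121 : starSum (r - 1) [1, 2, -1] ∈ gradedSpan 4 3 := starSum_mem _
  have n211 : starSum (r - 1) [2, 1, -1] ∈ gradedSpan 4 3 := starSum_mem _
  have n11 : starSum (r - 1) [1, -1] ∈ gradedSpan 2 2 := starSum_mem _
  have n21 : starSum (r - 1) [2, -1] ∈ gradedSpan 3 2 := starSum_mem _
  have p21 : starSum (r - 1) [2, 1] ∈ gradedSpan 3 2 := starSum_mem _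
  have n12 : starSum (r - 1) [1, -2] ∈ gradedSpan 3 2 := starSum_mem _
  have p12 : starSum (r - 1) [1, 2] ∈ gradedSpan 3 2 := starSum_mem _
  unfold shiftClosed12
  rw [genHarmonic_one_eq_starSum]
  simp only [mul_assoc]
  refine sub_mem (sub_mem (add_mem (sub_mem (add_mem (add_mem (add_mem (add_mem (sub_mem (sub_mem
    (sub_mem (add_mem (add_mem (sub_mem ?_ ?_) ?_) ?_) ?_) ?_) ?_) ?_) ?_) ?_) ?_) ?_) ?_) ?_) ?_
  · exact mem_starSpan_ratMul (-(5 / 16)) z4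
  · exact mem_starSpan_ratMul (1 / 4) (mem_gradedSpan_mul z2 l2)
  · exact mem_starSpan_ratMul (7 / 8) (mem_gradedSpan_mul z3 l)
  · exact mem_starSpan_ratMul (7 / 8) (mem_gradedSpan_mul z3 n1)
  · exact mem_starSpan_ratMul (1 / 4) (mem_gradedSpan_mul z3 p1)
  · exact mem_starSpan_ratMul (1 / 2) (mem_gradedSpan_mul z2 n2)
  · exact mem_starSpan_of_le n31
  · exact mem_starSpan_of_le n121
  · exact mem_starSpan_ratMul (1 / 2) (mem_gradedSpan_mul z2 n11)
  · exact mem_starSpan_of_le n211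
  · exact mem_starSpan_of_le (mem_gradedSpan_mul l (sub_mem n3 p3))
  · exact mem_starSpan_ratMul (1 / 2) (mem_gradedSpan_mul l (mem_gradedSpan_mul z2 (sub_mem n1 p1)))
  · exact mem_starSpan_ratMul (1 / 2) (mem_gradedSpan_mul l2 (sub_mem n2 p2))
  · exact mem_starSpan_of_le (mem_gradedSpan_mul l (sub_mem n21 p21))
  · exact mem_starSpan_of_le (mem_gradedSpan_mul l (sub_mem n12 p12))

lemma shiftClosed111_mem (r : ℕ) : shiftClosed111 r ∈ starSpan := by
  have z2 := zetaVal_mem (m := 2) le_rfl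
  have z3 := zetaVal_mem (m := 3) (by norm_num)
  have z4 := zetaVal_mem (m := 4) (by norm_num)
  have l := log_two_mem
  have l2 := mem_gradedSpan_pow l 2
  have l3 := mem_gradedSpan_pow l 3
  have l4 := mem_gradedSpan_pow l 4
  have n1 : starSum (r - 1) [-1] ∈ gradedSpan 1 1 := starSum_mem _
  have p1 : starSum (r - 1) [1] ∈ gradedSpan 1 1 := starSum_mem _
  have n2 : starSum (r - 1) [-2] ∈ gradedSpan 2 1 := starSum_mem _
  have p2 : starSum (r - 1) [2] ∈ gradedSpan 2 1 := starSum_mem _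
  have n3 : starSum (r - 1) [-3] ∈ gradedSpan 3 1 := starSum_mem _
  have p3 : starSum (r - 1) [3] ∈ gradedSpan 3 1 := starSum_mem _
  have n31 : starSum (r - 1) [3, -1] ∈ gradedSpan 4 2 := starSum_mem _
  have n121 : starSum (r - 1) [1, 2, -1] ∈ gradedSpan 4 3 := starSum_mem _
  have n211 : starSum (r - 1) [2, 1, -1] ∈ gradedSpan 4 3 := starSum_mem _
  have n1111 : starSum (r - 1) [1, 1, 1, -1] ∈ gradedSpan 4 4 := starSum_mem _
  have n11 : starSum (r - 1) [1, -1] ∈ gradedSpan 2 2 := starSum_mem _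
  have p11 : starSum (r - 1) [1, 1] ∈ gradedSpan 2 2 := starSum_mem _
  have n21 : starSum (r - 1) [2, -1] ∈ gradedSpan 3 2 := starSum_mem _
  have p21 : starSum (r - 1) [2, 1] ∈ gradedSpan 3 2 := starSum_mem _
  have n12 : starSum (r - 1) [1, -2] ∈ gradedSpan 3 2 := starSum_mem _
  have p12 : starSum (r - 1) [1, 2] ∈ gradedSpan 3 2 := starSum_mem _
  have n111 : starSum (r - 1) [1, 1, -1] ∈ gradedSpan 3 3 := starSum_mem _
  have p111 : starSum (r - 1) [1, 1, 1] ∈ gradedSpan 3 3 := starSum_mem _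
  -- The two terms have depths 3 and 2; the second is raised to depth 3 so that the bracket can be
  -- multiplied by a depth one sum.
  have hc : Real.log 2 ^ 3 - 3 / 2 * (Real.log 2 * zetaVal 2) ∈ gradedSpan 3 3 := by
    refine sub_mem l3 ?_
    have h := gradedSpan_mono (w' := 3) (d' := 3) (by norm_num) (by norm_num)
      (mem_gradedSpan_mul (ratCast_mem (3 / 2)) (mem_gradedSpan_mul l z2))
    norm_num at h
    exact h
  unfold shiftClosed111
  rw [genHarmonic_one_eq_starSum]
  simp only [mul_assoc]
  refine add_mem (add_mem (sub_mem (add_mem (sub_mem (sub_mem (add_mem (sub_mem (add_mem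
    (add_mem (sub_mem (add_mem (sub_mem (sub_mem (add_mem (add_mem (sub_mem (add_mem ?_ ?_) ?_)
    ?_) ?_) ?_) ?_) ?_) ?_) ?_) ?_) ?_) ?_) ?_) ?_) ?_) ?_) ?_) ?_
  · exact mem_starSpan_ratMul (-(5 / 16)) z4
  · exact mem_starSpan_ratMul (9 / 8) (mem_gradedSpan_mul z3 l)
  · exact mem_starSpan_ratMul (3 / 4) (mem_gradedSpan_mul z2 l2)
  · exact mem_starSpan_ratMul (1 / 4) l4
  · exact mem_starSpan_ratMul (9 / 8) (mem_gradedSpan_mul z3 n1)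
  · exact mem_starSpan_ratMul (1 / 2) (mem_gradedSpan_mul z2 n2)
  · exact mem_starSpan_of_le n31
  · exact mem_starSpan_ratMul (3 / 2) (mem_gradedSpan_mul z2 n11)
  · exact mem_starSpan_ratMul (3 / 4) (mem_gradedSpan_mul z3 p1)
  · exact mem_starSpan_ratMul (3) n121
  · exact mem_starSpan_ratMul (3) n211
  · exact mem_starSpan_ratMul (6) n1111
  · exact mem_starSpan_of_le (mem_gradedSpan_mul l (sub_mem n3 p3))
  · exact mem_starSpan_ratMul (3) (mem_gradedSpan_mul l (sub_mem n21 p21))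
  · exact mem_starSpan_ratMul (3) (mem_gradedSpan_mul l (sub_mem n12 p12))
  · exact mem_starSpan_ratMul (6) (mem_gradedSpan_mul l (sub_mem n111 p111))
  · exact mem_starSpan_ratMul (3) (mem_gradedSpan_mul l2 (sub_mem n11 p11))
  · exact mem_starSpan_ratMul (3 / 2) (mem_gradedSpan_mul l2 (sub_mem n2 p2))
  · exact mem_starSpan_of_le (mem_gradedSpan_mul hc (sub_mem n1 p1))

lemma baseClosed111_mem : baseClosed111 ∈ starSpan := by
  have z2 := zetaVal_mem (m := 2) le_rfl
  have z3 := zetaVal_mem (m := 3) (by norm_num)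
  have z4 := zetaVal_mem (m := 4) (by norm_num)
  have l := log_two_mem
  have l2 := mem_gradedSpan_pow l 2
  have l4 := mem_gradedSpan_pow l 4
  unfold baseClosed111
  simp only [mul_assoc]
  refine sub_mem (sub_mem (add_mem ?_ ?_) ?_) ?_
  · exact mem_starSpan_ratMul (5 / 8) z4
  · exact mem_starSpan_ratMul (3 / 4) (mem_gradedSpan_mul z2 l2)
  · exact mem_starSpan_ratMul (1 / 4) l4
  · exact mem_starSpan_ratMul (9 / 8) (mem_gradedSpan_mul z3 l)

/-- Its formula contains Li_4(1/2), which is not a permitted factor. Instead the sum over `diff12`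
is written through the limits ζ⋆(-3,1), ζ⋆(-2,2), ζ⋆(-4), and the shift from 0 to 1, read backwards,
expresses the constant by these and `shiftClosed12 1`. -/
lemma baseClosed12_mem : baseClosed12 ∈ starSpan := by
  obtain ⟨x, hx⟩ := exists_H_div_div
  obtain ⟨y, hy⟩ := exists_H2_div
  obtain ⟨z, hz⟩ := exists_inv_pow 2
  have hd : HasAltShift diff12 0 (x + y - z) := (hx.add hy).sub hz
  have hxm : x ∈ gradedSpan 4 2 := starLim_mem (s := [-3, 1]) (by simp) (by simp [starWeight]) (by simp) <|
    hx.tendsto_starSum (k := 2) (by norm_num) fun n _ => by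
      rw [← genHarmonic_one_eq_starSum, div_div, sq]
  have hym : y ∈ gradedSpan 4 2 := starLim_mem (s := [-2, 2]) (by simp) (by simp [starWeight]) (by simp) <|
    hy.tendsto_starSum (k := 1) (by norm_num) fun n _ => by
      simp [genHarmonic, starSum, show Int.sign 2 = 1 from rfl]
  have hzm : z ∈ gradedSpan 4 1 := starLim_mem (s := [-4]) (by simp) (by simp [starWeight]) (by simp) <|
    hz.tendsto_starSum (k := 3) (by norm_num) fun n _ => by
      rw [starSum_nil]
  have h := HasAltShift.unique (hasAltShift_shiftClosed12 0)
    (HasAltShift.succ (by simp [genHarmonic]) mul_succ_eq_add_diff12 hasAltShift_base12 hd)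
  have e : baseClosed12 = -(x + y - z) - shiftClosed12 1 := by
    rw [zero_add] at h
    linarith
  rw [e]
  exact sub_mem (neg_mem (sub_mem (add_mem (mem_starSpan_of_le hxm)
    (mem_starSpan_of_le hym)) (mem_starSpan_of_le hzm))) (shiftClosed12_mem 1)

lemma sum_mem_starSpan {k : ℕ} {f : ℕ → ℝ} (q : ℕ → ℚ) {a : ℕ → ℝ} (hq : ∀ r, a r = (q r : ℝ))
    (hf : ∀ r, f r ∈ starSpan) : ∑ r ∈ Finset.Icc 1 k, a r * f r ∈ starSpan := by
  refine sum_mem fun r _ => ?_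
  rw [hq, ← Rat.smul_def]
  exact starSpan.smul_mem _ (hf r)

lemma sum_mem_starSpan_zero {k : ℕ} {f : ℕ → ℝ} (hf : ∀ r, f r ∈ starSpan) :
    ∑ r ∈ Finset.Icc 1 k, (r : ℝ) * (k.choose r : ℝ) * f r ∈ starSpan :=
  sum_mem_starSpan (fun r => (r : ℚ) * k.choose r) (fun r => by push_cast; rfl) hf

lemma sum_mem_starSpan_one {k : ℕ} {f : ℕ → ℝ} {b : ℝ} (hb : b ∈ starSpan)
    (hf : ∀ r, f r ∈ starSpan) : ∑ r ∈ Finset.Icc 1 k, (-1 : ℝ) ^ (r + 1) * (k.choose r : ℝ) *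
      (b - (-1 : ℝ) ^ (r + 1) * f r) ∈ starSpan := by
  refine sum_mem_starSpan (fun r => (-1) ^ (r + 1) * (k.choose r : ℚ)) (fun r => by push_cast; rfl)
    fun r => sub_mem hb ?_
  have := starSpan.smul_mem ((-1 : ℚ) ^ (r + 1)) (hf r)
  rw [Rat.smul_def] at this
  push_cast at this
  exact this

end membership
end

theorem theorem4p1 (k : ℕ) (hk : 1 ≤ k) :
    -- the explicit closed forms
    (IsAltSum [1, 2] 0 k
        (∑ r ∈ Finset.Icc 1 k, (r : ℝ) * (k.choose r : ℝ) * shiftClosed12 r) ∧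
      IsAltSum [1, 1, 1] 0 k
        (∑ r ∈ Finset.Icc 1 k, (r : ℝ) * (k.choose r : ℝ) * shiftClosed111 r) ∧
      IsAltSum [1, 2] 1 k
        (∑ r ∈ Finset.Icc 1 k, (-1 : ℝ) ^ (r + 1) * (k.choose r : ℝ) *
          (baseClosed12 - (-1 : ℝ) ^ (r + 1) * shiftClosed12 r)) ∧
      IsAltSum [1, 1, 1] 1 k
        (∑ r ∈ Finset.Icc 1 k, (-1 : ℝ) ^ (r + 1) * (k.choose r : ℝ) *
          (baseClosed111 - (-1 : ℝ) ^ (r + 1) * shiftClosed111 r))) ∧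
    -- the sums are rational linear combinations of the stated kind
    (∀ p : ℕ, p = 0 ∨ p = 1 →
      (∃ w ∈ starSpan, IsAltSum [1, 2] p k w) ∧
      (∃ w ∈ starSpan, IsAltSum [1, 1, 1] p k w)) := by
  have h12 : ∀ n, (([1, 2] : List ℕ).map fun i => genHarmonic i n).prod
      = genHarmonic 1 n * genHarmonic 2 n := fun n => by simp
  have h111 : ∀ n, (([1, 1, 1] : List ℕ).map fun i => genHarmonic i n).prod
      = genHarmonic 1 n ^ 3 := fun n => by simp; ring
  have a0 := isAltSum_zero hk h12 hasAltShift_shiftClosed12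
  have b0 := isAltSum_zero hk h111 hasAltShift_shiftClosed111
  have a1 := isAltSum_one hk h12 hasAltShift_base12 hasAltShift_shiftClosed12
  have b1 := isAltSum_one hk h111 hasAltShift_base111 hasAltShift_shiftClosed111
  refine ⟨⟨a0, b0, a1, b1⟩, ?_⟩
  rintro p (rfl | rfl)
  · exact ⟨⟨_, sum_mem_starSpan_zero shiftClosed12_mem, a0⟩,
      ⟨_, sum_mem_starSpan_zero shiftClosed111_mem, b0⟩⟩
  · exact ⟨⟨_, sum_mem_starSpan_one baseClosed12_mem shiftClosed12_mem, a1⟩,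
      ⟨_, sum_mem_starSpan_one baseClosed111_mem shiftClosed111_mem, b1⟩⟩
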